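/- Let $T\subset\mathbb{R}^2$ be a nondegenerate triangle with vertices $x_0,x_1,x_2$ and barycentric coordinates $\lambda=(\lambda_0,\lambda_1,\lambda_2)$; identify a point of $T$ with its triple of barycentric coordinates. Let $r\ge 2$ be an integer. For a subcell $S$ of $T$ (a vertex, an edge, or $T$ itself) and $0\le k\le\dim S$ let $X^k(S)=\mathcal{P}_{r-k}\Lambda^k(S)$ be the space of differential $k$-forms on $S$ whose coefficients are polynomials of degree at most $r-k$, and let $\mathring{X}^k(S)$ be the subspace of the forms with zero trace on the boundary of $S$ (so $\mathring{X}^0(S)=X^0(S)$ if $S$ is a vertex). For a form $\omega$ and an oriented $k$-cell $s$ write $w(\omega,s)=\int_s\omega$. For $\xi\in T$ let $\tau_\xi(x)=\lambda_0(\xi)\,x+\lambda_1(\xi)\,x_1+\lambda_2(\xi)\,x_2$. Define $\Gamma_2=\{(1,0,0)\}$ and, for $m>2$, $\Gamma_m=\tau_{\zeta_m}(\Gamma_{m-1})\cup\Delta_m$, where $$\zeta_m=\Bigl(\tfrac{m-1}{m},0,\tfrac1m\Bigr),\qquad \Delta_m=\Bigl\{\tfrac1m(i,m-i,0): 1\le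 i\le m,\ i\ne\tfrac{m+1}{2}\Bigr\}\qquad\text{if } m \text{ is odd},$$ $$\zeta_m=\Bigl(\tfrac{m-1}{m},\tfrac1m,0\Bigr),\qquad \Delta_m=\Bigl\{\tfrac1m(i,0,m-i): 1\le i\le m,\ i\ne\tfrac{m}{2}\Bigr\}\qquad\text{if } m \text{ is even}.$$ Define the following sets of cells. - $\mathcal{F}^0(T)$ is the principal lattice: the points with barycentric coordinates $\alpha/r$, where $\alpha\in\mathbb{N}^3$ and $\alpha_0+\alpha_1+\alpha_2=r$. - $\mathcal{F}^2(T)$ is the set of the regions $$s_\xi=\overline{\tau_\xi(T)\setminus\bigcup_{\eta\in\Gamma_r,\ \lambda_0(\eta)<\lambda_0(\xi)}\tau_\eta(T)},\qquad \xi\in\Gamma_r.$$ - $\mathcal{F}^1(T)$ is the set of those edges of the small triangles $z_\alpha(T)$, where $z_\alpha(x)=\frac1r\bigl(x+\sum_i\alpha_i x_i\bigr)$, $\alpha\in\mathbb{N}^3$, $\alpha_0+\alpha_1+\alpha_2=r-1$, that lie on the boundary of some cell of $\mathcal{F}^2(T)$. For a subcell $S$ of $T$ let $\mathring{\mathcal{F}}^k(S)$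 be the set of the cells of $\mathcal{F}^k(T)$ that are contained in $S$ but in no proper subcell of $S$. Then $\mathcal{F}$ is a unisolvent and minimal physical system of degrees of freedom. That is, for each subcell $S$ of $T$ and each $0\le k\le\dim S$, the set $\mathring{\mathcal{F}}^k(S)$ is a finite set of non-overlapping $k$-cells in $S$; the only $\omega\in\mathring{X}^k(S)$ with $w(\omega,s)=0$ for all $s\in\mathring{\mathcal{F}}^k(S)$ is $\omega=0$; and $\lvert\mathring{\mathcal{F}}^k(S)\rvert=\dim\mathring{X}^k(S)$. Moreover, for $k=0,1,2$, $\mathcal{F}^k(T)=\bigcup_{S}\mathring{\mathcal{F}}^k(S)$ (the union over all subcells $S$ of $T$) is a finite set of non-overlapping $k$-cells, the only $\omega\in\mathcal{P}_{r-k}\Lambda^k(T)$ with $w(\omega,s)=0$ for all $s\in\mathcal{F}^k(T)$ is $\omega=0$, and $\lvert\mathcal{F}^k(T)\rvert=\dim\mathcal{P}_{r-k}\Lambda^k(T)$. -/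

import Mathlib

namespace PhysicalDofs

noncomputable section

/-! ## Polynomial differential forms -/

/-- The Euclidean plane. -/
abbrev Plane : Type := EuclideanSpace ℝ (Fin 2)

/-- Differential `k`-forms on the plane (no regularity is built in). -/
abbrev Form (k : ℕ) : Type := Plane → Plane [⋀^Fin k]→L[ℝ] ℝ

/-- Real polynomial functions of degree at most `m` on the plane. -/
def polyFun (m : ℕ) : Submodule ℝ (Plane → ℝ) :=
  (MvPolynomial.restrictTotalDegree (Fin 2) ℝ m).map
    (LinearMap.pi fun x : Plane => (MvPolynomial.aeval (fun i : Fin 2 => x i)).toLinearMap)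

/-- `P_m Λ^k`: the `k`-forms whose coefficients are polynomials of degree at most `m`. -/
def polyForm (m k : ℕ) : Submodule ℝ (Form k) where
  carrier := {ω | ∀ v : Fin k → Plane, (fun x => ω x v) ∈ polyFun m}
  add_mem' ha hb v := (polyFun m).add_mem (ha v) (hb v)
  zero_mem' _ := (polyFun m).zero_mem
  smul_mem' c _ h v := (polyFun m).smul_mem c (h v)

/-! ## A triangle, its subcells, and forms on them

The subcells of a triangle `T` are the simplices spanned by the nonempty subsets `S` of its set
of vertices; `S` has dimension `S.card - 1`, and `S = Finset.univ` is `T` itself. -/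

variable (T : Affine.Triangle ℝ Plane)

/-- The closed subcell of `T` with vertex set `S`. -/
def subcell (S : Finset (Fin 3)) : Set Plane :=
  convexHull ℝ (T.points '' (S : Set (Fin 3)))

/-- The tangent space of a subcell. -/
abbrev tangent (S : Finset (Fin 3)) : Submodule ℝ Plane :=
  vectorSpan ℝ (T.points '' (S : Set (Fin 3)))

/-- Differential `k`-forms on a subcell. -/
abbrev FormOn (S : Finset (Fin 3)) (k : ℕ) : Type :=
  subcell T S → tangent T S [⋀^Fin k]→L[ℝ] ℝ

/-- The pullback (trace) of a `k`-form to a subcell, under the inclusion of the subcell. -/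
def trace (S : Finset (Fin 3)) (k : ℕ) : Form k →ₗ[ℝ] FormOn T S k :=
  LinearMap.pi fun p =>
    (ContinuousAlternatingMap.compContinuousLinearMapₗ (tangent T S).subtypeL).comp
      (LinearMap.proj (p : Plane))

/-- `X^k(S) = P_{r-k} Λ^k(S)`. -/
def X (r : ℕ) (S : Finset (Fin 3)) (k : ℕ) : Submodule ℝ (FormOn T S k) :=
  (polyForm (r - k) k).map (trace T S k)

/-- The subspace of the forms in `X^k(S)` that have zero trace on the boundary of `S`, that is,
on every proper subcell of `S`. -/
def X0 (r : ℕ) (S : Finset (Fin 3)) (k : ℕ) : Submodule ℝ (FormOn T S k) :=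
  (polyForm (r - k) k ⊓ ⨅ (S' : Finset (Fin 3)) (_ : S'.Nonempty ∧ S' ⊂ S),
    LinearMap.ker (trace T S' k)).map (trace T S k)

/-! ## Cells and weights -/

/-- The `k`-cells used as degrees of freedom in the plane: points, oriented straight edges, and
plane regions (with the orientation of the plane). -/
inductive Cell : ℕ → Type
  | point (p : Plane) : Cell 0
  | edge (p q : Plane) : Cell 1
  | face (c : Set Plane) : Cell 2

/-- The underlying closed set of a cell. -/
def Cell.carrier : {k : ℕ} → Cell k → Set Plane
  | _, .point p => {p}
  | _, .edge p q => segment ℝ p q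
  | _, .face c => c

/-- The relative interior of a cell. -/
def Cell.inner : {k : ℕ} → Cell k → Set Plane
  | _, .point p => {p}
  | _, .edge p q => openSegment ℝ p q
  | _, .face c => interior c

/-- Edges have two distinct endpoints; a region is a `2`-cell if it is a closed topological
disc. -/
def Cell.IsCell : {k : ℕ} → Cell k → Prop
  | _, .point _ => True
  | _, .edge p q => p ≠ q
  | _, .face c => Nonempty (c ≃ₜ Metric.closedBall (0 : Plane) 1)

/-- The weight `w(ω, s) = ∫_s ω` of a `k`-form on a `k`-cell. For a cell contained in a subcell `S`
it depends only on the pullback of `ω` to `S`. -/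
def weight : {k : ℕ} → Form k → Cell k → ℝ
  | _, ω, .point p => ω p ![]
  | _, ω, .edge p q => ∫ t in (0 : ℝ)..1, ω (AffineMap.lineMap p q t) ![q - p]
  | _, ω, .face c =>
      ∫ x in c, ω x ![EuclideanSpace.single 0 1, EuclideanSpace.single 1 1]

/-! ## Physical systems of degrees of freedom

A system assigns to each subcell `S` of `T` and each `k ≤ dim S` a set of `k`-cells in `S`. -/

/-- A system of cells on the subcells of the triangle. -/
abbrev CellSystem : Type := Finset (Fin 3) → (k : ℕ) → Set (Cell k)

/-- A physical system of degrees of freedom: finite sets of non-overlapping `k`-cells of `S`. -/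
def IsPhysicalSysdofs (F : CellSystem) : Prop :=
  ∀ (S : Finset (Fin 3)), S.Nonempty → ∀ k : ℕ, k < S.card →
    (F S k).Finite ∧ (∀ c ∈ F S k, c.IsCell ∧ c.carrier ⊆ subcell T S) ∧
      (F S k).PairwiseDisjoint Cell.inner

/-- The only form in the space `V` of `k`-forms on `S`, consisting of (traces of) polynomial forms
in `P_{r-k} Λ^k`, whose weights on all cells in `C` vanish is the zero form. -/
def Unisolves (r : ℕ) (S : Finset (Fin 3)) (k : ℕ) (V : Submodule ℝ (FormOn T S k))
    (C : Set (Cell k)) : Prop :=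
  ∀ ω ∈ polyForm (r - k) k, trace T S k ω ∈ V → (∀ c ∈ C, weight ω c = 0) → trace T S k ω = 0

/-- Unisolvence of a system: the weights determine the forms with zero trace, on each subcell. -/
def IsUnisolvent (r : ℕ) (F : CellSystem) : Prop :=
  ∀ (S : Finset (Fin 3)), S.Nonempty → ∀ k : ℕ, k < S.card →
    Unisolves T r S k (X0 T r S k) (F S k)

/-- Minimality of a system: there are as many cells as the dimension, on each subcell. -/
def IsMinimal (r : ℕ) (F : CellSystem) : Prop :=
  ∀ (S : Finset (Fin 3)), S.Nonempty → ∀ k : ℕ, k < S.card →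
    (F S k).ncard = Module.finrank ℝ (X0 T r S k)

/-- All the `k`-cells attached to the subcells of `S`. -/
def total (F : CellSystem) (S : Finset (Fin 3)) (k : ℕ) : Set (Cell k) :=
  ⋃ (S' : Finset (Fin 3)) (_ : S'.Nonempty ∧ S' ⊆ S), F S' k

/-! ## The construction -/

/-- The point of the plane with barycentric coordinates `l` with respect to `T`. -/
def pt (l : Fin 3 → ℝ) : Plane := ∑ i, l i • T.points i

/-- The map `τ_ξ` of the plane, where `ξ` is given by its barycentric coordinates. -/
def tau (ξ : Fin 3 → ℝ) (x : Plane) : Plane :=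
  ξ 0 • x + (ξ 1 • T.points 1 + ξ 2 • T.points 2)

/-- The map `τ_ξ` in barycentric coordinates. -/
def tauBary (ξ l : Fin 3 → ℝ) : Fin 3 → ℝ :=
  ξ 0 • l + ![0, ξ 1, ξ 2]

/-- `tauBary` is the expression of `tau` in barycentric coordinates. -/
theorem tau_pt (ξ l : Fin 3 → ℝ) : tau T ξ (pt T l) = pt T (tauBary ξ l) := by
  simp [tau, pt, tauBary, Fin.sum_univ_three, smul_add, add_smul, mul_smul]
  abel

/-- The point `ζ_r`, in barycentric coordinates. -/
def zeta (r : ℕ) : Fin 3 → ℝ :=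
  if Odd r then ![((r : ℝ) - 1) / r, 0, 1 / r] else ![((r : ℝ) - 1) / r, 1 / r, 0]

/-- The set `Δ_r`, in barycentric coordinates. -/
def Delta (r : ℕ) : Set (Fin 3 → ℝ) :=
  if Odd r then
    {l | ∃ i : ℕ, 1 ≤ i ∧ i ≤ r ∧ 2 * i ≠ r + 1 ∧ l = ![(i : ℝ) / r, ((r : ℝ) - i) / r, 0]}
  else
    {l | ∃ i : ℕ, 1 ≤ i ∧ i ≤ r ∧ 2 * i ≠ r ∧ l = ![(i : ℝ) / r, 0, ((r : ℝ) - i) / r]}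

/-- The set `Γ_r` (`r ≥ 2`), in barycentric coordinates. -/
def Gamma : ℕ → Set (Fin 3 → ℝ)
  | 0 => ∅
  | 1 => ∅
  | 2 => {![1, 0, 0]}
  | r + 3 => tauBary (zeta (r + 3)) '' Gamma (r + 2) ∪ Delta (r + 3)

/-- The scaled triangle `τ_ξ(T)`. -/
def scaledTriangle (ξ : Fin 3 → ℝ) : Set Plane :=
  tau T ξ '' subcell T Finset.univ

/-- The region `s_i` attached to the point `ξ = ξ_i` of `Γ_r`: the closure of the difference of
`τ_ξ(T)` and all `τ_η(T)` with `η ∈ Γ_r`, `λ_0(η) < λ_0(ξ)`. -/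
def region (r : ℕ) (ξ : Fin 3 → ℝ) : Set Plane :=
  closure (scaledTriangle T ξ \ ⋃ η ∈ {η ∈ Gamma r | η 0 < ξ 0}, scaledTriangle T η)

/-- The homothety `z_α` onto a small triangle, for a multi-index `α` of weight `r - 1`. -/
def homothety (r : ℕ) (α : Fin 3 → ℕ) (x : Plane) : Plane :=
  (1 / (r : ℝ)) • (x + ∑ i, (α i : ℝ) • T.points i)

/-- The cells `F^k(T)`: the principal lattice for `k = 0`; for `k = 1` the small edges (oriented by
the ordering of the vertices of `T`) that lie on the boundary of some region; the regions for
`k = 2`. -/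
def dofs (r : ℕ) : (k : ℕ) → Set (Cell k)
  | 0 => {c | ∃ α : Fin 3 → ℕ, ∑ i, α i = r ∧ c = .point (pt T fun i => (α i : ℝ) / r)}
  | 1 => {c | (∃ (α : Fin 3 → ℕ) (i j : Fin 3), ∑ l, α l = r - 1 ∧ i < j ∧
        c = .edge (homothety T r α (T.points i)) (homothety T r α (T.points j))) ∧
      ∃ ξ ∈ Gamma r, c.carrier ⊆ frontier (region T r ξ)}
  | 2 => {c | ∃ ξ ∈ Gamma r, c = .face (region T r ξ)}
  | _ + 3 => ∅

/-- The system `F`: a cell of `F^k(T)` is attached to the smallest subcell of `T` containing it. -/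
def system (r : ℕ) : CellSystem := fun S k =>
  {c ∈ dofs T r k | c.carrier ⊆ subcell T S ∧
    ∀ S' : Finset (Fin 3), S' ⊂ S → ¬ c.carrier ⊆ subcell T S'}

end

end PhysicalDofs

namespace PhysicalDofs

open MeasureTheory

/-! ## Polynomial functions of two real variables -/

/-! Scale barycentric coordinates: u = rλ₁, v = rλ₂ turn T into the triangle u, v ≥ 0, u + v ≤ r.
Put x = ⌊r/2⌋ and y = r - x. Then Γ_r is the set of lattice points (b, c) with b + c < r, b ≠ x, c ≠
y (`mem_Gamma_iff`): one column and one row are deleted, and they meet on the hypotenuse since x + y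
= r. The set τ_ξ(T) is the triangle with corner ξ below the line u + v = r, and s_ξ is the box from
(b, c) to the next admissible column and row, truncated by that line (`region_bary`). The 1-cells
are the unit horizontal edges off row y, the unit vertical edges off column x, and all unit edges of
the hypotenuse (`gridEdge_subset_frontier_iff`).

2-forms: by inclusion-exclusion, vanishing integrals over the regions give vanishing integrals over
all triangles with corner at a node. The mean of p over the triangle with corner z is a polynomial
in z, of degree at most r - 2 like p, and the nodes are unisolvent for that degree
(`eq_zero_of_nodes`), so the mean vanishes for every z. Letting z reach the hypotenuse shows that p
vanishes there; dividing by r - u - v and repeating with a weight gives p = 0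
(`eq_zero_of_weighted_integrals`).

1-forms: subtract dF, with F a primitive of the du-coefficient, to leave C dv. The boundary of every
node triangle is a union of 1-cells, so by Stokes ∂C/∂u has zero integral over these triangles and
vanishes by the previous case. The form is therefore exact, with a potential of degree at most r;
the edges connect all lattice points, so the potential is constant on the principal lattice, hence
constant (`eq_zero_of_integral_edges`). For 0-forms, unisolvence of the lattice is enough.

Proper subcells: retract the vertices of T onto those of S and apply the same coordinate statements
to the resulting degenerate triangle.

Counting: unisolvence bounds dim P_{r-k}Λ^k by the number of cells, and explicit injections of the
cells into monomial indices give the reverse bound. Hence weights on T can be prescribed freely.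
Prescribing zero outside the cells of F̊^k(S) produces forms with zero trace on the boundary of S,
which gives minimality on S. -/

/-- Polynomial functions of total degree at most `m` in two real variables. -/
def bipoly (m : ℕ) : Submodule ℝ (ℝ × ℝ → ℝ) :=
  Submodule.span ℝ {f | ∃ i j : ℕ, i + j ≤ m ∧ f = fun z => z.1 ^ i * z.2 ^ j}

theorem monomial_mem_bipoly {m i j : ℕ} (h : i + j ≤ m) :
    (fun z : ℝ × ℝ => z.1 ^ i * z.2 ^ j) ∈ bipoly m :=
  Submodule.subset_span ⟨i, j, h, rfl⟩

theorem bipoly_induction {m : ℕ} {C : (ℝ × ℝ → ℝ) → Prop}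
    (mono : ∀ i j : ℕ, i + j ≤ m → C fun z => z.1 ^ i * z.2 ^ j) (zero : C 0)
    (add : ∀ f g, C f → C g → C (f + g)) (smul : ∀ (a : ℝ) f, C f → C (a • f))
    {f : ℝ × ℝ → ℝ} (hf : f ∈ bipoly m) : C f := by
  refine Submodule.span_induction (p := fun f _ => C f) ?_ zero (fun f g _ _ => add f g)
    (fun a f _ => smul a f) hf
  rintro _ ⟨i, j, h, rfl⟩
  exact mono i j h

theorem bipoly_mono {m n : ℕ} (h : m ≤ n) : bipoly m ≤ bipoly n :=
  Submodule.span_mono fun _ ⟨i, j, hij, hf⟩ => ⟨i, j, hij.trans h, hf⟩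

theorem const_mem_bipoly (m : ℕ) (a : ℝ) : (fun _ : ℝ × ℝ => a) ∈ bipoly m := by
  have := (bipoly m).smul_mem a (monomial_mem_bipoly (m := m) (i := 0) (j := 0) (by simp))
  convert this using 1
  ext z; simp

theorem fst_mem_bipoly : (fun z : ℝ × ℝ => z.1) ∈ bipoly 1 := by
  simpa using monomial_mem_bipoly (m := 1) (i := 1) (j := 0) (by simp)

theorem snd_mem_bipoly : (fun z : ℝ × ℝ => z.2) ∈ bipoly 1 := by
  simpa using monomial_mem_bipoly (m := 1) (i := 0) (j := 1) (by simp)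

theorem mul_mem_bipoly {m n : ℕ} {f g : ℝ × ℝ → ℝ} (hf : f ∈ bipoly m) (hg : g ∈ bipoly n) :
    (fun z => f z * g z) ∈ bipoly (m + n) := by
  refine bipoly_induction (C := fun f => (fun z => f z * g z) ∈ bipoly (m + n)) ?_ ?_ ?_ ?_ hf
  · intro i j hij
    refine bipoly_induction
      (C := fun g => (fun z : ℝ × ℝ => z.1 ^ i * z.2 ^ j * g z) ∈ bipoly (m + n)) ?_ ?_ ?_ ?_ hg
    · intro k l hkl
      convert monomial_mem_bipoly (m := m + n) (i := i + k) (j := j + l) (by omega) using 1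
      ext z; ring
    · convert (bipoly (m + n)).zero_mem using 1
      ext z; simp
    · intro f g hf hg
      convert (bipoly (m + n)).add_mem hf hg using 1
      ext z; simp; ring
    · intro a f hf
      convert (bipoly (m + n)).smul_mem a hf using 1
      ext z; simp; ring
  · convert (bipoly (m + n)).zero_mem using 1
    ext z; simp
  · intro f g hf hg
    convert (bipoly (m + n)).add_mem hf hg using 1
    ext z; simp; ring
  · intro a f hf
    convert (bipoly (m + n)).smul_mem a hf using 1
    ext z; simp; ring

theorem pow_mem_bipoly {f : ℝ × ℝ → ℝ} (hf : f ∈ bipoly 1) (n : ℕ) :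
    (fun z => f z ^ n) ∈ bipoly n := by
  induction n with
  | zero => simpa using const_mem_bipoly 0 1
  | succ n ih => simpa [pow_succ] using mul_mem_bipoly ih hf

theorem prod_mem_bipoly {ι : Type*} (s : Finset ι) (f : ι → ℝ × ℝ → ℝ) (d : ι → ℕ)
    (hf : ∀ i ∈ s, f i ∈ bipoly (d i)) :
    (fun z => ∏ i ∈ s, f i z) ∈ bipoly (∑ i ∈ s, d i) := by
  classical
  induction s using Finset.induction_on with
  | empty => simpa using const_mem_bipoly 0 1
  | insert a s ha ih =>
    simp only [Finset.prod_insert ha, Finset.sum_insert ha]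
    exact mul_mem_bipoly (hf a (by simp)) (ih fun i hi => hf i (by simp [hi]))

theorem affine_mem_bipoly (a b c : ℝ) : (fun z : ℝ × ℝ => a + b * z.1 + c * z.2) ∈ bipoly 1 := by
  convert (bipoly 1).add_mem ((bipoly 1).add_mem (const_mem_bipoly 1 a)
    ((bipoly 1).smul_mem b fst_mem_bipoly)) ((bipoly 1).smul_mem c snd_mem_bipoly) using 1
  ext z; simp

theorem comp_mem_bipoly {m : ℕ} {f p q : ℝ × ℝ → ℝ} (hf : f ∈ bipoly m) (hp : p ∈ bipoly 1)
    (hq : q ∈ bipoly 1) : (fun z => f (p z, q z)) ∈ bipoly m := by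
  refine bipoly_induction (C := fun f => (fun z => f (p z, q z)) ∈ bipoly m) ?_ ?_ ?_ ?_ hf
  · intro i j hij
    exact bipoly_mono hij (mul_mem_bipoly (pow_mem_bipoly hp i) (pow_mem_bipoly hq j))
  · exact (bipoly m).zero_mem
  · intro f g hf hg
    exact (bipoly m).add_mem hf hg
  · intro a f hf
    exact (bipoly m).smul_mem a hf

theorem comp_mem_bipoly_of_mem_polyFun {m : ℕ} {f : Plane → ℝ} (hf : f ∈ polyFun m)
    {ψ : ℝ × ℝ → Plane} (hψ : ∀ i, (fun z => ψ z i) ∈ bipoly 1) :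
    (fun z => f (ψ z)) ∈ bipoly m := by
  obtain ⟨p, hp, rfl⟩ := hf
  rw [SetLike.mem_coe, MvPolynomial.mem_restrictTotalDegree] at hp
  have : (fun z => (LinearMap.pi fun x : Plane =>
      (MvPolynomial.aeval (R := ℝ) (fun i : Fin 2 => x i)).toLinearMap) p (ψ z)) =
      ∑ s ∈ p.support, p.coeff s • fun z => ∏ i : Fin 2, ψ z i ^ s i := by
    ext z
    simp only [LinearMap.pi_apply, AlgHom.toLinearMap_apply, Finset.sum_apply, Pi.smul_apply,
      smul_eq_mul]
    rw [MvPolynomial.aeval_def, MvPolynomial.eval₂_eq']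
    simp
  rw [this]
  refine Submodule.sum_mem _ fun s hs => Submodule.smul_mem _ _ ?_
  have h1 := prod_mem_bipoly (Finset.univ : Finset (Fin 2)) (fun i z => ψ z i ^ s i) (fun i => s i)
    fun i _ => pow_mem_bipoly (hψ i) _
  refine bipoly_mono ?_ h1
  refine le_trans ?_ ((MvPolynomial.le_totalDegree hs).trans hp)
  rw [Finsupp.sum_fintype _ _ (by simp)]

@[fun_prop]
theorem continuous_of_mem_bipoly {m : ℕ} {f : ℝ × ℝ → ℝ} (hf : f ∈ bipoly m) : Continuous f := by
  refine bipoly_induction (C := Continuous) ?_ continuous_zero ?_ ?_ hf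
  · intro i j _
    fun_prop
  · intro f g hf hg
    exact hf.add hg
  · intro a f hf
    exact hf.const_smul a

theorem exists_eval_fst_of_mem_bipoly {m : ℕ} {f : ℝ × ℝ → ℝ} (hf : f ∈ bipoly m) (c : ℝ) :
    ∃ q : Polynomial ℝ, q.natDegree ≤ m ∧ ∀ u, f (u, c) = q.eval u := by
  refine bipoly_induction (C := fun f => ∃ q : Polynomial ℝ, q.natDegree ≤ m ∧
    ∀ u, f (u, c) = q.eval u) ?_ ?_ ?_ ?_ hf
  · intro i j hij
    refine ⟨Polynomial.C (c ^ j) * Polynomial.X ^ i, ?_, fun u => by simp; ring⟩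
    exact (Polynomial.natDegree_C_mul_X_pow_le _ _).trans (by omega)
  · exact ⟨0, by simp, by simp⟩
  · rintro f g ⟨p, hp, hf⟩ ⟨q, hq, hg⟩
    exact ⟨p + q, Polynomial.natDegree_add_le_of_degree_le hp hq, fun u => by simp [hf, hg]⟩
  · rintro a f ⟨p, hp, hf⟩
    exact ⟨a • p, (Polynomial.natDegree_smul_le _ _).trans hp, fun u => by simp [hf]⟩

theorem eq_zero_on_line_of_card {m : ℕ} {f : ℝ × ℝ → ℝ} (hf : f ∈ bipoly m) (c : ℝ)
    (s : Finset ℝ) (hs : m < s.card) (h : ∀ u ∈ s, f (u, c) = 0) (u : ℝ) : f (u, c) = 0 := by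
  obtain ⟨q, hq, hfq⟩ := exists_eval_fst_of_mem_bipoly hf c
  have : q = 0 := Polynomial.eq_zero_of_natDegree_lt_card_of_eval_eq_zero' q s
    (fun v hv => by rw [← hfq]; exact h v hv) (hq.trans_lt hs)
  rw [hfq, this]; simp

/-- Division with remainder by v - c. The clause for `m = 0` is needed because `m - 1` is then `0`,
so membership alone would allow a nonzero constant quotient. -/
theorem exists_div_snd {m : ℕ} {f : ℝ × ℝ → ℝ} (hf : f ∈ bipoly m) (c : ℝ) :
    ∃ g ∈ bipoly (m - 1), (m = 0 → g = 0) ∧ ∀ u v, f (u, v) = f (u, c) + (v - c) * g (u, v) := by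
  refine bipoly_induction (C := fun f => ∃ g ∈ bipoly (m - 1), (m = 0 → g = 0) ∧
    ∀ u v, f (u, v) = f (u, c) + (v - c) * g (u, v)) ?_ ?_ ?_ ?_ hf
  · intro i j hij
    refine ⟨∑ k ∈ Finset.range j, c ^ (j - 1 - k) • fun z => z.1 ^ i * z.2 ^ k, ?_, ?_, ?_⟩
    · refine Submodule.sum_mem _ fun k hk => Submodule.smul_mem _ _ ?_
      rw [Finset.mem_range] at hk
      exact monomial_mem_bipoly (by omega)
    · intro hm
      obtain rfl : j = 0 := by omega
      simp
    · intro u v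
      have := geom_sum₂_mul v c j
      simp only [Finset.sum_apply, Pi.smul_apply, smul_eq_mul]
      have h2 : ∑ k ∈ Finset.range j, c ^ (j - 1 - k) * (u ^ i * v ^ k) =
          u ^ i * ∑ k ∈ Finset.range j, v ^ k * c ^ (j - 1 - k) := by
        rw [Finset.mul_sum]
        exact Finset.sum_congr rfl fun k _ => by ring
      rw [h2]
      linear_combination (-u ^ i) * this
  · exact ⟨0, Submodule.zero_mem _, fun _ => rfl, by simp⟩
  · rintro f g ⟨p, hp, hp0, hf⟩ ⟨q, hq, hq0, hg⟩
    refine ⟨p + q, Submodule.add_mem _ hp hq, fun hm => by simp [hp0 hm, hq0 hm], fun u v => ?_⟩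
    simp only [Pi.add_apply]
    rw [hf u v, hg u v]; ring
  · rintro a f ⟨p, hp, hp0, hf⟩
    refine ⟨a • p, Submodule.smul_mem _ _ hp, fun hm => by simp [hp0 hm], fun u v => ?_⟩
    simp only [Pi.smul_apply, smul_eq_mul]
    rw [hf u v]; ring

theorem exists_hasFDerivAt {m : ℕ} {f : ℝ × ℝ → ℝ} (hf : f ∈ bipoly m) :
    ∃ g ∈ bipoly (m - 1), ∃ h ∈ bipoly (m - 1), ∀ z, HasFDerivAt f
      (g z • ContinuousLinearMap.fst ℝ ℝ ℝ + h z • ContinuousLinearMap.snd ℝ ℝ ℝ) z := by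
  refine bipoly_induction (C := fun f => ∃ g ∈ bipoly (m - 1), ∃ h ∈ bipoly (m - 1),
    ∀ z, HasFDerivAt f
      (g z • ContinuousLinearMap.fst ℝ ℝ ℝ + h z • ContinuousLinearMap.snd ℝ ℝ ℝ) z)
    ?_ ?_ ?_ ?_ hf
  · intro i j hij
    refine ⟨(i : ℝ) • fun z => z.1 ^ (i - 1) * z.2 ^ j, ?_,
      (j : ℝ) • fun z => z.1 ^ i * z.2 ^ (j - 1), ?_, fun z => ?_⟩
    · rcases Nat.eq_zero_or_pos i with rfl | hi
      · simp
      · exact Submodule.smul_mem _ _ (monomial_mem_bipoly (by omega))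
    · rcases Nat.eq_zero_or_pos j with rfl | hj
      · simp
      · exact Submodule.smul_mem _ _ (monomial_mem_bipoly (by omega))
    · have h1 := (hasFDerivAt_fst (𝕜 := ℝ) (p := z)).pow i
      have h2 := (hasFDerivAt_snd (𝕜 := ℝ) (p := z)).pow j
      refine (h1.mul h2).congr_fderiv ?_
      ext <;> simp <;> ring
  · exact ⟨0, Submodule.zero_mem _, 0, Submodule.zero_mem _,
      fun z => (hasFDerivAt_const (0 : ℝ) z).congr_fderiv (by simp)⟩
  · rintro f₁ f₂ ⟨g₁, hg₁, h₁, hh₁, hf₁⟩ ⟨g₂, hg₂, h₂, hh₂, hf₂⟩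
    refine ⟨g₁ + g₂, Submodule.add_mem _ hg₁ hg₂, h₁ + h₂, Submodule.add_mem _ hh₁ hh₂,
      fun z => ((hf₁ z).add (hf₂ z)).congr_fderiv ?_⟩
    ext <;> simp
  · rintro a f ⟨g, hg, h, hh, hf⟩
    refine ⟨a • g, Submodule.smul_mem _ _ hg, a • h, Submodule.smul_mem _ _ hh,
      fun z => ((hf z).const_smul a).congr_fderiv ?_⟩
    ext <;> simp

theorem swap_mem_bipoly {m : ℕ} {f : ℝ × ℝ → ℝ} (hf : f ∈ bipoly m) :
    (fun z => f z.swap) ∈ bipoly m :=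
  comp_mem_bipoly hf snd_mem_bipoly fst_mem_bipoly

theorem exists_primitive_fst {m : ℕ} {f : ℝ × ℝ → ℝ} (hf : f ∈ bipoly m) :
    ∃ F ∈ bipoly (m + 1), ∀ u v, HasDerivAt (fun u => F (u, v)) (f (u, v)) u := by
  refine bipoly_induction (C := fun f => ∃ F ∈ bipoly (m + 1),
    ∀ u v, HasDerivAt (fun u => F (u, v)) (f (u, v)) u) ?_ ?_ ?_ ?_ hf
  · intro i j hij
    refine ⟨((i : ℝ) + 1)⁻¹ • fun z => z.1 ^ (i + 1) * z.2 ^ j, ?_, fun u v => ?_⟩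
    · exact Submodule.smul_mem _ _ (monomial_mem_bipoly (by omega))
    · have h := ((hasDerivAt_pow (i + 1) u).mul_const (v ^ j)).const_smul ((i : ℝ) + 1)⁻¹
      have hi : (i : ℝ) + 1 ≠ 0 := by positivity
      have e : ((i : ℝ) + 1)⁻¹ • (((i + 1 : ℕ) : ℝ) * u ^ (i + 1 - 1) * v ^ j) = u ^ i * v ^ j := by
        simp only [Nat.cast_add, Nat.cast_one, Nat.add_sub_cancel, smul_eq_mul]
        field_simp
      rw [e] at h
      exact h
  · exact ⟨0, Submodule.zero_mem _, fun u v => hasDerivAt_const _ _⟩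
  · rintro f g ⟨p, hp, hf⟩ ⟨q, hq, hg⟩
    exact ⟨p + q, Submodule.add_mem _ hp hq, fun u v => (hf u v).add (hg u v)⟩
  · rintro a f ⟨p, hp, hf⟩
    exact ⟨a • p, Submodule.smul_mem _ _ hp, fun u v => (hf u v).const_smul a⟩

theorem exists_primitive_snd {m : ℕ} {f : ℝ × ℝ → ℝ} (hf : f ∈ bipoly m) :
    ∃ F ∈ bipoly (m + 1), ∀ u v, HasDerivAt (fun v => F (u, v)) (f (u, v)) v := by
  obtain ⟨g, hg, h⟩ := exists_primitive_fst (swap_mem_bipoly hf)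
  exact ⟨_, swap_mem_bipoly hg, fun u v => h v u⟩

/-! ## Unisolvent sets of points -/

/-- A polynomial of degree at most `m` that has more than `m - j` zeros on the `j`-th of `m + 1`
parallel lines, `j = 0, …, m`, is zero. -/
theorem eq_zero_of_rows {m : ℕ} {f : ℝ × ℝ → ℝ} (hf : f ∈ bipoly m) (c : ℕ → ℝ)
    (hc : Function.Injective c)
    (h : ∀ j ≤ m, ∃ s : Finset ℝ, m - j < s.card ∧ ∀ u ∈ s, f (u, c j) = 0) : f = 0 := by
  induction m generalizing f c with
  | zero =>
    obtain ⟨g, -, hg0, hg⟩ := exists_div_snd hf (c 0)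
    obtain ⟨s, hs, hsf⟩ := h 0 le_rfl
    ext ⟨u, v⟩
    rw [hg, hg0 rfl, eq_zero_on_line_of_card hf _ s hs hsf]; simp
  | succ m ih =>
    obtain ⟨g, hgm, -, hg⟩ := exists_div_snd hf (c 0)
    obtain ⟨s, hs, hsf⟩ := h 0 (Nat.zero_le _)
    have h0 := eq_zero_on_line_of_card hf _ s hs hsf
    -- On the other lines v - c₀ is nonzero, so the quotient inherits the zeros; its degree bound
    -- and the number of lines both drop by one.
    have hg' : g = 0 := by
      refine ih hgm (fun j => c (j + 1)) (fun i j hij => by simpa using hc hij) fun j hj => ?_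
      obtain ⟨s, hs, hsf⟩ := h (j + 1) (by omega)
      refine ⟨s, by omega, fun u hu => ?_⟩
      have h1 := hg u (c (j + 1))
      rw [hsf u hu, h0, zero_add, eq_comm, mul_eq_zero, sub_eq_zero] at h1
      exact h1.resolve_left fun h => by simpa using hc h
    ext ⟨u, v⟩
    rw [hg, h0, hg']; simp

theorem eq_zero_of_lattice {m : ℕ} {f : ℝ × ℝ → ℝ} (hf : f ∈ bipoly m)
    (h : ∀ b c : ℕ, b + c ≤ m → f (b, c) = 0) : f = 0 := by
  refine eq_zero_of_rows hf (fun j => (j : ℝ)) Nat.cast_injective fun j hj => ?_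
  refine ⟨(Finset.range (m - j + 1)).map Nat.castEmbedding, by simp, fun u hu => ?_⟩
  simp only [Finset.mem_map, Finset.mem_range, Nat.castEmbedding_apply] at hu
  obtain ⟨b, hb, rfl⟩ := hu
  exact h b j (by omega)

/-- The nodes `(b, c)` of the integer triangle of size `x + y` with `b ≠ x` and `c ≠ y`. -/
def IsNode (x y b c : ℕ) : Prop := b + c < x + y ∧ b ≠ x ∧ c ≠ y

/-- Below row y a row loses exactly the node in column x; above row y that column is already outside
the triangle. After skipping row y, the j-th row therefore always has m + 1 - j nodes. -/
theorem eq_zero_of_nodes {m x y : ℕ} (hxy : x + y = m + 2) {f : ℝ × ℝ → ℝ} (hf : f ∈ bipoly m)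
    (h : ∀ b c : ℕ, IsNode x y b c → f (b, c) = 0) : f = 0 := by
  refine eq_zero_of_rows hf (fun j => ((if j < y then j else j + 1 : ℕ) : ℝ)) ?_ fun j hj => ?_
  · intro i j hij
    have : (if i < y then i else i + 1) = if j < y then j else j + 1 := by
      beta_reduce at hij
      exact_mod_cast hij
    split_ifs at this <;> omega
  · refine ⟨((Finset.range (m + 2 - if j < y then j else j + 1)).erase x).map Nat.castEmbedding,
      ?_, fun u hu => ?_⟩
    · rw [Finset.card_map]
      split_ifs with hj
      · rw [Finset.card_erase_of_mem (by simp; omega)]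
        simp; omega
      · refine lt_of_lt_of_le ?_ (Finset.card_le_card (s := Finset.range (m + 1 - j)) ?_)
        · simp; omega
        · intro b hb
          simp at hb ⊢
          omega
    · simp only [Finset.mem_map, Finset.mem_erase, Finset.mem_range, Nat.castEmbedding_apply] at hu
      obtain ⟨b, ⟨hb, hb'⟩, rfl⟩ := hu
      refine h b _ ⟨?_, hb, ?_⟩ <;> split_ifs at hb' ⊢ <;> omega

/-! ## Integrals of polynomials over triangles -/

/-- Evaluation on `N` is injective on `bipoly m`, so it has a linear left inverse; composing this
with evaluation at `ξ` yields the coefficients. -/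
theorem exists_evaluation_eq_sum {m : ℕ} (N : Finset (ℝ × ℝ))
    (hN : ∀ f ∈ bipoly m, (∀ z ∈ N, f z = 0) → f = 0) (ξ : ℝ × ℝ) :
    ∃ w : ℝ × ℝ → ℝ, ∀ f ∈ bipoly m, f ξ = ∑ z ∈ N, w z * f z := by
  let E : bipoly m →ₗ[ℝ] (N → ℝ) :=
    LinearMap.pi fun z => (LinearMap.proj (z : ℝ × ℝ)).comp (bipoly m).subtype
  have hE : LinearMap.ker E = ⊥ := by
    rw [LinearMap.ker_eq_bot']
    intro f hf
    exact Subtype.ext (hN f f.2 fun z hz => congrFun hf ⟨z, hz⟩)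
  obtain ⟨G, hG⟩ := E.exists_leftInverse_of_injective hE
  classical
  let L : (N → ℝ) →ₗ[ℝ] ℝ := ((LinearMap.proj ξ).comp (bipoly m).subtype).comp G
  refine ⟨fun z => if hz : z ∈ N then L (Pi.single ⟨z, hz⟩ 1) else 0, fun f hf => ?_⟩
  have h1 : f ξ = L (E ⟨f, hf⟩) := by
    have := LinearMap.congr_fun hG ⟨f, hf⟩
    simp only [LinearMap.comp_apply, LinearMap.id_apply] at this
    simp [L, this]
  rw [h1, LinearMap.pi_apply_eq_sum_univ L, ← Finset.sum_coe_sort N]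
  refine Finset.sum_congr rfl fun z _ => ?_
  simp only [z.2, dite_true, smul_eq_mul, mul_comm (L _)]
  congr 2
  ext w
  simp [Pi.single_apply, eq_comm]

/-- If the polynomials `f s` have mean value zero at a unisolvent set of nodes, then they have mean
value zero everywhere. -/
theorem setIntegral_eq_zero_of_nodes {m : ℕ} (N : Finset (ℝ × ℝ))
    (hN : ∀ f ∈ bipoly m, (∀ z ∈ N, f z = 0) → f = 0) {K : Set (ℝ × ℝ)} (hK : IsCompact K)
    (f : ℝ × ℝ → ℝ × ℝ → ℝ) (hf : ∀ s, f s ∈ bipoly m) (hc : ∀ z, Continuous fun s => f s z)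
    (h : ∀ z ∈ N, ∫ s in K, f s z = 0) (ξ : ℝ × ℝ) : ∫ s in K, f s ξ = 0 := by
  obtain ⟨w, hw⟩ := exists_evaluation_eq_sum N hN ξ
  -- The coefficients `w` do not depend on `s`, so the finite sum can be taken out of the integral.
  simp_rw [fun s => hw (f s) (hf s)]
  rw [integral_finsetSum]
  · refine Finset.sum_eq_zero fun z hz => ?_
    rw [integral_const_mul, h z hz, mul_zero]
  · intro z _
    exact ((hc z).continuousOn.integrableOn_compact hK).const_mul (w z)

/-- The right-angled triangle with vertices `(b, c)`, `(r - c, c)`, `(b, r - b)`. -/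
def rightTriangle (r b c : ℝ) : Set (ℝ × ℝ) := {z | b ≤ z.1 ∧ c ≤ z.2 ∧ z.1 + z.2 ≤ r}

theorem isClosed_rightTriangle (r b c : ℝ) : IsClosed (rightTriangle r b c) :=
  (isClosed_le continuous_const continuous_fst).inter
    ((isClosed_le continuous_const continuous_snd).inter
      (isClosed_le (continuous_fst.add continuous_snd) continuous_const))

theorem isCompact_rightTriangle (r b c : ℝ) : IsCompact (rightTriangle r b c) := by
  refine (isCompact_Icc (a := (b, c)) (b := (r - c, r - b))).of_isClosed_subset
    (isClosed_rightTriangle r b c) ?_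
  rintro ⟨u, v⟩ ⟨h1, h2, h3⟩
  simp only at h1 h2 h3
  exact ⟨⟨h1, h2⟩, ⟨by simp only; linarith, by simp only; linarith⟩⟩

/-- The homothety from the unit triangle fixes the domain of integration, so the corner enters only
through the integrand. -/
theorem setIntegral_rightTriangle_eq {r b c : ℝ} (h : b + c < r) (p : ℝ × ℝ → ℝ) :
    ∫ z in rightTriangle r b c, p z =
      (r - b - c) ^ 2 * ∫ s in rightTriangle 1 0 0,
        p (b + (r - b - c) * s.1, c + (r - b - c) * s.2) := by
  have ha : 0 < r - b - c := by linarith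
  have e1 : ∀ s : ℝ × ℝ, (rightTriangle 1 0 0).indicator
      (fun s => p (b + (r - b - c) * s.1, c + (r - b - c) * s.2)) s =
      (fun z => (rightTriangle r b c).indicator p ((b, c) + z)) ((r - b - c) • s) := by
    intro s
    simp only [Set.indicator]
    have : s ∈ rightTriangle 1 0 0 ↔ (b, c) + (r - b - c) • s ∈ rightTriangle r b c := by
      simp only [rightTriangle, Set.mem_ofPred_eq, Prod.fst_add, Prod.snd_add, Prod.smul_fst,
        Prod.smul_snd, smul_eq_mul, le_add_iff_nonneg_right, mul_nonneg_iff_of_pos_left ha]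
      refine and_congr Iff.rfl (and_congr Iff.rfl ?_)
      constructor <;> intro h <;> nlinarith
    by_cases hs : s ∈ rightTriangle 1 0 0
    · rw [if_pos hs, if_pos (this.1 hs)]; rfl
    · rw [if_neg hs, if_neg (mt this.2 hs)]
  rw [← integral_indicator (isClosed_rightTriangle _ _ _).measurableSet,
    ← integral_indicator (isClosed_rightTriangle _ _ _).measurableSet]
  simp_rw [e1]
  rw [Measure.integral_comp_smul_of_nonneg volume
    (fun z => (rightTriangle r b c).indicator p ((b, c) + z)) (r - b - c) (hR := ha.le),
    integral_add_left_eq_self]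
  have : Module.finrank ℝ (ℝ × ℝ) = 2 := by simp
  rw [this, smul_eq_mul, ← mul_assoc, mul_inv_cancel₀ (by positivity), one_mul]

/-- Nonvanishing of this weight lets it be cancelled when the triangle degenerates to a point of the
hypotenuse. -/
theorem setIntegral_height_pow_pos (i : ℕ) :
    0 < ∫ s in rightTriangle 1 0 0, (1 - s.1 - s.2 : ℝ) ^ i := by
  have hm := (isClosed_rightTriangle 1 0 0).measurableSet
  rw [setIntegral_pos_iff_support_of_nonneg_ae]
  · refine lt_of_lt_of_le ?_ (measure_mono (s := {z : ℝ × ℝ | 0 < z.1} ∩ ({z | 0 < z.2} ∩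
      {z | z.1 + z.2 < 1})) ?_)
    · refine IsOpen.measure_pos _ ?_ ⟨(1 / 3, 1 / 3), by norm_num⟩
      exact (isOpen_lt continuous_const continuous_fst).inter
        ((isOpen_lt continuous_const continuous_snd).inter
          (isOpen_lt (continuous_fst.add continuous_snd) continuous_const))
    · rintro ⟨u, v⟩ ⟨h1, h2, h3⟩
      simp only [Set.mem_ofPred_eq] at h1 h2 h3
      refine ⟨?_, h1.le, h2.le, h3.le⟩
      simp only [Function.mem_support]
      exact pow_ne_zero _ (by linarith)
  · filter_upwards [ae_restrict_mem hm] with z hz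
    have := hz.2.2
    exact pow_nonneg (by linarith) _
  · exact (Continuous.continuousOn (by fun_prop)).integrableOn_compact
      (isCompact_rightTriangle 1 0 0)

/-- For fixed `s` the substitution is affine in `z`, so means over the rescaled triangles keep the
degree bound in the corner. -/
theorem scale_mem_bipoly {m : ℕ} {p : ℝ × ℝ → ℝ} (hp : p ∈ bipoly m) (r : ℝ) (s : ℝ × ℝ) :
    (fun z : ℝ × ℝ => p (z.1 + (r - z.1 - z.2) * s.1, z.2 + (r - z.1 - z.2) * s.2)) ∈ bipoly m := by
  refine comp_mem_bipoly hp ?_ ?_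
  · convert affine_mem_bipoly (r * s.1) (1 - s.1) (-s.1) using 1
    ext z; ring
  · convert affine_mem_bipoly (r * s.2) (-s.2) (1 - s.2) using 1
    ext z; ring

theorem continuous_scale {m : ℕ} {p : ℝ × ℝ → ℝ} (hp : p ∈ bipoly m) (r : ℝ) (z : ℝ × ℝ) :
    Continuous fun s : ℝ × ℝ =>
      p (z.1 + (r - z.1 - z.2) * s.1, z.2 + (r - z.1 - z.2) * s.2) :=
  (continuous_of_mem_bipoly hp).comp (by fun_prop)

def latticeFinset (m : ℕ) : Finset (ℝ × ℝ) :=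
  ((Finset.range (m + 1) ×ˢ Finset.range (m + 1)).filter fun z => z.1 + z.2 ≤ m).map
    ⟨fun z => ((z.1 : ℝ), (z.2 : ℝ)), fun z w h => by
      simp only [Prod.mk.injEq, Nat.cast_inj] at h
      exact Prod.ext h.1 h.2⟩

theorem mem_latticeFinset {m : ℕ} {z : ℝ × ℝ} :
    z ∈ latticeFinset m ↔ ∃ b c : ℕ, b + c ≤ m ∧ z = ((b : ℝ), (c : ℝ)) := by
  simp only [latticeFinset, Finset.mem_map, Finset.mem_filter, Finset.mem_product,
    Finset.mem_range, Prod.exists]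
  constructor
  · rintro ⟨b, c, ⟨_, h⟩, rfl⟩
    exact ⟨b, c, h, rfl⟩
  · rintro ⟨b, c, h, rfl⟩
    exact ⟨b, c, ⟨⟨by omega, by omega⟩, h⟩, rfl⟩

/-- A polynomial whose weighted mean values over all the triangles homothetic to a given one with a
side on a fixed line vanish is zero. -/
theorem eq_zero_of_weighted_integrals {m r i : ℕ} (hm : m < r) {p : ℝ × ℝ → ℝ} (hp : p ∈ bipoly m)
    (h : ∀ z : ℝ × ℝ, r - z.1 - z.2 ≠ 0 → ∫ s in rightTriangle 1 0 0, (1 - s.1 - s.2) ^ i *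
      p (z.1 + (r - z.1 - z.2) * s.1, z.2 + (r - z.1 - z.2) * s.2) = 0) : p = 0 := by
  induction m using Nat.strong_induction_on generalizing i p with
  | _ m ih =>
  -- The condition on `z` is removed: the integral is a polynomial of degree at most m in z, and the
  -- lattice of size m < r avoids the line u + v = r.
  have h1 : ∀ z : ℝ × ℝ, ∫ s in rightTriangle 1 0 0, (1 - s.1 - s.2) ^ i *
      p (z.1 + (r - z.1 - z.2) * s.1, z.2 + (r - z.1 - z.2) * s.2) = 0 := by
    intro z
    refine setIntegral_eq_zero_of_nodes (m := m) (latticeFinset m) ?_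
      (isCompact_rightTriangle 1 0 0) (fun s z => (1 - s.1 - s.2) ^ i *
      p (z.1 + (r - z.1 - z.2) * s.1, z.2 + (r - z.1 - z.2) * s.2)) ?_ ?_ ?_ z
    · intro f hf hz
      exact eq_zero_of_lattice hf fun b c hbc => hz _ (mem_latticeFinset.2 ⟨b, c, hbc, rfl⟩)
    · intro s
      exact (bipoly m).smul_mem _ (scale_mem_bipoly hp r s)
    · intro z
      exact (by fun_prop : Continuous fun s : ℝ × ℝ => (1 - s.1 - s.2) ^ i).mul
        (continuous_scale hp r z)
    · intro z hz
      obtain ⟨b, c, hbc, rfl⟩ := mem_latticeFinset.1 hz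
      refine h _ (ne_of_gt ?_)
      have : ((b + c : ℕ) : ℝ) < r := by exact_mod_cast (by omega : b + c < r)
      push_cast at this
      simp only
      linarith
  -- On the hypotenuse the scaling factor is 0, so the integrand is the value of `p` at the corner
  -- times the weight.
  have h2 : ∀ u v : ℝ, u + v = r → p (u, v) = 0 := by
    intro u v huv
    have h3 := h1 (u, v)
    have h4 : (r : ℝ) - u - v = 0 := by linarith
    simp only [h4, zero_mul, add_zero] at h3
    rw [integral_mul_const] at h3
    exact (mul_eq_zero.1 h3).resolve_left (setIntegral_height_pow_pos i).ne'
  have hφ : (fun z : ℝ × ℝ => r - z.1 - z.2) ∈ bipoly 1 := by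
    convert affine_mem_bipoly r (-1) (-1) using 1
    ext z; ring
  -- In the coordinates (u, r - u - v) the hypotenuse is the line where the second coordinate is 0,
  -- so r - u - v can be divided out.
  obtain ⟨g, hg, hg0, hpg⟩ := exists_div_snd (comp_mem_bipoly hp fst_mem_bipoly hφ) 0
  have hg' : (fun z : ℝ × ℝ => g (z.1, r - z.1 - z.2)) ∈ bipoly (m - 1) :=
    comp_mem_bipoly hg fst_mem_bipoly hφ
  have hp' : ∀ u v : ℝ, p (u, v) = (r - u - v) * g (u, r - u - v) := by
    intro u v
    have := hpg u (r - u - v)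
    simp only [sub_zero, h2 u (r - u) (by ring), zero_add] at this
    rw [← this]
    congr 2; ring
  have hzero : (fun z : ℝ × ℝ => g (z.1, r - z.1 - z.2)) = 0 := by
    rcases Nat.eq_zero_or_pos m with hm0 | hm0
    · ext z; simp [hg0 hm0]
    · refine ih (m - 1) (by omega) (i := i + 1) (by omega) hg' fun z hz => ?_
      have h3 := h z hz
      simp only [hp'] at h3
      -- At the rescaled point the factor r - u - v equals (r - z₁ - z₂)(1 - s₁ - s₂): it
      -- contributes a constant and one more power of the weight.
      have h4 : ∀ s : ℝ × ℝ, (1 - s.1 - s.2) ^ i * ((r - (z.1 + (r - z.1 - z.2) * s.1) -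
          (z.2 + (r - z.1 - z.2) * s.2)) * g (z.1 + (r - z.1 - z.2) * s.1,
          r - (z.1 + (r - z.1 - z.2) * s.1) - (z.2 + (r - z.1 - z.2) * s.2))) =
          (r - z.1 - z.2) * ((1 - s.1 - s.2) ^ (i + 1) * g (z.1 + (r - z.1 - z.2) * s.1,
          r - (z.1 + (r - z.1 - z.2) * s.1) - (z.2 + (r - z.1 - z.2) * s.2))) := by
        intro s; ring
      simp_rw [h4] at h3
      rw [integral_const_mul] at h3
      exact (mul_eq_zero.1 h3).resolve_left hz
  ext ⟨u, v⟩
  have := congrFun hzero (u, v)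
  rw [hp']
  simp only [Pi.zero_apply] at this ⊢
  rw [this, mul_zero]

def nodeFinset (x y : ℕ) : Finset (ℝ × ℝ) :=
  ((Finset.range (x + y) ×ˢ Finset.range (x + y)).filter fun z =>
      z.1 + z.2 < x + y ∧ z.1 ≠ x ∧ z.2 ≠ y).map
    ⟨fun z => ((z.1 : ℝ), (z.2 : ℝ)), fun z w h => by
      simp only [Prod.mk.injEq, Nat.cast_inj] at h
      exact Prod.ext h.1 h.2⟩

theorem mem_nodeFinset {x y : ℕ} {z : ℝ × ℝ} :
    z ∈ nodeFinset x y ↔ ∃ b c : ℕ, IsNode x y b c ∧ z = ((b : ℝ), (c : ℝ)) := by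
  simp only [nodeFinset, Finset.mem_map, Finset.mem_filter, Finset.mem_product,
    Finset.mem_range, Prod.exists]
  constructor
  · rintro ⟨b, c, ⟨_, h⟩, rfl⟩
    exact ⟨b, c, h, rfl⟩
  · rintro ⟨b, c, h, rfl⟩
    exact ⟨b, c, ⟨⟨by have := h.1; omega, by have := h.1; omega⟩, h⟩, rfl⟩

/-- Integrals over the triangles at the nodes determine polynomials of degree `x + y - 2`. -/
theorem eq_zero_of_integral_rightTriangle {m x y r : ℕ} (hxy : x + y = r) (hm : m + 2 = r)
    {p : ℝ × ℝ → ℝ} (hp : p ∈ bipoly m)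
    (h : ∀ b c : ℕ, IsNode x y b c → ∫ z in rightTriangle r b c, p z = 0) : p = 0 := by
  refine eq_zero_of_weighted_integrals (i := 0) (r := r) (by omega) hp fun z _ => ?_
  simp only [pow_zero, one_mul]
  refine setIntegral_eq_zero_of_nodes (nodeFinset x y) ?_
      (isCompact_rightTriangle 1 0 0) (fun s z =>
      p (z.1 + (r - z.1 - z.2) * s.1, z.2 + (r - z.1 - z.2) * s.2))
      (scale_mem_bipoly hp r) (continuous_scale hp r) ?_ z
  · intro f hf hz
    exact eq_zero_of_nodes (hxy.trans hm.symm) hf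
      fun b c hbc => hz _ (mem_nodeFinset.2 ⟨b, c, hbc, rfl⟩)
  · intro z hz
    obtain ⟨b, c, hbc, rfl⟩ := mem_nodeFinset.1 hz
    have h1 : ((b + c : ℕ) : ℝ) < r := by exact_mod_cast (hbc.1.trans_eq hxy)
    push_cast at h1
    have h2 := h b c hbc
    rw [setIntegral_rightTriangle_eq h1, mul_eq_zero] at h2
    refine h2.resolve_left (pow_ne_zero _ ?_)
    linarith

/-! ## The regions of the construction, in coordinates -/

/-- The smallest number greater than `b` and different from `x`. -/
def next (x b : ℕ) : ℕ := if b + 1 = x then b + 2 else b + 1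

theorem lt_next (x b : ℕ) : b < next x b := by unfold next; split_ifs <;> omega

theorem next_ne (x b : ℕ) : next x b ≠ x := by unfold next; split_ifs <;> omega

theorem next_le {x b d : ℕ} (h : b < d) (hd : d ≠ x) : next x b ≤ d := by
  unfold next; split_ifs <;> omega

/-- The box `[b, b'] × [c, c']` truncated by the line `u + v = r`. -/
def truncatedBox (r b b' c c' : ℝ) : Set (ℝ × ℝ) :=
  {z | b ≤ z.1 ∧ z.1 ≤ b' ∧ c ≤ z.2 ∧ z.2 ≤ c' ∧ z.1 + z.2 ≤ r}

theorem volume_line_fst (b : ℝ) : volume {z : ℝ × ℝ | z.1 = b} = 0 := by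
  have : {z : ℝ × ℝ | z.1 = b} = {b} ×ˢ Set.univ := by ext; simp
  rw [this, Measure.volume_eq_prod, Measure.prod_prod]; simp

theorem volume_line_snd (c : ℝ) : volume {z : ℝ × ℝ | z.2 = c} = 0 := by
  have : {z : ℝ × ℝ | z.2 = c} = Set.univ ×ˢ {c} := by ext; simp
  rw [this, Measure.volume_eq_prod, Measure.prod_prod]; simp

/-- Inclusion-exclusion: the box is, up to the null lines u = b' and v = c', what remains of the
large triangle after removing the two shifted ones, whose intersection is the fourth triangle. -/
theorem setIntegral_rightTriangle_decompose {r b b' c c' : ℝ} (hb : b ≤ b') (hc : c ≤ c')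
    {p : ℝ × ℝ → ℝ} (hp : Continuous p) :
    ∫ z in rightTriangle r b c, p z = (∫ z in truncatedBox r b b' c c', p z) +
      (∫ z in rightTriangle r b' c, p z) + (∫ z in rightTriangle r b c', p z) -
      ∫ z in rightTriangle r b' c', p z := by
  have hm : ∀ b c, MeasurableSet (rightTriangle r b c) :=
    fun b c => (isClosed_rightTriangle r b c).measurableSet
  have hi : ∀ b c, IntegrableOn p (rightTriangle r b c) :=
    fun b c => hp.continuousOn.integrableOn_compact (isCompact_rightTriangle r b c)
  have hinter : rightTriangle r b c' ∩ rightTriangle r b' c = rightTriangle r b' c' := by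
    ext z
    constructor
    · rintro ⟨⟨h1, h2, h3⟩, h4, h5, h6⟩
      exact ⟨h4, h2, h3⟩
    · rintro ⟨h1, h2, h3⟩
      exact ⟨⟨hb.trans h1, h2, h3⟩, h1, hc.trans h2, h3⟩
  have hU : rightTriangle r b' c ∪ rightTriangle r b c' ⊆ rightTriangle r b c := by
    rintro z (⟨h1, h2, h3⟩ | ⟨h1, h2, h3⟩)
    · exact ⟨hb.trans h1, h2, h3⟩
    · exact ⟨h1, hc.trans h2, h3⟩
  have e1 : ∫ z in rightTriangle r b c \ (rightTriangle r b' c ∪ rightTriangle r b c'), p z =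
      (∫ z in rightTriangle r b c, p z) -
        ∫ z in rightTriangle r b' c ∪ rightTriangle r b c', p z :=
    setIntegral_sdiff ((hm _ _).union (hm _ _)) (hi _ _) hU
  have e2 : ∫ z in rightTriangle r b' c ∪ rightTriangle r b c', p z =
      (∫ z in rightTriangle r b' c, p z) +
        ∫ z in rightTriangle r b c' \ rightTriangle r b' c', p z := by
    rw [← hinter, Set.sdiff_self_inter, ← Set.union_sdiff_self]
    exact setIntegral_union Set.disjoint_sdiff_right ((hm _ _).diff (hm _ _)) (hi _ _)
      ((hi _ _).mono_set Set.sdiff_subset)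
  have e3 : ∫ z in rightTriangle r b c' \ rightTriangle r b' c', p z =
      (∫ z in rightTriangle r b c', p z) - ∫ z in rightTriangle r b' c', p z :=
    setIntegral_sdiff (hm _ _) (hi _ _) (hinter ▸ Set.inter_subset_left)
  have e4 : ∫ z in truncatedBox r b b' c c', p z =
      ∫ z in rightTriangle r b c \ (rightTriangle r b' c ∪ rightTriangle r b c'), p z := by
    refine setIntegral_congr_set (Filter.eventuallyEq_set.2 ?_)
    have n1 : ∀ᵐ z : ℝ × ℝ, z.1 ≠ b' := by
      rw [ae_iff]; simpa using volume_line_fst b'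
    have n2 : ∀ᵐ z : ℝ × ℝ, z.2 ≠ c' := by
      rw [ae_iff]; simpa using volume_line_snd c'
    filter_upwards [n1, n2] with z h1 h2
    simp only [truncatedBox, rightTriangle, Set.mem_ofPred_eq, Set.mem_sdiff, Set.mem_union]
    constructor
    · rintro ⟨a1, a2, a3, a4, a5⟩
      refine ⟨⟨a1, a3, a5⟩, ?_⟩
      rintro (⟨d1, -⟩ | ⟨-, d1, -⟩)
      · exact h1 (le_antisymm a2 d1)
      · exact h2 (le_antisymm a4 d1)
    · rintro ⟨⟨a1, a2, a3⟩, a4⟩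
      push Not at a4
      refine ⟨a1, ?_, a2, ?_, a3⟩
      · by_contra! h
        linarith [a4.1 h.le a2]
      · by_contra! h
        linarith [a4.2 a1 h.le]
  rw [e4, e1, e2, e3]; ring

theorem setIntegral_rightTriangle_of_le {r b c : ℝ} (h : r ≤ b + c) (p : ℝ × ℝ → ℝ) :
    ∫ z in rightTriangle r b c, p z = 0 := by
  refine setIntegral_measure_zero _ (measure_mono_null (t := {z : ℝ × ℝ | z.1 = b}) ?_
    (volume_line_fst b))
  rintro z ⟨h1, h2, h3⟩
  exact le_antisymm (by linarith) h1

/-- Integrals over the regions determine polynomials of degree `x + y - 2`. -/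
theorem eq_zero_of_integral_truncatedBox {m x y r : ℕ} (hxy : x + y = r) (hm : m + 2 = r)
    {p : ℝ × ℝ → ℝ} (hp : p ∈ bipoly m)
    (h : ∀ b c : ℕ, IsNode x y b c →
      ∫ z in truncatedBox r b (next x b) c (next y c), p z = 0) : p = 0 := by
  -- Descending induction on b + c, with `n` bounding the distance to the hypotenuse; `next` keeps
  -- the corners of the three smaller triangles admissible.
  have key : ∀ n b c : ℕ, r ≤ b + c + n → b ≠ x → c ≠ y →
      ∫ z in rightTriangle r b c, p z = 0 := by
    intro n
    induction n with
    | zero =>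
      intro b c hbc _ _
      exact setIntegral_rightTriangle_of_le (by exact_mod_cast hbc) p
    | succ n ih =>
      intro b c hbc hb hc
      rcases le_or_gt r (b + c) with h1 | h1
      · exact setIntegral_rightTriangle_of_le (by exact_mod_cast h1) p
      · have lb := lt_next x b
        have lc := lt_next y c
        rw [setIntegral_rightTriangle_decompose (b' := next x b) (c' := next y c)
          (by exact_mod_cast lb.le) (by exact_mod_cast lc.le) (continuous_of_mem_bipoly hp),
          h b c ⟨by omega, hb, hc⟩, ih _ _ (by omega) (next_ne x b) hc,
          ih _ _ (by omega) hb (next_ne y c), ih _ _ (by omega) (next_ne x b) (next_ne y c)]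
        simp
  exact eq_zero_of_integral_rightTriangle hxy hm hp fun b c hbc =>
    key r b c (by omega) hbc.2.1 hbc.2.2

/-! ## Stokes' theorem on a triangle and closed polynomial 1-forms -/

/-- Stokes for f dv, by Fubini and the fundamental theorem of calculus in u. The horizontal side
contributes nothing because dv vanishes on it. -/
theorem setIntegral_rightTriangle_deriv_fst {r b c : ℝ} (h : b + c ≤ r) {f g : ℝ × ℝ → ℝ}
    (hg : Continuous g) (hf : ∀ u v, HasDerivAt (fun u => f (u, v)) (g (u, v)) u) :
    ∫ z in rightTriangle r b c, g z = ∫ v in c..(r - b), (f (r - v, v) - f (b, v)) := by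
  have hi : Integrable ((rightTriangle r b c).indicator g) (volume : Measure (ℝ × ℝ)) :=
    (integrable_indicator_iff (isClosed_rightTriangle r b c).measurableSet).2
      (hg.continuousOn.integrableOn_compact (isCompact_rightTriangle r b c))
  rw [← integral_indicator (isClosed_rightTriangle r b c).measurableSet, Measure.volume_eq_prod,
    integral_prod_symm _ hi, intervalIntegral.integral_of_le (by linarith),
    ← integral_Icc_eq_integral_Ioc, ← integral_indicator measurableSet_Icc]
  refine integral_congr_ae (Filter.Eventually.of_forall fun v => ?_)
  simp only
  by_cases hv : v ∈ Set.Icc c (r - b)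
  · rw [Set.indicator_of_mem hv]
    have e : (fun u => (rightTriangle r b c).indicator g (u, v)) =
        (Set.Icc b (r - v)).indicator fun u => g (u, v) := by
      ext u
      have : (u, v) ∈ rightTriangle r b c ↔ u ∈ Set.Icc b (r - v) := by
        simp only [rightTriangle, Set.mem_ofPred_eq, Set.mem_Icc]
        constructor
        · rintro ⟨h1, h2, h3⟩
          exact ⟨h1, by linarith⟩
        · rintro ⟨h1, h2⟩
          exact ⟨h1, hv.1, by linarith⟩
      by_cases hu : u ∈ Set.Icc b (r - v)
      · rw [Set.indicator_of_mem hu, Set.indicator_of_mem (this.2 hu)]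
      · rw [Set.indicator_of_notMem hu, Set.indicator_of_notMem (mt this.1 hu)]
    rw [e, integral_indicator measurableSet_Icc, integral_Icc_eq_integral_Ioc,
      ← intervalIntegral.integral_of_le (by linarith [hv.2])]
    exact intervalIntegral.integral_eq_sub_of_hasDerivAt (fun u _ => hf u v)
      ((hg.comp (by fun_prop)).intervalIntegrable _ _)
  · rw [Set.indicator_of_notMem hv]
    have e : (fun u => (rightTriangle r b c).indicator g (u, v)) = 0 := by
      ext u
      refine Set.indicator_of_notMem ?_ _
      rintro ⟨h1, h2, h3⟩
      exact hv ⟨h2, by simp only at h1 h3; linarith⟩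
    rw [e]; simp

/-- Here `l` is the derivative of `f` in the direction (p, q); leaving the direction free covers all
three kinds of edges. -/
theorem integral_unit_eq_sub {f g : ℝ × ℝ → ℝ} {k l : ℝ × ℝ → ℝ} (hg : Continuous g)
    (hk : Continuous k)
    (hf : ∀ z, HasFDerivAt f
      (g z • ContinuousLinearMap.fst ℝ ℝ ℝ + k z • ContinuousLinearMap.snd ℝ ℝ ℝ) z)
    (u v p q : ℝ) (hl : ∀ z, l z = p * g z + q * k z) :
    ∫ t in (0 : ℝ)..1, l (u + p * t, v + q * t) = f (u + p, v + q) - f (u, v) := by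
  have h1 : ∀ t : ℝ, HasDerivAt (fun t : ℝ => f (u + p * t, v + q * t))
      (l (u + p * t, v + q * t)) t := by
    intro t
    have a1 : HasDerivAt (fun t : ℝ => u + p * t) p t := by
      simpa using ((hasDerivAt_id t).const_mul p).const_add u
    have a2 : HasDerivAt (fun t : ℝ => v + q * t) q t := by
      simpa using ((hasDerivAt_id t).const_mul q).const_add v
    have a3 := (hf (u + p * t, v + q * t)).comp_hasDerivAt t (a1.prodMk a2)
    have e : (g (u + p * t, v + q * t) • ContinuousLinearMap.fst ℝ ℝ ℝ +
        k (u + p * t, v + q * t) • ContinuousLinearMap.snd ℝ ℝ ℝ) (p, q) =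
        l (u + p * t, v + q * t) := by
      simp [hl, mul_comm]
    rw [e] at a3
    exact a3
  have hlc : Continuous l := by
    have : l = fun z => p * g z + q * k z := funext hl
    rw [this]; fun_prop
  rw [intervalIntegral.integral_eq_sub_of_hasDerivAt (fun t _ => h1 t)
    ((hlc.comp (by fun_prop)).intervalIntegrable _ _)]
  simp

theorem hasDerivAt_fst_of_hasFDerivAt {f : ℝ × ℝ → ℝ} {a b : ℝ} {u v : ℝ}
    (hf : HasFDerivAt f (a • ContinuousLinearMap.fst ℝ ℝ ℝ +
      b • ContinuousLinearMap.snd ℝ ℝ ℝ) (u, v)) :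
    HasDerivAt (fun u => f (u, v)) a u := by
  have h := hf.comp_hasDerivAt u ((hasDerivAt_id u).prodMk (hasDerivAt_const u v))
  have e : (a • ContinuousLinearMap.fst ℝ ℝ ℝ + b • ContinuousLinearMap.snd ℝ ℝ ℝ) (1, 0) = a := by
    simp
  rw [e] at h
  exact h

theorem hasDerivAt_snd_of_hasFDerivAt {f : ℝ × ℝ → ℝ} {a b : ℝ} {u v : ℝ}
    (hf : HasFDerivAt f (a • ContinuousLinearMap.fst ℝ ℝ ℝ +
      b • ContinuousLinearMap.snd ℝ ℝ ℝ) (u, v)) :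
    HasDerivAt (fun v => f (u, v)) b v := by
  have h := hf.comp_hasDerivAt v ((hasDerivAt_const v u).prodMk (hasDerivAt_id v))
  have e : (a • ContinuousLinearMap.fst ℝ ℝ ℝ + b • ContinuousLinearMap.snd ℝ ℝ ℝ) (0, 1) = b := by
    simp
  rw [e] at h
  exact h

/-- The edge graph is connected. Points off row y move along their row to column 0, points off
column x along their column to row 0. Only (x, y) admits neither move; it lies on the hypotenuse and
is reached by a diagonal edge. -/
theorem lattice_const_of_edges {x y r : ℕ} (hxy : x + y = r) (hx : 1 ≤ x) (hy : 1 ≤ y)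
    (f : ℕ → ℕ → ℝ)
    (hu : ∀ b c, b + c + 1 ≤ r → c ≠ y → f (b + 1) c = f b c)
    (hv : ∀ b c, b + c + 1 ≤ r → b ≠ x → f b (c + 1) = f b c)
    (hd : ∀ b c, b + c + 1 = r → f b (c + 1) = f (b + 1) c) :
    ∀ b c, b + c ≤ r → f b c = f 0 0 := by
  have h1 : ∀ b c, b + c ≤ r → c ≠ y → f b c = f 0 c := by
    intro b c
    induction b with
    | zero => simp
    | succ b ih => intro h hc; rw [hu b c (by omega) hc, ih (by omega) hc]
  have h2 : ∀ c b, b + c ≤ r → b ≠ x → f b c = f b 0 := by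
    intro c b
    induction c with
    | zero => simp
    | succ c ih => intro h hc; rw [hv b c (by omega) hc, ih (by omega) hc]
  have h3 : ∀ b c, b + c ≤ r → (c ≠ y ∨ b ≠ x) → f b c = f 0 0 := by
    intro b c h hbc
    by_cases hc : c = y
    · rw [h2 c b h (by tauto), h1 b 0 (by omega) (by omega)]
    · rw [h1 b c h hc, h2 c 0 (by omega) (by omega)]
  intro b c h
  by_cases hbc : c ≠ y ∨ b ≠ x
  · exact h3 b c h hbc
  · push Not at hbc
    obtain ⟨rfl, rfl⟩ := hbc
    obtain ⟨b', rfl⟩ : ∃ b', b = b' + 1 := ⟨b - 1, by omega⟩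
    rw [← hd b' c (by omega), h3 _ _ (by omega) (by omega)]

/-- The integrals over the edges of the construction determine the 1-forms `A du + B dv` with
coefficients of degree at most `r - 1`. -/
theorem eq_zero_of_integral_edges {x y r : ℕ} (hxy : x + y = r) (hx : 1 ≤ x) (hy : 1 ≤ y)
    {A B : ℝ × ℝ → ℝ} (hA : A ∈ bipoly (r - 1)) (hB : B ∈ bipoly (r - 1))
    (hu : ∀ b c : ℕ, b + c + 1 ≤ r → c ≠ y → ∫ t in (0 : ℝ)..1, A (b + t, c) = 0)
    (hv : ∀ b c : ℕ, b + c + 1 ≤ r → b ≠ x → ∫ t in (0 : ℝ)..1, B (b, c + t) = 0)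
    (hd : ∀ b c : ℕ, b + c + 1 = r →
      ∫ t in (0 : ℝ)..1, (B (b + 1 - t, c + t) - A (b + 1 - t, c + t)) = 0) :
    A = 0 ∧ B = 0 := by
  -- With ω = A du + B dv and C = B - ∂F/∂v, one has ω - dF = C dv. On each 1-cell the integral of C
  -- dv is therefore minus the increment of F.
  obtain ⟨F, hF, hFA⟩ := exists_primitive_fst hA
  rw [Nat.sub_add_cancel (by omega : 1 ≤ r)] at hF
  obtain ⟨A', hA', Fv, hFv, hFd⟩ := exists_hasFDerivAt hF
  obtain rfl : A' = A := by
    ext ⟨u, v⟩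
    exact (hasDerivAt_fst_of_hasFDerivAt (hFd (u, v))).unique (hFA u v)
  have cA := continuous_of_mem_bipoly hA
  have cB := continuous_of_mem_bipoly hB
  have cF := continuous_of_mem_bipoly hFv
  have hC : B - Fv ∈ bipoly (r - 1) := Submodule.sub_mem _ hB hFv
  obtain ⟨C, hCdef⟩ : ∃ C, C = B - Fv := ⟨_, rfl⟩
  rw [← hCdef] at hC
  have cC := continuous_of_mem_bipoly hC
  have hBC : ∀ z, B z = C z + Fv z := fun z => by simp [hCdef]
  have fu : ∀ b c : ℕ, b + c + 1 ≤ r → c ≠ y → F ((b + 1 : ℕ), c) = F (b, c) := by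
    intro b c h hc
    have h1 := integral_unit_eq_sub cA cF hFd b c 1 0 (l := A') (by simp)
    simp only [one_mul, zero_mul, add_zero, hu b c h hc] at h1
    push_cast
    linarith
  have fv : ∀ b c : ℕ, b + c + 1 ≤ r → b ≠ x →
      ∫ t in (0 : ℝ)..1, C (b, c + t) = F (b, c) - F (b, (c + 1 : ℕ)) := by
    intro b c h hc
    have h1 := integral_unit_eq_sub cA cF hFd b c 0 1 (l := Fv) (by simp)
    simp only [one_mul, zero_mul, add_zero] at h1
    have h2 := hv b c h hc
    simp only [hBC] at h2
    rw [intervalIntegral.integral_add (Continuous.intervalIntegrable (by fun_prop) _ _)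
      (Continuous.intervalIntegrable (by fun_prop) _ _), h1] at h2
    push_cast
    linarith
  have fd : ∀ b c : ℕ, b + c + 1 = r →
      ∫ t in (0 : ℝ)..1, C (b + 1 - t, c + t) = F ((b + 1 : ℕ), c) - F (b, (c + 1 : ℕ)) := by
    intro b c h
    have h1 := integral_unit_eq_sub cA cF hFd (b + 1) c (-1) 1 (l := fun z => Fv z - A' z)
      (fun z => by ring)
    simp only [one_mul, neg_one_mul, ← sub_eq_add_neg, add_sub_cancel_right] at h1
    have h2 := hd b c h
    have h3 : ∀ t : ℝ, B (b + 1 - t, c + t) - A' (b + 1 - t, c + t) =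
        C (b + 1 - t, c + t) + (Fv (b + 1 - t, c + t) - A' (b + 1 - t, c + t)) := by
      intro t; rw [hBC]; ring
    simp only [h3] at h2
    rw [intervalIntegral.integral_add (Continuous.intervalIntegrable (by fun_prop) _ _)
      (Continuous.intervalIntegrable (by fun_prop) _ _), h1] at h2
    push_cast
    linarith
  have frow : ∀ b c n : ℕ, b + n + c ≤ r → c ≠ y → F ((b + n : ℕ), c) = F (b, c) := by
    intro b c n h hc
    induction n with
    | zero => simp
    | succ n ih => rw [← ih (by omega), ← fu (b + n) c (by omega) hc]; rfl
  obtain ⟨D, hD, E, hE, hCd⟩ := exists_hasFDerivAt hC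
  have cD := continuous_of_mem_bipoly hD
  -- Since D = ∂C/∂u has degree at most r - 2, it suffices to integrate it over the node triangles,
  -- by Stokes. Their legs avoid column x and row y, so their sides consist of 1-cells.
  have hD0 : D = 0 := by
    refine eq_zero_of_integral_rightTriangle (m := r - 1 - 1) hxy (by omega) hD fun b c hbc => ?_
    obtain ⟨h1, h2, h3⟩ := hbc
    rw [setIntegral_rightTriangle_deriv_fst (f := C)
      (by exact_mod_cast (by omega : b + c ≤ r)) cD
      fun u v => hasDerivAt_fst_of_hasFDerivAt (hCd (u, v))]
    have hcont : Continuous fun v : ℝ => C (r - v, v) - C (b, v) :=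
      (cC.comp (by fun_prop)).sub (cC.comp (by fun_prop))
    -- The two non-horizontal sides are cut at integer heights; each unit piece is an increment of
    -- F, and the sum telescopes.
    have hsum := intervalIntegral.sum_integral_adjacent_intervals
      (f := fun v : ℝ => C (r - v, v) - C (b, v)) (μ := volume)
      (a := fun k : ℕ => ((c + k : ℕ) : ℝ)) (n := r - b - c)
      fun k _ => hcont.intervalIntegrable _ _
    have e : ((c + (r - b - c) : ℕ) : ℝ) = (r : ℝ) - b := by
      rw [show c + (r - b - c) = r - b by omega, Nat.cast_sub (by omega)]
    simp only [e, add_zero] at hsum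
    rw [← hsum]
    have hterm : ∀ k ∈ Finset.range (r - b - c),
        ∫ v in ((c + k : ℕ) : ℝ)..((c + (k + 1) : ℕ) : ℝ), (C (r - v, v) - C (b, v)) =
        (F (b, (c + (k + 1) : ℕ)) - F ((r - c - (k + 1) : ℕ), (c + (k + 1) : ℕ))) -
          (F (b, (c + k : ℕ)) - F ((r - c - k : ℕ), (c + k : ℕ))) := by
      intro k hk
      rw [Finset.mem_range] at hk
      obtain ⟨d, hd⟩ : ∃ d, r = d + (c + k) + 1 := ⟨r - c - k - 1, by omega⟩
      have e1 := fd d (c + k) hd.symm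
      have e2 := fv b (c + k) (by omega) h2
      have e3 := intervalIntegral.integral_comp_add_left (a := 0) (b := 1)
        (fun v : ℝ => C (r - v, v) - C (b, v)) ((c + k : ℕ) : ℝ)
      rw [add_zero] at e3
      rw [show ((c + (k + 1) : ℕ) : ℝ) = ((c + k : ℕ) : ℝ) + 1 by push_cast; ring, ← e3]
      have e4 : ∀ t : ℝ, (r : ℝ) - (((c + k : ℕ) : ℝ) + t) = d + 1 - t := by
        intro t; rw [hd]; push_cast; ring
      simp only [e4]
      rw [intervalIntegral.integral_sub (Continuous.intervalIntegrable (by fun_prop) _ _)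
        (Continuous.intervalIntegrable (by fun_prop) _ _), e1, e2,
        show r - c - (k + 1) = d by omega, show r - c - k = d + 1 by omega]
      push_cast
      ring
    rw [Finset.sum_congr rfl hterm, Finset.sum_range_sub
      (fun k => F (b, (c + k : ℕ)) - F ((r - c - k : ℕ), (c + k : ℕ)))]
    -- What is left is the increment of F along the bottom side, which is zero because c ≠ y.
    have e5 := frow b c (r - c - b) (by omega) h3
    rw [show b + (r - c - b) = r - c by omega] at e5
    rw [show r - c - (r - b - c) = b by omega, show r - c - 0 = r - c by omega]
    simp [e5]
  have hC0 : ∀ u v, C (u, v) = C (0, v) := by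
    intro u v
    have h1 : ∀ u, HasDerivAt (fun u => C (u, v)) 0 u := by
      intro u
      have := hasDerivAt_fst_of_hasFDerivAt (hCd (u, v))
      rwa [hD0] at this
    exact is_const_of_deriv_eq_zero (fun u => (h1 u).differentiableAt) (fun u => (h1 u).deriv) u 0
  obtain ⟨G, hG, hGC⟩ := exists_primitive_snd hC
  rw [Nat.sub_add_cancel (by omega : 1 ≤ r)] at hG
  -- As C depends only on v, the form is the differential of F(u, v) + G(0, v), of degree at most r.
  have hG0 : (fun z : ℝ × ℝ => G (0, z.2)) ∈ bipoly r :=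
    comp_mem_bipoly hG (const_mem_bipoly 1 0) snd_mem_bipoly
  have hGint : ∀ c : ℕ, ∫ t in (0 : ℝ)..1, C (0, c + t) = G (0, (c + 1 : ℕ)) - G (0, c) := by
    intro c
    rw [intervalIntegral.integral_comp_add_left (fun t => C (0, t)) (c : ℝ),
      intervalIntegral.integral_eq_sub_of_hasDerivAt (fun t _ => hGC 0 t)
      ((cC.comp (by fun_prop)).intervalIntegrable _ _)]
    simp
  have hconst := lattice_const_of_edges hxy hx hy (fun b c => F (b, c) + G (0, c))
    (fun b c h hc => by simp only [fu b c h hc])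
    (fun b c h hb => by
      have h1 := fv b c h hb
      simp only [hC0 b] at h1
      rw [hGint] at h1
      linarith)
    (fun b c h => by
      have h1 := fd b c h
      simp only [fun t : ℝ => hC0 (b + 1 - t)] at h1
      rw [hGint] at h1
      linarith)
  have hzero : (fun z : ℝ × ℝ => F z + G (0, z.2) - (F (0, 0) + G (0, 0))) = 0 := by
    refine eq_zero_of_lattice (m := r) ?_ fun b c hbc => ?_
    · exact Submodule.sub_mem _ (Submodule.add_mem _ hF hG0) (const_mem_bipoly r _)
    · have := hconst b c hbc
      simp only [Nat.cast_zero] at this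
      simp [this]
  obtain ⟨K, hK⟩ : ∃ K, K = F (0, 0) + G (0, 0) := ⟨_, rfl⟩
  have hF' : ∀ u v, F (u, v) = K - G (0, v) := by
    intro u v
    have := congrFun hzero (u, v)
    simp only [Pi.zero_apply] at this
    linarith
  constructor
  · ext ⟨u, v⟩
    have h1 := hFA u v
    simp only [hF'] at h1
    exact h1.unique (hasDerivAt_const _ _)
  · ext ⟨u, v⟩
    have h1 := hasDerivAt_snd_of_hasFDerivAt (hFd (u, v))
    simp only [hF'] at h1
    have h2 := h1.unique ((hGC 0 v).const_sub K)
    rw [hBC, h2, hC0 u v]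
    simp

/-! ## Integer barycentric coordinates -/

/-- Barycentric coordinates of the point with integer coordinates `(u, v)`. -/
noncomputable def bary (r : ℕ) (z : ℝ × ℝ) : Fin 3 → ℝ := ![(r - z.1 - z.2) / r, z.1 / r, z.2 / r]

theorem sum_bary {r : ℕ} (hr : 0 < r) (z : ℝ × ℝ) : ∑ i, bary r z i = 1 := by
  have : (r : ℝ) ≠ 0 := by positivity
  simp only [bary, Fin.sum_univ_three, Matrix.cons_val]
  field_simp; ring

theorem bary_combo {r : ℕ} {a b : ℝ} (hab : a + b = 1) (z w : ℝ × ℝ) (i : Fin 3) :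
    bary r (a • z + b • w) i = a * bary r z i + b * bary r w i := by
  obtain rfl : b = 1 - a := by linarith
  fin_cases i <;> simp [bary] <;> ring

theorem eq_bary {r : ℕ} (hr : 0 < r) {l : Fin 3 → ℝ} (hl : ∑ i, l i = 1) :
    l = bary r (r * l 1, r * l 2) := by
  have : (r : ℝ) ≠ 0 := by positivity
  rw [Fin.sum_univ_three] at hl
  ext i
  fin_cases i
  · simp [bary]
    field_simp
    linarith
  · simp [bary]; field_simp
  · simp [bary]; field_simp

theorem bary_injective {r : ℕ} (hr : 0 < r) : Function.Injective (bary r) := by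
  have : (r : ℝ) ≠ 0 := by positivity
  intro z w h
  have h1 := congrFun h 1
  have h2 := congrFun h 2
  simp only [bary, Matrix.cons_val] at h1 h2
  exact Prod.ext ((div_left_inj' this).1 h1) ((div_left_inj' this).1 h2)

theorem bary_mem_bipoly (r : ℕ) (i : Fin 3) : (fun z => bary r z i) ∈ bipoly 1 := by
  fin_cases i
  · convert affine_mem_bipoly (r / r) (-1 / r) (-1 / r) using 1
    ext z; simp [bary]; ring
  · convert affine_mem_bipoly 0 (1 / r) 0 using 1
    ext z; simp [bary]; ring
  · convert affine_mem_bipoly 0 0 (1 / r) using 1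
    ext z; simp [bary]; ring

/-- The affine map taking the integer triangle of size `r` to the triangle with vertices `P i`. -/
noncomputable def baryMap (r : ℕ) (P : Fin 3 → Plane) (z : ℝ × ℝ) : Plane := ∑ i, bary r z i • P i

theorem baryMap_mem_bipoly (r : ℕ) (P : Fin 3 → Plane) (i : Fin 2) :
    (fun z => baryMap r P z i) ∈ bipoly 1 := by
  have : (fun z => baryMap r P z i) = ∑ j, P j i • fun z => bary r z j := by
    ext z
    simp [baryMap, mul_comm]
  rw [this]
  exact Submodule.sum_mem _ fun j _ => Submodule.smul_mem _ _ (bary_mem_bipoly r j)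

theorem baryMap_combo {r : ℕ} (P : Fin 3 → Plane) {a b : ℝ} (hab : a + b = 1) (z w : ℝ × ℝ) :
    baryMap r P (a • z + b • w) = a • baryMap r P z + b • baryMap r P w := by
  simp only [baryMap, bary_combo hab, Finset.smul_sum, ← Finset.sum_add_distrib, add_smul, mul_smul]

variable (T : Affine.Triangle ℝ Plane)

theorem baryMap_eq_pt (r : ℕ) (z : ℝ × ℝ) : baryMap r T.points z = pt T (bary r z) := rfl

/-! ### The affine chart given by integer coordinates. -/

theorem pt_injective {l l' : Fin 3 → ℝ} (hl : ∑ i, l i = 1) (hl' : ∑ i, l' i = 1)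
    (h : pt T l = pt T l') : l = l' := by
  have h1 := affineIndependent_iff.1 T.independent Finset.univ (fun i => l i - l' i)
    (by rw [Finset.sum_sub_distrib, hl, hl', sub_self])
    (by simp only [sub_smul, Finset.sum_sub_distrib]; exact sub_eq_zero.2 h)
  ext i
  exact sub_eq_zero.1 (h1 i (Finset.mem_univ i))

/-- The linear part of the integer coordinates of the plane. -/
noncomputable def chartLinear (r : ℕ) : ℝ × ℝ →ₗ[ℝ] Plane :=
  (LinearMap.fst ℝ ℝ ℝ).smulRight ((1 / (r : ℝ)) • (T.points 1 - T.points 0)) +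
    (LinearMap.snd ℝ ℝ ℝ).smulRight ((1 / (r : ℝ)) • (T.points 2 - T.points 0))

theorem baryMap_eq_chartLinear {r : ℕ} (hr : 0 < r) (z : ℝ × ℝ) :
    baryMap r T.points z = chartLinear T r z + T.points 0 := by
  have : (r : ℝ) ≠ 0 := by positivity
  have e : ((r : ℝ) - z.1 - z.2) / r = 1 - z.1 * (1 / r) - z.2 * (1 / r) := by field_simp
  simp only [baryMap, bary, chartLinear, Fin.sum_univ_three, Matrix.cons_val, e]
  simp only [LinearMap.add_apply, LinearMap.smulRight_apply, LinearMap.fst_apply,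
    LinearMap.snd_apply]
  module

theorem baryMap_injective {r : ℕ} (hr : 0 < r) : Function.Injective (baryMap r T.points) :=
  fun z w h => bary_injective hr (pt_injective T (sum_bary hr z) (sum_bary hr w) h)

theorem chartLinear_injective {r : ℕ} (hr : 0 < r) : Function.Injective (chartLinear T r) := by
  intro z w h
  refine baryMap_injective T hr ?_
  rw [baryMap_eq_chartLinear T hr, baryMap_eq_chartLinear T hr, h]

noncomputable def chartLinearEquiv {r : ℕ} (hr : 0 < r) : (ℝ × ℝ) ≃L[ℝ] Plane :=
  (LinearEquiv.ofInjectiveOfFinrankEq (chartLinear T r) (chartLinear_injective T hr)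
    (by simp)).toContinuousLinearEquiv

/-- The integer coordinates of the plane. -/
noncomputable def chart {r : ℕ} (hr : 0 < r) : (ℝ × ℝ) ≃ₜ Plane :=
  (chartLinearEquiv T hr).toHomeomorph.trans (Homeomorph.addRight (T.points 0))

theorem chart_apply {r : ℕ} (hr : 0 < r) (z : ℝ × ℝ) : chart T hr z = pt T (bary r z) := by
  rw [← baryMap_eq_pt, baryMap_eq_chartLinear T hr]; rfl

theorem chart_eq_baryMap {r : ℕ} (hr : 0 < r) (z : ℝ × ℝ) :
    chart T hr z = baryMap r T.points z := chart_apply T hr z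

theorem chart_combo {r : ℕ} (hr : 0 < r) {a b : ℝ} (hab : a + b = 1) (z w : ℝ × ℝ) :
    chart T hr (a • z + b • w) = a • chart T hr z + b • chart T hr w := by
  simp only [chart_eq_baryMap, baryMap_combo _ hab]

theorem convex_image_chart {r : ℕ} (hr : 0 < r) {s : Set (ℝ × ℝ)} (hs : Convex ℝ s) :
    Convex ℝ (chart T hr '' s) := by
  rintro _ ⟨z, hz, rfl⟩ _ ⟨w, hw, rfl⟩ a b ha hb hab
  exact ⟨_, hs hz hw ha hb hab, chart_combo T hr hab z w⟩

theorem mem_subcell {S : Finset (Fin 3)} {p : Plane} :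
    p ∈ subcell T S ↔
      ∃ l : Fin 3 → ℝ, (∀ i, 0 ≤ l i) ∧ ∑ i, l i = 1 ∧ (∀ i ∉ S, l i = 0) ∧ p = pt T l := by
  constructor
  · intro hp
    refine convexHull_min (s := T.points '' S) (t := {p | ∃ l : Fin 3 → ℝ, (∀ i, 0 ≤ l i) ∧
      ∑ i, l i = 1 ∧ (∀ i ∉ S, l i = 0) ∧ p = pt T l}) ?_ ?_ hp
    · rintro _ ⟨i, hi, rfl⟩
      refine ⟨Pi.single i 1, fun j => ?_, by simp, fun j hj => ?_, ?_⟩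
      · by_cases h : j = i
        · subst h; simp
        · simp [h]
      · rw [Pi.single_eq_of_ne]
        rintro rfl
        exact hj hi
      · simp [pt, Pi.single_apply]
    · rintro _ ⟨l, h1, h2, h3, rfl⟩ _ ⟨l', h1', h2', h3', rfl⟩ a b ha hb hab
      refine ⟨a • l + b • l', fun i => ?_, ?_, fun i hi => ?_, ?_⟩
      · have := mul_nonneg ha (h1 i)
        have := mul_nonneg hb (h1' i)
        simp only [Pi.add_apply, Pi.smul_apply, smul_eq_mul]
        linarith
      · simp only [Pi.add_apply, Pi.smul_apply, smul_eq_mul, Finset.sum_add_distrib,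
          ← Finset.mul_sum, h2, h2', hab, mul_one]
      · simp [h3 i hi, h3' i hi]
      · simp [pt, Finset.smul_sum, add_smul, mul_smul, Finset.sum_add_distrib]
  · rintro ⟨l, h1, h2, h3, rfl⟩
    have e1 : ∑ i ∈ S, l i = 1 := by
      rw [← h2]
      exact Finset.sum_subset (Finset.subset_univ S) fun i _ hi => h3 i hi
    have e2 : pt T l = ∑ i ∈ S, l i • T.points i := by
      rw [pt]
      exact (Finset.sum_subset (Finset.subset_univ S) fun i _ hi => by rw [h3 i hi, zero_smul]).symm
    rw [e2]
    exact (convex_convexHull ℝ _).sum_mem (fun i _ => h1 i) e1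
      fun i hi => subset_convexHull ℝ _ ⟨i, hi, rfl⟩

theorem chart_mem_subcell {r : ℕ} (hr : 0 < r) {S : Finset (Fin 3)} {z : ℝ × ℝ} :
    chart T hr z ∈ subcell T S ↔ (∀ i, 0 ≤ bary r z i) ∧ ∀ i ∉ S, bary r z i = 0 := by
  rw [mem_subcell]
  constructor
  · rintro ⟨l, h1, h2, h3, h4⟩
    rw [chart_apply] at h4
    obtain rfl := pt_injective T (sum_bary hr z) h2 h4
    exact ⟨h1, h3⟩
  · rintro ⟨h1, h3⟩
    exact ⟨_, h1, sum_bary hr z, h3, chart_apply T hr z⟩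

theorem bary_nonneg_iff {r : ℕ} (hr : 0 < r) (z : ℝ × ℝ) :
    (∀ i, 0 ≤ bary r z i) ↔ z ∈ rightTriangle r 0 0 := by
  have hr' : (0 : ℝ) < r := by positivity
  simp only [bary, Fin.forall_fin_succ, Fin.isValue, IsEmpty.forall_iff, Matrix.cons_val_zero,
    Matrix.cons_val_succ, le_div_iff₀ hr', zero_mul, rightTriangle, Set.mem_ofPred_eq, and_true]
  constructor
  · rintro ⟨h1, h2, h3⟩
    exact ⟨h2, h3, by linarith⟩
  · rintro ⟨h1, h2, h3⟩
    exact ⟨by linarith, h1, h2⟩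

theorem subcell_univ_eq {r : ℕ} (hr : 0 < r) :
    subcell T Finset.univ = chart T hr '' rightTriangle r 0 0 := by
  ext p
  obtain ⟨z, rfl⟩ := (chart T hr).surjective p
  rw [chart_mem_subcell, (chart T hr).injective.mem_set_image, ← bary_nonneg_iff hr]
  simp

/-! ## The nodes and regions of the construction -/

theorem bary_eq {r : ℕ} (hr : 0 < r) {b c a : ℕ} (h : a + b + c = r) {l : Fin 3 → ℝ}
    (h0 : l 0 = (a : ℝ) / r) (h1 : l 1 = (b : ℝ) / r) (h2 : l 2 = (c : ℝ) / r) :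
    l = bary r ((b : ℝ), (c : ℝ)) := by
  have : (r : ℝ) ≠ 0 := by positivity
  have hr' : (r : ℝ) = a + b + c := by exact_mod_cast h.symm
  ext i
  fin_cases i
  · simp only [bary, Fin.zero_eta, h0, Matrix.cons_val_zero]
    congr 1; rw [hr']; ring
  · simpa [bary] using h1
  · simpa [bary] using h2

theorem tauBary_zeta_odd {r b c : ℕ} (h : Odd (r + 1)) (hr : 0 < r) :
    tauBary (zeta (r + 1)) (bary r ((b : ℝ), (c : ℝ))) =
      bary (r + 1) ((b : ℝ), ((c + 1 : ℕ) : ℝ)) := by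
  have : (r : ℝ) ≠ 0 := by positivity
  have h' : (r : ℝ) + 1 ≠ 0 := by positivity
  ext i
  fin_cases i <;> simp [tauBary, zeta, h, bary] <;> field_simp <;> ring

theorem tauBary_zeta_even {r b c : ℕ} (h : ¬ Odd (r + 1)) (hr : 0 < r) :
    tauBary (zeta (r + 1)) (bary r ((b : ℝ), (c : ℝ))) =
      bary (r + 1) (((b + 1 : ℕ) : ℝ), (c : ℝ)) := by
  have : (r : ℝ) ≠ 0 := by positivity
  have h' : (r : ℝ) + 1 ≠ 0 := by positivity
  ext i
  fin_cases i <;> simp only [tauBary, zeta, if_neg h, bary] <;> simp <;> field_simp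

/-- In integer coordinates τ_ζ raises c by one when the new index is odd and b by one when it is
even. In the same step the deleted row, respectively column, moves by one, and Δ supplies the new
bottom row, respectively left column, without its deleted point. -/
theorem mem_Gamma_iff {r : ℕ} (hr : 2 ≤ r) {l : Fin 3 → ℝ} :
    l ∈ Gamma r ↔ ∃ b c : ℕ, IsNode (r / 2) (r - r / 2) b c ∧ l = bary r ((b : ℝ), (c : ℝ)) := by
  induction r, hr using Nat.le_induction generalizing l with
  | base =>
    simp only [Gamma, Set.mem_singleton_iff, IsNode]
    constructor
    · rintro rfl
      exact ⟨0, 0, by omega, by ext i; fin_cases i <;> simp [bary]⟩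
    · rintro ⟨b, c, h, rfl⟩
      obtain rfl : b = 0 := by omega
      obtain rfl : c = 0 := by omega
      ext i; fin_cases i <;> simp [bary]
  | succ r hr ih =>
    obtain ⟨m, rfl⟩ : ∃ m, r = m + 2 := ⟨r - 2, by omega⟩
    have hG : Gamma (m + 2 + 1) = tauBary (zeta (m + 2 + 1)) '' Gamma (m + 2) ∪
      Delta (m + 2 + 1) := rfl
    rw [hG, Set.mem_union, Set.mem_image]
    by_cases hodd : Odd (m + 2 + 1)
    · have ho : (m + 3) % 2 = 1 := Nat.odd_iff.1 hodd
      simp only [Delta, if_pos hodd]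
      constructor
      · rintro (⟨l', hl', rfl⟩ | ⟨i, h1, h2, h3, rfl⟩)
        · obtain ⟨b, c, hbc, rfl⟩ := ih.1 hl'
          refine ⟨b, c + 1, ?_, tauBary_zeta_odd hodd (by omega)⟩
          unfold IsNode at hbc ⊢; omega
        · refine ⟨m + 3 - i, 0, by unfold IsNode; omega, ?_⟩
          refine bary_eq (a := i) (by omega) (by omega) (by simp) ?_ (by simp)
          rw [Nat.cast_sub (by omega)]; simp; ring
      · rintro ⟨b, c, hbc, rfl⟩
        unfold IsNode at hbc
        rcases Nat.eq_zero_or_pos c with rfl | hc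
        · refine Or.inr ⟨m + 3 - b, by omega, by omega, by omega, ?_⟩
          refine (bary_eq (a := m + 3 - b) (by omega) (by omega) (by simp) ?_ (by simp)).symm
          rw [Nat.cast_sub (by omega)]; simp; ring
        · obtain ⟨c, rfl⟩ : ∃ c', c = c' + 1 := ⟨c - 1, by omega⟩
          refine Or.inl ⟨_, ih.2 ⟨b, c, ?_, rfl⟩, tauBary_zeta_odd hodd (by omega)⟩
          unfold IsNode; omega
    · have ho : (m + 3) % 2 = 0 := Nat.even_iff.1 (Nat.not_odd_iff_even.1 hodd)
      simp only [Delta, if_neg hodd]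
      constructor
      · rintro (⟨l', hl', rfl⟩ | ⟨i, h1, h2, h3, rfl⟩)
        · obtain ⟨b, c, hbc, rfl⟩ := ih.1 hl'
          refine ⟨b + 1, c, ?_, tauBary_zeta_even hodd (by omega)⟩
          unfold IsNode at hbc ⊢; omega
        · refine ⟨0, m + 3 - i, by unfold IsNode; omega, ?_⟩
          refine bary_eq (a := i) (by omega) (by omega) (by simp) (by simp) ?_
          rw [Nat.cast_sub (by omega)]; simp; ring
      · rintro ⟨b, c, hbc, rfl⟩
        unfold IsNode at hbc
        rcases Nat.eq_zero_or_pos b with rfl | hc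
        · refine Or.inr ⟨m + 3 - c, by omega, by omega, by omega, ?_⟩
          refine (bary_eq (a := m + 3 - c) (by omega) (by omega) (by simp) (by simp) ?_).symm
          rw [Nat.cast_sub (by omega)]; simp; ring
        · obtain ⟨b, rfl⟩ : ∃ c', b = c' + 1 := ⟨b - 1, by omega⟩
          refine Or.inl ⟨_, ih.2 ⟨b, c, ?_, rfl⟩, tauBary_zeta_even hodd (by omega)⟩
          unfold IsNode; omega

/-- In coordinates τ_ξ scales by (r - b - c)/r, sends the origin to (b, c) and maps the line u + v =
r to itself. -/
theorem scaledTriangle_bary {r : ℕ} (hr : 0 < r) {b c : ℝ} (h : b + c < r) :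
    scaledTriangle T (bary r (b, c)) = chart T hr '' rightTriangle r b c := by
  have hr' : (r : ℝ) ≠ 0 := by positivity
  have ha : (0 : ℝ) < r - b - c := by linarith
  have key : ∀ z : ℝ × ℝ, tau T (bary r (b, c)) (chart T hr z) =
      chart T hr (b + (r - b - c) / r * z.1, c + (r - b - c) / r * z.2) := by
    intro z
    rw [chart_apply, chart_apply, tau_pt]
    congr 1
    ext i
    fin_cases i <;> simp [tauBary, bary] <;> field_simp <;> ring
  rw [scaledTriangle, subcell_univ_eq T hr, Set.image_image]
  simp_rw [key]
  have hk : 0 < (r - b - c) / (r : ℝ) := by positivity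
  ext p
  obtain ⟨w, rfl⟩ := (chart T hr).surjective p
  rw [(chart T hr).injective.mem_set_image]
  constructor
  · rintro ⟨z, ⟨h1, h2, h3⟩, hz⟩
    rw [← (chart T hr).injective hz]
    refine ⟨?_, ?_, ?_⟩
    · have := mul_nonneg hk.le h1
      simp only; linarith
    · have := mul_nonneg hk.le h2
      simp only; linarith
    · have := mul_le_mul_of_nonneg_left h3 hk.le
      rw [div_mul_cancel₀ _ hr'] at this
      simp only; linarith
  · rintro ⟨h1, h2, h3⟩
    refine ⟨((w.1 - b) * (r / (r - b - c)), (w.2 - c) * (r / (r - b - c))), ⟨?_, ?_, ?_⟩, ?_⟩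
    · exact mul_nonneg (by linarith) (by positivity)
    · exact mul_nonneg (by linarith) (by positivity)
    · simp only
      rw [← add_mul, mul_div_assoc', div_le_iff₀ ha, mul_comm]
      exact mul_le_mul_of_nonneg_left (by linarith) (by positivity)
    · have e : ∀ s : ℝ, (r - b - c) / r * (s * (r / (r - b - c))) = s := by
        intro s
        field_simp [ha.ne']
      refine congrArg (chart T hr) (Prod.ext ?_ ?_)
      · simp only [e]; ring
      · simp only [e]; ring

/-! ### Topology and convexity of truncated boxes, and identification of the regions. -/

theorem isClosed_truncatedBox (r b b' c c' : ℝ) : IsClosed (truncatedBox r b b' c c') :=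
  (isClosed_le continuous_const continuous_fst).inter
    ((isClosed_le continuous_fst continuous_const).inter
    ((isClosed_le continuous_const continuous_snd).inter
    ((isClosed_le continuous_snd continuous_const).inter
      (isClosed_le (continuous_fst.add continuous_snd) continuous_const))))

theorem isCompact_truncatedBox (r b b' c c' : ℝ) : IsCompact (truncatedBox r b b' c c') := by
  refine (isCompact_Icc (a := (b, c)) (b := (b', c'))).of_isClosed_subset
    (isClosed_truncatedBox r b b' c c') ?_
  rintro ⟨u, v⟩ ⟨h1, h2, h3, h4, h5⟩
  exact ⟨⟨h1, h3⟩, ⟨h2, h4⟩⟩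

theorem convex_truncatedBox (r b b' c c' : ℝ) : Convex ℝ (truncatedBox r b b' c c') := by
  rintro z ⟨h1, h2, h3, h4, h5⟩ w ⟨k1, k2, k3, k4, k5⟩ p q hp hq hpq
  obtain rfl : q = 1 - p := by linarith
  refine ⟨?_, ?_, ?_, ?_, ?_⟩ <;>
    simp only [Prod.fst_add, Prod.snd_add, Prod.smul_fst, Prod.smul_snd, smul_eq_mul] <;>
    nlinarith

theorem interior_truncatedBox (r b b' c c' : ℝ) : interior (truncatedBox r b b' c c') =
    {z | b < z.1 ∧ z.1 < b' ∧ c < z.2 ∧ z.2 < c' ∧ z.1 + z.2 < r} := by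
  refine Set.Subset.antisymm ?_ (interior_maximal ?_ ?_)
  · intro z hz
    rw [mem_interior_iff_mem_nhds, Metric.mem_nhds_iff] at hz
    obtain ⟨ε, hε, h⟩ := hz
    have e : |ε / 2| < ε := by rw [abs_of_pos (by linarith)]; linarith
    -- Moving an interior point both ways along the diagonal (1, 1) makes all five constraints
    -- strict.
    have hp : (z.1 + ε / 2, z.2 + ε / 2) ∈ truncatedBox r b b' c c' := by
      refine h ?_
      rw [Metric.mem_ball, Prod.dist_eq, Real.dist_eq, Real.dist_eq]
      simpa using e
    have hm : (z.1 - ε / 2, z.2 - ε / 2) ∈ truncatedBox r b b' c c' := by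
      refine h ?_
      rw [Metric.mem_ball, Prod.dist_eq, Real.dist_eq, Real.dist_eq]
      simpa using e
    obtain ⟨h1, h2, h3, h4, h5⟩ := hp
    obtain ⟨k1, k2, k3, k4, k5⟩ := hm
    simp only at h1 h2 h3 h4 h5 k1 k2 k3 k4 k5
    exact ⟨by linarith, by linarith, by linarith, by linarith, by linarith⟩
  · rintro z ⟨h1, h2, h3, h4, h5⟩
    exact ⟨h1.le, h2.le, h3.le, h4.le, h5.le⟩
  · exact (isOpen_lt continuous_const continuous_fst).inter
      ((isOpen_lt continuous_fst continuous_const).inter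
      ((isOpen_lt continuous_const continuous_snd).inter
      ((isOpen_lt continuous_snd continuous_const).inter
        (isOpen_lt (continuous_fst.add continuous_snd) continuous_const))))

/-- The region attached to the node `(b, c)`, in integer coordinates. -/
def nodeBox (r b c : ℕ) : Set (ℝ × ℝ) :=
  truncatedBox r b (next (r / 2) b : ℕ) c (next (r - r / 2) c : ℕ)

theorem nonempty_interior_nodeBox {r b c : ℕ} (h : b + c < r) : (interior (nodeBox r b c)).Nonempty := by
  rw [nodeBox, interior_truncatedBox]
  have h1 : (b : ℝ) + 1 ≤ next (r / 2) b := by exact_mod_cast lt_next _ b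
  have h2 : (c : ℝ) + 1 ≤ next (r - r / 2) c := by exact_mod_cast lt_next _ c
  have h3 : (b : ℝ) + c + 1 ≤ r := by exact_mod_cast h
  refine ⟨(b + 1 / 4, c + 1 / 4), ?_, ?_, ?_, ?_, ?_⟩ <;> simp only <;> linarith

/-- Smaller λ₀ means larger b + c. The triangles at the next node to the right and the next node
above already cut the large triangle down to the box; no other removed triangle meets the interior
of the box. -/
theorem region_bary {r : ℕ} (hr : 2 ≤ r) {b c : ℕ} (h : IsNode (r / 2) (r - r / 2) b c) :
    region T r (bary r ((b : ℝ), (c : ℝ))) = chart T (by omega : 0 < r) '' nodeBox r b c := by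
  have hr0 : 0 < r := by omega
  have hr' : (0 : ℝ) < r := by positivity
  obtain ⟨hlt, hb, hc⟩ := h
  rw [Nat.add_sub_cancel' (Nat.div_le_self r 2)] at hlt
  have cast_lt : ∀ {b c : ℕ}, b + c < r → (b : ℝ) + c < r := fun h => by exact_mod_cast h
  have hU : ⋃ η ∈ {η ∈ Gamma r | η 0 < bary r ((b : ℝ), (c : ℝ)) 0}, scaledTriangle T η =
      chart T hr0 '' ⋃ (b' : ℕ) (c' : ℕ) (_ : IsNode (r / 2) (r - r / 2) b' c' ∧ b + c < b' + c'),
        rightTriangle r b' c' := by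
    simp only [Set.image_iUnion]
    ext p
    simp only [Set.mem_iUnion, Set.mem_ofPred_eq, exists_prop]
    have lt_iff : ∀ b' c' : ℕ, bary r ((b' : ℝ), (c' : ℝ)) 0 < bary r ((b : ℝ), (c : ℝ)) 0 ↔
        b + c < b' + c' := by
      intro b' c'
      simp only [bary, Matrix.cons_val_zero, div_lt_div_iff_of_pos_right hr']
      rw [← @Nat.cast_lt ℝ]
      push_cast
      constructor <;> intro h <;> linarith
    constructor
    · rintro ⟨η, ⟨h1, h2⟩, h3⟩
      obtain ⟨b', c', hbc, rfl⟩ := (mem_Gamma_iff hr).1 h1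
      refine ⟨b', c', ⟨hbc, (lt_iff b' c').1 h2⟩, ?_⟩
      rwa [scaledTriangle_bary T hr0 (cast_lt (by have := hbc.1; omega))] at h3
    · rintro ⟨b', c', ⟨hbc, h1⟩, h2⟩
      refine ⟨_, ⟨(mem_Gamma_iff hr).2 ⟨b', c', hbc, rfl⟩, (lt_iff b' c').2 h1⟩, ?_⟩
      rwa [scaledTriangle_bary T hr0 (cast_lt (by have := hbc.1; omega))]
  rw [region, hU, scaledTriangle_bary T hr0 (cast_lt hlt), ← Set.image_sdiff (chart T hr0).injective,
    ← Homeomorph.image_closure]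
  congr 1
  refine Set.Subset.antisymm (closure_minimal ?_ (isClosed_truncatedBox _ _ _ _ _)) ?_
  · rintro z ⟨⟨h1, h2, h3⟩, h4⟩
    simp only [Set.mem_iUnion, not_exists] at h4
    refine ⟨h1, ?_, h2, ?_, h3⟩
    · by_contra! h5
      have l1 := lt_next (r / 2) b
      have : next (r / 2) b + c < r := by
        rw [← @Nat.cast_lt ℝ]; push_cast; linarith
      exact h4 (next (r / 2) b) c ⟨⟨by omega, next_ne _ _, hc⟩, by omega⟩ ⟨h5.le, h2, h3⟩
    · by_contra! h5
      have l1 := lt_next (r - r / 2) c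
      have : b + next (r - r / 2) c < r := by
        rw [← @Nat.cast_lt ℝ]; push_cast; linarith
      exact h4 b (next (r - r / 2) c) ⟨⟨by omega, hb, next_ne _ _⟩, by omega⟩ ⟨h1, h5.le, h3⟩
  -- A closed convex set with nonempty interior is the closure of its interior, so it suffices that
  -- interior points survive the removal.
  · have h1 := (convex_truncatedBox r b (next (r / 2) b : ℕ) c (next (r - r / 2) c :
      ℕ)).closure_interior_eq_closure_of_nonempty_interior (nonempty_interior_nodeBox hlt)
    rw [nodeBox, ← (isClosed_truncatedBox r b (next (r / 2) b : ℕ) c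
      (next (r - r / 2) c : ℕ)).closure_eq, ← h1]
    refine closure_mono ?_
    rw [interior_truncatedBox]
    rintro z ⟨h1, h2, h3, h4, h5⟩
    refine ⟨⟨h1.le, h3.le, h5.le⟩, ?_⟩
    simp only [Set.mem_iUnion, not_exists]
    rintro b' c' ⟨⟨h6, h7, h8⟩, h9⟩ ⟨h10, h11, h12⟩
    rcases lt_or_ge b b' with hbb | hbb
    · have : (next (r / 2) b : ℝ) ≤ b' := by exact_mod_cast next_le hbb h7
      linarith
    · have : (next (r - r / 2) c : ℝ) ≤ c' := by exact_mod_cast next_le (by omega) h8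
      linarith

/-! ## The cells of the construction in integer coordinates -/

/-- The exponents of the monomials of degree at most `m`; also the points of the principal
lattice. -/
def degreeIndex (m : ℕ) : Finset (ℕ × ℕ) :=
  (Finset.range (m + 1) ×ˢ Finset.range (m + 1)).filter fun z => z.1 + z.2 ≤ m

theorem mem_degreeIndex {m : ℕ} {z : ℕ × ℕ} : z ∈ degreeIndex m ↔ z.1 + z.2 ≤ m := by
  simp only [degreeIndex, Finset.mem_filter, Finset.mem_product, Finset.mem_range]
  omega

theorem dofs_zero_eq {r : ℕ} (hr : 0 < r) :
    dofs T r 0 = (fun z : ℕ × ℕ => Cell.point (chart T hr ((z.1 : ℝ), (z.2 : ℝ)))) ''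
      (degreeIndex r : Set (ℕ × ℕ)) := by
  ext c
  simp only [dofs, Set.mem_ofPred_eq, Set.mem_image, Finset.mem_coe, mem_degreeIndex, chart_apply,
    Fin.sum_univ_three]
  constructor
  · rintro ⟨α, hα, rfl⟩
    refine ⟨(α 1, α 2), by simp only; omega, ?_⟩
    rw [bary_eq (l := fun i => (α i : ℝ) / r) hr hα rfl rfl rfl]
  · rintro ⟨⟨b, c⟩, h, rfl⟩
    simp only at h
    refine ⟨![r - b - c, b, c], by simp; omega, ?_⟩
    rw [bary_eq (l := fun i => ((![r - b - c, b, c] i : ℕ) : ℝ) / r) hr (a := r - b - c) (b := b)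
      (c := c) (by omega) (by simp) (by simp) (by simp)]

/-! ### Small edges in integer coordinates. -/

/-- The point with parameter `t` on the small edge with index `(b, c)` and direction `d`. -/
def edgePt (d : Fin 3) (b c : ℕ) (t : ℝ) : ℝ × ℝ :=
  ![((b : ℝ) + t, (c : ℝ)), ((b : ℝ), (c : ℝ) + t), ((b : ℝ) + 1 - t, (c : ℝ) + t)] d

/-- The small edge with index `(b, c)` and direction `d`. -/
noncomputable def gridEdge {r : ℕ} (hr : 0 < r) (d : Fin 3) (b c : ℕ) : Cell 1 :=
  .edge (chart T hr (edgePt d b c 0)) (chart T hr (edgePt d b c 1))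

theorem edgePt_eq_combo (d : Fin 3) (b c : ℕ) (t : ℝ) :
    edgePt d b c t = (1 - t) • edgePt d b c 0 + t • edgePt d b c 1 := by
  fin_cases d <;> ext <;> simp [edgePt] <;> ring

theorem chart_edgePt {r : ℕ} (hr : 0 < r) (d : Fin 3) (b c : ℕ) (t : ℝ) :
    chart T hr (edgePt d b c t) =
      AffineMap.lineMap (chart T hr (edgePt d b c 0)) (chart T hr (edgePt d b c 1)) t := by
  rw [edgePt_eq_combo, chart_combo T hr (by ring), AffineMap.lineMap_apply_module]

theorem carrier_gridEdge {r : ℕ} (hr : 0 < r) (d : Fin 3) (b c : ℕ) :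
    (gridEdge T hr d b c).carrier = (fun t => chart T hr (edgePt d b c t)) '' Set.Icc 0 1 := by
  simp only [gridEdge, Cell.carrier, segment_eq_image_lineMap]
  exact Set.image_congr fun t _ => (chart_edgePt T hr d b c t).symm

theorem inner_gridEdge {r : ℕ} (hr : 0 < r) (d : Fin 3) (b c : ℕ) :
    (gridEdge T hr d b c).inner = (fun t => chart T hr (edgePt d b c t)) '' Set.Ioo 0 1 := by
  simp only [gridEdge, Cell.inner, openSegment_eq_image_lineMap]
  exact Set.image_congr fun t _ => (chart_edgePt T hr d b c t).symm

theorem natCast_add_eq {b b' : ℕ} {t t' : ℝ} (ht : t ∈ Set.Ioo (0 : ℝ) 1)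
    (ht' : t' ∈ Set.Ioo (0 : ℝ) 1) (h : (b : ℝ) + t = b' + t') : b = b' := by
  have h1 : (b : ℝ) < (b' + 1 : ℕ) := by push_cast; linarith [ht.1, ht'.2]
  have h2 : (b' : ℝ) < (b + 1 : ℕ) := by push_cast; linarith [ht.2, ht'.1]
  have h3 : b < b' + 1 := by exact_mod_cast h1
  have h4 : b' < b + 1 := by exact_mod_cast h2
  omega

theorem natCast_add_ne {b b' : ℕ} {t : ℝ} (ht : t ∈ Set.Ioo (0 : ℝ) 1) : (b : ℝ) + t ≠ b' := by
  intro h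
  have h1 : (b : ℝ) < (b' : ℕ) := by linarith [ht.1]
  have h2 : (b' : ℝ) < (b + 1 : ℕ) := by push_cast; linarith [ht.2]
  have h3 : b < b' := by exact_mod_cast h1
  have h4 : b' < b + 1 := by exact_mod_cast h2
  omega

/-- The direction can be read off from which of the two coordinates are integers, and the index from
their integer parts. -/
theorem edgePt_inj {d d' : Fin 3} {b c b' c' : ℕ} {t t' : ℝ} (ht : t ∈ Set.Ioo (0 : ℝ) 1)
    (ht' : t' ∈ Set.Ioo (0 : ℝ) 1) (h : edgePt d b c t = edgePt d' b' c' t') :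
    d = d' ∧ b = b' ∧ c = c' := by
  have s : 1 - t ∈ Set.Ioo (0 : ℝ) 1 := ⟨by linarith [ht.2], by linarith [ht.1]⟩
  have s' : 1 - t' ∈ Set.Ioo (0 : ℝ) 1 := ⟨by linarith [ht'.2], by linarith [ht'.1]⟩
  fin_cases d <;> fin_cases d' <;>
    simp only [edgePt, Fin.zero_eta, Fin.mk_one, Fin.reduceFinMk, Matrix.cons_val, Prod.mk.injEq,
      add_sub_assoc] at h <;> obtain ⟨h1, h2⟩ := h
  · exact ⟨rfl, natCast_add_eq ht ht' h1, by exact_mod_cast h2⟩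
  · exact (natCast_add_ne ht h1).elim
  · exact (natCast_add_ne ht' h2.symm).elim
  · exact (natCast_add_ne ht h2).elim
  · exact ⟨rfl, by exact_mod_cast h1, natCast_add_eq ht ht' h2⟩
  · exact (natCast_add_ne s' h1.symm).elim
  · exact (natCast_add_ne ht h2).elim
  · exact (natCast_add_ne s h1).elim
  · exact ⟨rfl, natCast_add_eq s s' h1, natCast_add_eq ht ht' h2⟩

/-- The small edges that lie on the boundary of a region. -/
def IsGoodEdge (r : ℕ) (d : Fin 3) (b c : ℕ) : Prop :=
  b + c + 1 ≤ r ∧ (d = 0 → c ≠ r - r / 2) ∧ (d = 1 → b ≠ r / 2) ∧ (d = 2 → b + c + 1 = r)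

instance (r : ℕ) (d : Fin 3) (b c : ℕ) : Decidable (IsGoodEdge r d b c) := by
  unfold IsGoodEdge; infer_instance

theorem homothety_points {r : ℕ} (hr : 0 < r) {α : Fin 3 → ℕ} (hα : ∑ l, α l = r - 1) (i : Fin 3) :
    homothety T r α (T.points i) =
      chart T hr (![((α 1 : ℝ), (α 2 : ℝ)), ((α 1 : ℝ) + 1, (α 2 : ℝ)),
        ((α 1 : ℝ), (α 2 : ℝ) + 1)] i) := by
  have hr' : (r : ℝ) ≠ 0 := by positivity
  have hs : (r : ℝ) = α 0 + α 1 + α 2 + 1 := by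
    rw [Fin.sum_univ_three] at hα
    have : r = α 0 + α 1 + α 2 + 1 := by omega
    exact_mod_cast this
  have e0 : (r : ℝ) - α 1 - α 2 = α 0 + 1 := by rw [hs]; ring
  have e1 : (r : ℝ) - (α 1 + 1) - α 2 = α 0 := by rw [hs]; ring
  have e2 : (r : ℝ) - α 1 - (α 2 + 1) = α 0 := by rw [hs]; ring
  rw [chart_apply]
  simp only [homothety, pt, Fin.sum_univ_three]
  fin_cases i <;> simp only [bary, Fin.zero_eta, Fin.mk_one, Fin.reduceFinMk, Matrix.cons_val, e0,
    e1, e2] <;> module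

theorem frontier_region {r : ℕ} (hr : 2 ≤ r) {b c : ℕ} (h : IsNode (r / 2) (r - r / 2) b c) :
    frontier (region T r (bary r ((b : ℝ), (c : ℝ)))) =
      chart T (by omega : 0 < r) '' (nodeBox r b c \ interior (nodeBox r b c)) := by
  have hcl : IsClosed (nodeBox r b c) := isClosed_truncatedBox _ _ _ _ _
  rw [region_bary T hr h, ← Homeomorph.image_frontier, hcl.frontier_eq]

theorem half_ne_natCast {b c : ℕ} : (b : ℝ) + 1 / 2 ≠ c :=
  natCast_add_ne ⟨by norm_num, by norm_num⟩

/-- Every side of a box lies on the hypotenuse or on a line u = n with n ≠ x, or v = n with n ≠ y.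
Conversely, each unit edge on such lines bounds the box at its own index or, if that index is
deleted, the double-width box before it. -/
theorem gridEdge_subset_frontier_iff {r : ℕ} (hr : 2 ≤ r) {d : Fin 3} {b c : ℕ} (h : b + c + 1 ≤ r) :
    (∃ ξ ∈ Gamma r, (gridEdge T (by omega : 0 < r) d b c).carrier ⊆ frontier (region T r ξ)) ↔
      IsGoodEdge r d b c := by
  have hr0 : 0 < r := by omega
  have mem : ∀ b' c', IsNode (r / 2) (r - r / 2) b' c' →
      ((gridEdge T hr0 d b c).carrier ⊆ frontier (region T r (bary r ((b' : ℝ), (c' : ℝ)))) ↔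
      ∀ t ∈ Set.Icc (0 : ℝ) 1, edgePt d b c t ∈ nodeBox r b' c' \ interior (nodeBox r b' c')) := by
    intro b' c' hbc
    rw [frontier_region T hr hbc, carrier_gridEdge, Set.image_subset_iff]
    refine forall₂_congr fun t _ => ?_
    rw [Set.mem_preimage, (chart T hr0).injective.mem_set_image]
  have boxmem : ∀ (b' c' : ℕ) (z : ℝ × ℝ), z ∈ nodeBox r b' c' \ interior (nodeBox r b' c') ↔
      (b' ≤ z.1 ∧ z.1 ≤ (next (r / 2) b' : ℕ) ∧ c' ≤ z.2 ∧ z.2 ≤ (next (r - r / 2) c' : ℕ) ∧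
        z.1 + z.2 ≤ r) ∧
      ¬ (b' < z.1 ∧ z.1 < (next (r / 2) b' : ℕ) ∧ c' < z.2 ∧ z.2 < (next (r - r / 2) c' : ℕ) ∧
        z.1 + z.2 < r) := by
    intro b' c' z
    rw [nodeBox, interior_truncatedBox]; rfl
  constructor
  · rintro ⟨ξ, hξ, hsub⟩
    obtain ⟨b', c', hbc, rfl⟩ := (mem_Gamma_iff hr).1 hξ
    rw [mem b' c' hbc] at hsub
    -- The midpoint suffices: its half-integer coordinates cannot equal a box bound, so for an
    -- excluded edge all constraints are strict and the midpoint is interior.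
    have h1 := hsub (1 / 2) ⟨by norm_num, by norm_num⟩
    rw [boxmem] at h1
    obtain ⟨⟨a1, a2, a3, a4, a5⟩, h2⟩ := h1
    refine ⟨h, ?_, ?_, ?_⟩
    · rintro rfl rfl
      simp only [edgePt, Matrix.cons_val_zero] at a1 a2 a3 a4 a5 h2
      refine h2 ⟨lt_of_le_of_ne a1 half_ne_natCast.symm, lt_of_le_of_ne a2 half_ne_natCast,
        lt_of_le_of_ne a3 ?_, lt_of_le_of_ne a4 ?_, lt_of_le_of_ne a5 ?_⟩
      · exact_mod_cast hbc.2.2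
      · exact_mod_cast (next_ne _ _).symm
      · have := half_ne_natCast (b := b + (r - r / 2)) (c := r)
        push_cast at this ⊢
        intro h; exact this (by rw [← h]; ring)
    · rintro rfl rfl
      simp only [edgePt, Matrix.cons_val_one, Matrix.cons_val_zero] at a1 a2 a3 a4 a5 h2
      refine h2 ⟨lt_of_le_of_ne a1 ?_, lt_of_le_of_ne a2 ?_,
        lt_of_le_of_ne a3 half_ne_natCast.symm, lt_of_le_of_ne a4 half_ne_natCast,
        lt_of_le_of_ne a5 ?_⟩
      · exact_mod_cast hbc.2.1
      · exact_mod_cast (next_ne _ _).symm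
      · have := half_ne_natCast (b := r / 2 + c) (c := r)
        push_cast at this ⊢
        intro h; exact this (by rw [← h]; ring)
    · rintro rfl
      by_contra hne
      have e : (b : ℝ) + 1 - 1 / 2 = b + 1 / 2 := by ring
      simp only [edgePt, Matrix.cons_val, e] at a1 a2 a3 a4 a5 h2
      refine h2 ⟨lt_of_le_of_ne a1 half_ne_natCast.symm, lt_of_le_of_ne a2 half_ne_natCast,
        lt_of_le_of_ne a3 half_ne_natCast.symm, lt_of_le_of_ne a4 half_ne_natCast,
        lt_of_le_of_ne a5 ?_⟩
      intro h
      refine hne ?_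
      have : ((b + c + 1 : ℕ) : ℝ) = r := by push_cast; linarith
      exact_mod_cast this
  · rintro ⟨-, g0, g1, g2⟩
    have hle : (b : ℝ) + c + 1 ≤ r := by exact_mod_cast h
    have cast1 : ∀ x m : ℕ, (m : ℝ) + 1 ≤ (next x m : ℕ) := fun x m => by
      exact_mod_cast lt_next x m
    have cast2 : ∀ x m : ℕ, m + 1 = x → ((next x m : ℕ) : ℝ) = m + 2 := fun x m hm => by
      rw [next, if_pos hm]; push_cast; ring
    fin_cases d
    · have g := g0 rfl
      -- No node lies in column x; the box starting in column x - 1 has width two and also covers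
      -- the edge from x to x + 1.
      by_cases hb : b = r / 2
      · obtain ⟨k, hk⟩ : ∃ k, b = k + 1 := ⟨b - 1, by omega⟩
        have hbc : IsNode (r / 2) (r - r / 2) k c := ⟨by omega, by omega, g⟩
        refine ⟨_, (mem_Gamma_iff hr).2 ⟨k, c, hbc, rfl⟩, (mem k c hbc).2 fun t ht => ?_⟩
        have e : (b : ℝ) = k + 1 := by rw [hk]; push_cast; ring
        have := cast2 (r / 2) k (by omega)
        have := cast1 (r - r / 2) c
        rw [boxmem]
        simp only [edgePt, Fin.zero_eta, Matrix.cons_val_zero]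
        obtain ⟨t0, t1⟩ := ht
        exact ⟨⟨by linarith, by linarith, by linarith, by linarith, by linarith⟩,
          fun h => lt_irrefl _ h.2.2.1⟩
      · have hbc : IsNode (r / 2) (r - r / 2) b c := ⟨by omega, hb, g⟩
        refine ⟨_, (mem_Gamma_iff hr).2 ⟨b, c, hbc, rfl⟩, (mem b c hbc).2 fun t ht => ?_⟩
        have := cast1 (r / 2) b
        have := cast1 (r - r / 2) c
        rw [boxmem]
        simp only [edgePt, Fin.zero_eta, Matrix.cons_val_zero]
        obtain ⟨t0, t1⟩ := ht
        exact ⟨⟨by linarith, by linarith, by linarith, by linarith, by linarith⟩,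
          fun h => lt_irrefl _ h.2.2.1⟩
    · have g := g1 rfl
      by_cases hc : c = r - r / 2
      · obtain ⟨k, hk⟩ : ∃ k, c = k + 1 := ⟨c - 1, by omega⟩
        have hbc : IsNode (r / 2) (r - r / 2) b k := ⟨by omega, g, by omega⟩
        refine ⟨_, (mem_Gamma_iff hr).2 ⟨b, k, hbc, rfl⟩, (mem b k hbc).2 fun t ht => ?_⟩
        have e : (c : ℝ) = k + 1 := by rw [hk]; push_cast; ring
        have := cast2 (r - r / 2) k (by omega)
        have := cast1 (r / 2) b
        rw [boxmem]
        simp only [edgePt, Fin.mk_one, Matrix.cons_val]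
        obtain ⟨t0, t1⟩ := ht
        exact ⟨⟨by linarith, by linarith, by linarith, by linarith, by linarith⟩,
          fun h => lt_irrefl _ h.1⟩
      · have hbc : IsNode (r / 2) (r - r / 2) b c := ⟨by omega, g, hc⟩
        refine ⟨_, (mem_Gamma_iff hr).2 ⟨b, c, hbc, rfl⟩, (mem b c hbc).2 fun t ht => ?_⟩
        have := cast1 (r / 2) b
        have := cast1 (r - r / 2) c
        rw [boxmem]
        simp only [edgePt, Fin.mk_one, Matrix.cons_val]
        obtain ⟨t0, t1⟩ := ht
        exact ⟨⟨by linarith, by linarith, by linarith, by linarith, by linarith⟩,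
          fun h => lt_irrefl _ h.1⟩
    · have g : b + c + 1 = r := g2 rfl
      have hg : (b : ℝ) + c + 1 = r := by exact_mod_cast g
      -- The two hypotenuse edges ending at (x, y) both bound the box at (x - 1, y - 1).
      by_cases hbc' : b = r / 2 ∨ c = r - r / 2
      · have hbc : IsNode (r / 2) (r - r / 2) (r / 2 - 1) (r - r / 2 - 1) :=
          ⟨by omega, by omega, by omega⟩
        refine ⟨_, (mem_Gamma_iff hr).2 ⟨_, _, hbc, rfl⟩, (mem _ _ hbc).2 fun t ht => ?_⟩
        have := cast2 (r / 2) (r / 2 - 1) (by omega)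
        have := cast2 (r - r / 2) (r - r / 2 - 1) (by omega)
        obtain ⟨p, q, hp, hq, hor⟩ : ∃ p q : ℕ, r / 2 - 1 = p ∧ r - r / 2 - 1 = q ∧
            ((b = p + 1 ∧ c = q) ∨ (b = p ∧ c = q + 1)) := ⟨_, _, rfl, rfl, by omega⟩
        have hor' : ((b : ℝ) = p + 1 ∧ (c : ℝ) = q) ∨ ((b : ℝ) = p ∧ (c : ℝ) = q + 1) := by
          exact_mod_cast hor
        rw [boxmem]
        simp only [edgePt, Fin.reduceFinMk, Matrix.cons_val, hp, hq] at *
        obtain ⟨t0, t1⟩ := ht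
        rcases hor' with ⟨hb, hc⟩ | ⟨hb, hc⟩ <;>
          exact ⟨⟨by linarith, by linarith, by linarith, by linarith, by linarith⟩,
            fun h => by linarith [h.2.2.2.2]⟩
      · push Not at hbc'
        have hbc : IsNode (r / 2) (r - r / 2) b c := ⟨by omega, hbc'.1, hbc'.2⟩
        refine ⟨_, (mem_Gamma_iff hr).2 ⟨b, c, hbc, rfl⟩, (mem b c hbc).2 fun t ht => ?_⟩
        have := cast1 (r / 2) b
        have := cast1 (r - r / 2) c
        rw [boxmem]
        simp only [edgePt, Fin.reduceFinMk, Matrix.cons_val]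
        obtain ⟨t0, t1⟩ := ht
        exact ⟨⟨by linarith, by linarith, by linarith, by linarith, by linarith⟩,
          fun h => by linarith [h.2.2.2.2]⟩

def edgeIndex (r : ℕ) : Finset (Fin 3 × ℕ × ℕ) :=
  (Finset.univ ×ˢ degreeIndex (r - 1)).filter fun e => IsGoodEdge r e.1 e.2.1 e.2.2

theorem mem_edgeIndex {r : ℕ} {e : Fin 3 × ℕ × ℕ} :
    e ∈ edgeIndex r ↔ IsGoodEdge r e.1 e.2.1 e.2.2 := by
  simp only [edgeIndex, Finset.mem_filter, Finset.mem_product, Finset.mem_univ, mem_degreeIndex,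
    true_and, and_iff_right_iff_imp]
  intro h
  have := h.1
  omega

theorem edge_homothety_eq_gridEdge {r : ℕ} (hr : 0 < r) {α : Fin 3 → ℕ} (hα : ∑ l, α l = r - 1)
    {i j : Fin 3} (hij : i < j) :
    Cell.edge (homothety T r α (T.points i)) (homothety T r α (T.points j)) =
      gridEdge T hr (if i = 0 then if j = 1 then 0 else 1 else 2) (α 1) (α 2) := by
  rw [homothety_points T hr hα, homothety_points T hr hα]
  fin_cases i <;> fin_cases j <;> first | (exact absurd hij (by decide)) | simp [gridEdge, edgePt]

theorem dofs_one_eq {r : ℕ} (hr : 2 ≤ r) :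
    dofs T r 1 = (fun e : Fin 3 × ℕ × ℕ => gridEdge T (by omega : 0 < r) e.1 e.2.1 e.2.2) ''
      (edgeIndex r : Set (Fin 3 × ℕ × ℕ)) := by
  have hr0 : 0 < r := by omega
  ext e
  simp only [dofs, Set.mem_ofPred_eq, Set.mem_image, Finset.mem_coe, mem_edgeIndex]
  constructor
  · rintro ⟨⟨α, i, j, hα, hij, rfl⟩, hfr⟩
    rw [edge_homothety_eq_gridEdge T hr0 hα hij] at hfr ⊢
    rw [gridEdge_subset_frontier_iff T hr (by rw [Fin.sum_univ_three] at hα; omega)] at hfr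
    exact ⟨(_, _, _), hfr, rfl⟩
  · rintro ⟨⟨d, b, c⟩, h, rfl⟩
    simp only at h ⊢
    have hle := h.1
    refine ⟨?_, (gridEdge_subset_frontier_iff T hr hle).2 h⟩
    have hα : ∑ l, ![r - 1 - b - c, b, c] l = r - 1 := by
      simp [Fin.sum_univ_three]; omega
    fin_cases d
    · refine ⟨_, 0, 1, hα, by decide, ?_⟩
      rw [edge_homothety_eq_gridEdge T hr0 hα (by decide)]
      simp
    · refine ⟨_, 0, 2, hα, by decide, ?_⟩
      rw [edge_homothety_eq_gridEdge T hr0 hα (by decide)]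
      simp
    · refine ⟨_, 1, 2, hα, by decide, ?_⟩
      rw [edge_homothety_eq_gridEdge T hr0 hα (by decide)]
      simp

def nodeIndex (r : ℕ) : Finset (ℕ × ℕ) :=
  (degreeIndex (r - 1)).filter fun z => z.1 ≠ r / 2 ∧ z.2 ≠ r - r / 2

theorem mem_nodeIndex {r : ℕ} (hr : 0 < r) {z : ℕ × ℕ} :
    z ∈ nodeIndex r ↔ IsNode (r / 2) (r - r / 2) z.1 z.2 := by
  simp only [nodeIndex, Finset.mem_filter, mem_degreeIndex, IsNode]
  omega

theorem dofs_two_eq {r : ℕ} (hr : 2 ≤ r) :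
    dofs T r 2 = (fun z : ℕ × ℕ => Cell.face (chart T (by omega : 0 < r) '' nodeBox r z.1 z.2)) ''
      (nodeIndex r : Set (ℕ × ℕ)) := by
  ext e
  simp only [dofs, Set.mem_ofPred_eq, Set.mem_image, Finset.mem_coe,
    mem_nodeIndex (by omega : 0 < r)]
  constructor
  · rintro ⟨ξ, hξ, rfl⟩
    obtain ⟨b, c, hbc, rfl⟩ := (mem_Gamma_iff hr).1 hξ
    exact ⟨(b, c), hbc, by rw [region_bary T hr hbc]⟩
  · rintro ⟨⟨b, c⟩, hbc, rfl⟩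
    exact ⟨_, (mem_Gamma_iff hr).2 ⟨b, c, hbc, rfl⟩, by rw [region_bary T hr hbc]⟩

/-! ### Finiteness, cardinality bounds and geometry of the cells. -/

theorem finite_dofs {r : ℕ} (hr : 2 ≤ r) (k : ℕ) : (dofs T r k).Finite := by
  match k with
  | 0 => rw [dofs_zero_eq T (by omega : 0 < r)]; exact (Finset.finite_toSet _).image _
  | 1 => rw [dofs_one_eq T hr]; exact (Finset.finite_toSet _).image _
  | 2 => rw [dofs_two_eq T hr]; exact (Finset.finite_toSet _).image _
  | k + 3 => exact Set.finite_empty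

theorem ncard_dofs_zero_le {r : ℕ} (hr : 2 ≤ r) :
    (dofs T r 0).ncard ≤ 1 * (degreeIndex r).card := by
  rw [dofs_zero_eq T (by omega : 0 < r), one_mul, ← Set.ncard_coe_finset]
  exact Set.ncard_image_le (Finset.finite_toSet _)

/-- The x missing horizontal edges of row y and the y missing vertical edges of column x leave
exactly r places, which the r hypotenuse edges fill: those with b < x go to the row, the others to
the column. -/
theorem ncard_dofs_one_le {r : ℕ} (hr : 2 ≤ r) :
    (dofs T r 1).ncard ≤ 2 * (degreeIndex (r - 1)).card := by
  rw [dofs_one_eq T hr]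
  refine (Set.ncard_image_le (Finset.finite_toSet _)).trans ?_
  rw [Set.ncard_coe_finset]
  have : 2 * (degreeIndex (r - 1)).card =
      ((Finset.univ : Finset (Fin 2)) ×ˢ degreeIndex (r - 1)).card := by
    rw [Finset.card_product]; simp
  rw [this]
  refine Finset.card_le_card_of_injOn
    (fun e => if e.1 = 0 then (0, e.2) else if e.1 = 1 then (1, e.2) else
      if e.2.1 < r / 2 then (0, (e.2.1, r - r / 2)) else (1, (r / 2, e.2.2))) ?_ ?_
  · rintro ⟨d, b, c⟩ h
    rw [Finset.mem_coe, mem_edgeIndex] at h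
    obtain ⟨h1, h2, h3, h4⟩ := h
    simp only at h1 h2 h3 h4
    simp only [Finset.coe_product, Set.mem_prod, Finset.mem_coe, Finset.mem_univ, true_and,
      mem_degreeIndex]
    have h5 : d = 0 ∨ d = 1 ∨ d = 2 := by fin_cases d <;> simp
    split_ifs with a1 a2 a3
    · simp only; omega
    · simp only; omega
    · have := h4 (by tauto)
      simp only; omega
    · have := h4 (by tauto)
      simp only; omega
  · rintro ⟨d, b, c⟩ h ⟨d', b', c'⟩ h' heq
    rw [Finset.mem_coe, mem_edgeIndex] at h h'
    obtain ⟨h1, h2, h3, h4⟩ := h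
    obtain ⟨h1', h2', h3', h4'⟩ := h'
    simp only at h1 h2 h3 h4 h1' h2' h3' h4' heq
    fin_cases d <;> fin_cases d' <;> simp at h1 h2 h3 h4 h1' h2' h3' h4' heq <;>
      (try split_ifs at heq) <;> simp at heq ⊢ <;> omega

/-- Closing the gaps left by the deleted column and row injects the nodes into the lattice of size r
- 2; a node cannot lie beyond both gaps since x + y = r. -/
theorem ncard_dofs_two_le {r : ℕ} (hr : 2 ≤ r) :
    (dofs T r 2).ncard ≤ 1 * (degreeIndex (r - 2)).card := by
  rw [dofs_two_eq T hr, one_mul]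
  refine (Set.ncard_image_le (Finset.finite_toSet _)).trans ?_
  rw [Set.ncard_coe_finset]
  refine Finset.card_le_card_of_injOn
    (fun z => (if r / 2 < z.1 then z.1 - 1 else z.1, if r - r / 2 < z.2 then z.2 - 1 else z.2)) ?_ ?_
  · rintro ⟨b, c⟩ h
    rw [Finset.mem_coe, mem_nodeIndex (by omega)] at h
    obtain ⟨h1, h2, h3⟩ := h
    simp only at h1 h2 h3
    rw [Finset.mem_coe, mem_degreeIndex]
    simp only
    split_ifs <;> omega
  · rintro ⟨b, c⟩ h ⟨b', c'⟩ h' heq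
    rw [Finset.mem_coe, mem_nodeIndex (by omega)] at h h'
    obtain ⟨h1, h2, h3⟩ := h
    obtain ⟨h1', h2', h3'⟩ := h'
    simp only [Prod.mk.injEq] at h1 h2 h3 h1' h2' h3' heq ⊢
    obtain ⟨e1, e2⟩ := heq
    constructor
    · split_ifs at e1 <;> omega
    · split_ifs at e2 <;> omega

theorem pairwiseDisjoint_dofs {r : ℕ} (hr : 2 ≤ r) (k : ℕ) :
    (dofs T r k).PairwiseDisjoint Cell.inner := by
  have hr0 : 0 < r := by omega
  match k with
  | 0 =>
    rw [dofs_zero_eq T hr0]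
    rintro _ ⟨z, _, rfl⟩ _ ⟨w, _, rfl⟩ hne
    refine Set.disjoint_singleton.2 fun h => hne ?_
    simp only [h]
  | 1 =>
    rw [dofs_one_eq T hr]
    rintro _ ⟨⟨d, b, c⟩, _, rfl⟩ _ ⟨⟨d', b', c'⟩, _, rfl⟩ hne
    simp only [Function.onFun, inner_gridEdge]
    rw [Set.disjoint_left]
    rintro _ ⟨t, ht, rfl⟩ ⟨t', ht', h⟩
    obtain ⟨rfl, rfl, rfl⟩ := edgePt_inj ht ht' ((chart T hr0).injective h).symm
    exact hne rfl
  | 2 =>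
    rw [dofs_two_eq T hr]
    rintro _ ⟨⟨b, c⟩, hz, rfl⟩ _ ⟨⟨b', c'⟩, hw, rfl⟩ hne
    rw [Finset.mem_coe, mem_nodeIndex hr0] at hz hw
    simp only [Function.onFun, Cell.inner, ← Homeomorph.image_interior, nodeBox,
      interior_truncatedBox]
    rw [Set.disjoint_left]
    rintro _ ⟨z, ⟨h1, h2, h3, h4, h5⟩, rfl⟩ ⟨z', ⟨h1', h2', h3', h4', h5'⟩, h⟩
    obtain rfl := (chart T hr0).injective h
    refine hne ?_
    -- A common interior point orders the corners of both boxes each way, because no admissible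
    -- value lies strictly between m and `next x m`.
    have aux : ∀ {x m n : ℕ} {t : ℝ}, n ≠ x → (n : ℝ) < t → t < (next x m : ℕ) → n ≤ m := by
      intro x m n t hn h1 h2
      by_contra! hlt
      have : ((next x m : ℕ) : ℝ) ≤ n := by exact_mod_cast next_le hlt hn
      linarith
    obtain rfl : b = b' := le_antisymm (aux hz.2.1 h1 h2') (aux hw.2.1 h1' h2)
    obtain rfl : c = c' := le_antisymm (aux hz.2.2 h3 h4') (aux hw.2.2 h3' h4)
    rfl
  | k + 3 => simp [dofs]

theorem convex_region_cell {r b c : ℕ} (hr : 0 < r) : Convex ℝ (chart T hr '' nodeBox r b c) :=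
  convex_image_chart T hr (convex_truncatedBox _ _ _ _ _)

theorem nonempty_interior_region_cell {r b c : ℕ} (hr : 0 < r) (h : b + c < r) :
    (interior (chart T hr '' nodeBox r b c)).Nonempty := by
  rw [← Homeomorph.image_interior]
  exact (nonempty_interior_nodeBox h).image _

theorem isCompact_region_cell {r b c : ℕ} (hr : 0 < r) : IsCompact (chart T hr '' nodeBox r b c) :=
  (isCompact_truncatedBox _ _ _ _ _).image (chart T hr).continuous

theorem isCell_of_mem_dofs {r : ℕ} (hr : 2 ≤ r) {k : ℕ} {c : Cell k} (hc : c ∈ dofs T r k) :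
    c.IsCell := by
  have hr0 : 0 < r := by omega
  match k with
  | 0 =>
    rw [dofs_zero_eq T hr0] at hc
    obtain ⟨z, -, rfl⟩ := hc
    trivial
  | 1 =>
    rw [dofs_one_eq T hr] at hc
    obtain ⟨⟨d, b, c⟩, -, rfl⟩ := hc
    intro h
    have := (chart T hr0).injective h
    fin_cases d <;> simp [edgePt] at this
  | 2 =>
    rw [dofs_two_eq T hr] at hc
    obtain ⟨⟨b, c⟩, h, rfl⟩ := hc
    rw [Finset.mem_coe, mem_nodeIndex hr0] at h
    -- A compact convex set with nonempty interior is a closed disc.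
    obtain ⟨e, -, he, -⟩ := exists_homeomorph_image_interior_closure_frontier_eq_unitBall
      (convex_region_cell T hr0)
      (nonempty_interior_region_cell T hr0 (b := b) (c := c) (by have := h.1; simp only at this; omega))
      (isCompact_region_cell T hr0).isBounded
    rw [(isCompact_region_cell T hr0).isClosed.closure_eq] at he
    exact ⟨(e.image _).trans (Homeomorph.setCongr he)⟩
  | k + 3 => exact hc.elim

theorem carrier_nonempty_of_mem_dofs {r : ℕ} (hr : 2 ≤ r) {k : ℕ} {c : Cell k}
    (hc : c ∈ dofs T r k) : c.carrier.Nonempty := by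
  have hr0 : 0 < r := by omega
  match k with
  | 0 =>
    rw [dofs_zero_eq T hr0] at hc
    obtain ⟨z, -, rfl⟩ := hc
    exact Set.singleton_nonempty _
  | 1 =>
    rw [dofs_one_eq T hr] at hc
    obtain ⟨⟨d, b, c⟩, -, rfl⟩ := hc
    exact ⟨_, left_mem_segment ℝ _ _⟩
  | 2 =>
    rw [dofs_two_eq T hr] at hc
    obtain ⟨⟨b, c⟩, h, rfl⟩ := hc
    rw [Finset.mem_coe, mem_nodeIndex hr0] at h
    exact (nonempty_interior_region_cell T hr0 (b := b) (c := c)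
      (by have := h.1; simp only at this; omega)).mono interior_subset
  | k + 3 => exact hc.elim

theorem chart_mem_subcell_univ {r : ℕ} (hr : 0 < r) {z : ℝ × ℝ} :
    chart T hr z ∈ subcell T Finset.univ ↔ z ∈ rightTriangle r 0 0 := by
  rw [subcell_univ_eq T hr, (chart T hr).injective.mem_set_image]

theorem carrier_subset_of_mem_dofs {r : ℕ} (hr : 2 ≤ r) {k : ℕ} {c : Cell k}
    (hc : c ∈ dofs T r k) : c.carrier ⊆ subcell T Finset.univ := by
  have hr0 : 0 < r := by omega
  match k with
  | 0 =>
    rw [dofs_zero_eq T hr0] at hc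
    obtain ⟨z, hz, rfl⟩ := hc
    rw [Finset.mem_coe, mem_degreeIndex] at hz
    rintro _ rfl
    rw [chart_mem_subcell_univ]
    refine ⟨by positivity, by positivity, ?_⟩
    simp only
    exact_mod_cast hz
  | 1 =>
    rw [dofs_one_eq T hr] at hc
    obtain ⟨⟨d, b, c⟩, h, rfl⟩ := hc
    rw [Finset.mem_coe, mem_edgeIndex] at h
    have hle : (b : ℝ) + c + 1 ≤ r := by exact_mod_cast h.1
    have hb : (0 : ℝ) ≤ b := by positivity
    have hc : (0 : ℝ) ≤ c := by positivity
    rw [carrier_gridEdge]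
    rintro _ ⟨t, ⟨t0, t1⟩, rfl⟩
    simp only
    rw [chart_mem_subcell_univ]
    fin_cases d <;> simp only [rightTriangle, edgePt, Fin.zero_eta, Fin.mk_one, Fin.reduceFinMk,
      Matrix.cons_val, Set.mem_ofPred_eq] <;> exact ⟨by linarith, by linarith, by linarith⟩
  | 2 =>
    rw [dofs_two_eq T hr] at hc
    obtain ⟨⟨b, c⟩, h, rfl⟩ := hc
    rintro _ ⟨z, ⟨h1, h2, h3, h4, h5⟩, rfl⟩
    rw [chart_mem_subcell_univ]
    have hb : (0 : ℝ) ≤ b := by positivity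
    have hc : (0 : ℝ) ≤ c := by positivity
    exact ⟨hb.trans h1, hc.trans h3, h5⟩
  | k + 3 => exact hc.elim

/-! ## Polynomial forms: traces, weights and dimensions -/

theorem trace_apply (S : Finset (Fin 3)) (k : ℕ) (ω : Form k) (p : subcell T S)
    (v : Fin k → tangent T S) : trace T S k ω p v = ω p (fun i => (v i : Plane)) := rfl

theorem coeff_comp_mem_bipoly {m k : ℕ} {ω : Form k} (hω : ω ∈ polyForm m k) (r : ℕ)
    (P : Fin 3 → Plane) (v : Fin k → Plane) : (fun z => ω (baryMap r P z) v) ∈ bipoly m :=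
  comp_mem_bipoly_of_mem_polyFun (hω v) (baryMap_mem_bipoly r P)

theorem continuous_coeff {m k : ℕ} {ω : Form k} (hω : ω ∈ polyForm m k) (v : Fin k → Plane) :
    Continuous fun x => ω x v := by
  obtain ⟨p, -, hp⟩ := hω v
  have h : (fun x => ω x v) = fun x : Plane => MvPolynomial.eval (fun i => x i) p := by
    rw [← hp]
    rfl
  rw [h]
  exact (MvPolynomial.continuous_eval p).comp (by fun_prop)

theorem weight_smul {k : ℕ} (a : ℝ) (ω : Form k) (c : Cell k) :
    weight (a • ω) c = a * weight ω c := by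
  cases c with
  | point p => simp [weight]
  | edge p q => simp only [weight, Pi.smul_apply, ContinuousAlternatingMap.smul_apply,
      smul_eq_mul, intervalIntegral.integral_const_mul]
  | face s => simp only [weight, Pi.smul_apply, ContinuousAlternatingMap.smul_apply,
      smul_eq_mul, integral_const_mul]

theorem weight_add {r : ℕ} (hr : 2 ≤ r) {m k : ℕ} {ω ω' : Form k} (hω : ω ∈ polyForm m k)
    (hω' : ω' ∈ polyForm m k) {c : Cell k} (hc : c ∈ dofs T r k) :
    weight (ω + ω') c = weight ω c + weight ω' c := by
  cases c with
  | point p => simp [weight]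
  | edge p q =>
    have h : ∀ {ω : Form 1}, ω ∈ polyForm m 1 →
        IntervalIntegrable (fun t : ℝ => ω (AffineMap.lineMap p q t) ![q - p]) volume 0 1 :=
      fun hω => ((continuous_coeff hω _).comp AffineMap.lineMap_continuous).intervalIntegrable _ _
    simpa [weight] using intervalIntegral.integral_add (h hω) (h hω')
  | face s =>
    have hs : IsCompact s := by
      rw [dofs_two_eq T hr] at hc
      obtain ⟨z, -, hz⟩ := hc
      cases hz
      exact isCompact_region_cell T (by omega)
    have h : ∀ {ω : Form 2}, ω ∈ polyForm m 2 → IntegrableOn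
        (fun x => ω x ![EuclideanSpace.single 0 1, EuclideanSpace.single 1 1]) s :=
      fun hω => (continuous_coeff hω _).continuousOn.integrableOn_compact hs
    simpa [weight] using integral_add (h hω) (h hω')

theorem subcell_subset_affineSpan (S : Finset (Fin 3)) :
    subcell T S ⊆ affineSpan ℝ (T.points '' (S : Set (Fin 3))) :=
  convexHull_subset_affineSpan _

/-- The weight on a cell contained in a subcell depends only on the trace on the subcell. -/
theorem weight_congr {r : ℕ} (hr : 2 ≤ r) {k : ℕ} {ω ω' : Form k} {c : Cell k}
    (hc : c ∈ dofs T r k) {S : Finset (Fin 3)} (hS : c.carrier ⊆ subcell T S)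
    (h : trace T S k ω = trace T S k ω') : weight ω c = weight ω' c := by
  have key : ∀ x ∈ subcell T S, ∀ v : Fin k → Plane, (∀ i, v i ∈ tangent T S) →
      ω x v = ω' x v := by
    intro x hx v hv
    have := congrFun h ⟨x, hx⟩
    exact congrArg (fun f => f fun i => (⟨v i, hv i⟩ : tangent T S)) this
  cases c with
  | point p => exact key p (hS rfl) _ (fun i => i.elim0)
  | edge p q =>
    have hp := subcell_subset_affineSpan T S (hS (left_mem_segment ℝ p q))
    have hq := subcell_subset_affineSpan T S (hS (right_mem_segment ℝ p q))
    have hv : q - p ∈ tangent T S := by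
      have := AffineSubspace.vsub_mem_direction hq hp
      rwa [direction_affineSpan] at this
    refine intervalIntegral.integral_congr fun t ht => ?_
    rw [Set.uIcc_of_le zero_le_one] at ht
    refine key _ (hS ?_) _ (fun i => by simpa using hv)
    simp only [Cell.carrier, segment_eq_image_lineMap]
    exact ⟨t, ht, rfl⟩
  | face s =>
    rw [dofs_two_eq T hr] at hc
    obtain ⟨z, hz, hs⟩ := hc
    cases hs
    rw [Finset.mem_coe, mem_nodeIndex (by omega)] at hz
    -- A subcell containing a region has interior, so its tangent space is the whole plane and the
    -- trace loses nothing.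
    have hne := (nonempty_interior_region_cell T (by omega : 0 < r) (b := z.1) (c := z.2)
      (by have := hz.1; omega)).mono (interior_mono hS)
    have htop : tangent T S = ⊤ := by
      rw [tangent, ← direction_affineSpan, affineSpan_eq_top_of_nonempty_interior hne,
        AffineSubspace.direction_top]
    refine setIntegral_congr_fun (isCompact_region_cell T (by omega)).measurableSet fun x hx => ?_
    exact key x (hS hx) _ fun i => by rw [htop]; trivial

theorem weight_zero {k : ℕ} (c : Cell k) : weight (0 : Form k) c = 0 := by
  cases c <;> simp [weight]

theorem finrank_tangent_le {S : Finset (Fin 3)} (hS : S.Nonempty) :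
    Module.finrank ℝ (tangent T S) + 1 ≤ S.card := by
  classical
  have h := finrank_vectorSpan_image_finset_le ℝ T.points S (n := S.card - 1)
    (by have := hS.card_pos; omega)
  rw [Finset.coe_image] at h
  have := hS.card_pos
  have h2 : Module.finrank ℝ (tangent T S) ≤ S.card - 1 := h
  omega

/-- An alternating form vanishes on linearly dependent vectors, and k exceeds the dimension of the
subcell. -/
theorem trace_eq_zero_of_card_le {S : Finset (Fin 3)} (hS : S.Nonempty) {k : ℕ} (hk : S.card ≤ k)
    (ω : Form k) : trace T S k ω = 0 := by
  ext p v
  refine (trace T S k ω p).toAlternatingMap.map_linearDependent v fun h => ?_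
  have h1 := h.fintype_card_le_finrank
  have := finrank_tangent_le T hS
  simp only [Fintype.card_fin] at h1
  omega

/-! ### Dimensions -/

theorem finrank_polyFun (m : ℕ) : (degreeIndex m).card ≤ Module.finrank ℝ (polyFun m) := by
  have hinj : Function.Injective (LinearMap.pi fun x : Plane =>
      (MvPolynomial.aeval (R := ℝ) (fun i : Fin 2 => x i)).toLinearMap) := by
    intro p q h
    refine MvPolynomial.funext fun x => ?_
    exact congrFun h (WithLp.toLp 2 x)
  rw [polyFun, ← (Submodule.equivMapOfInjective _ hinj _).finrank_eq]
  have hb := Module.finrank_eq_nat_card_basis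
    (MvPolynomial.basisRestrictSupport ℝ {n : Fin 2 →₀ ℕ | (n.sum fun _ e => e) ≤ m})
  rw [MvPolynomial.restrictTotalDegree, hb]
  have hfin : Finite {n : Fin 2 →₀ ℕ | (n.sum fun _ e => e) ≤ m} := by
    have : Module.Finite ℝ (MvPolynomial.restrictSupport ℝ
        {n : Fin 2 →₀ ℕ | (n.sum fun _ e => e) ≤ m}) :=
      inferInstanceAs (Module.Finite ℝ (MvPolynomial.restrictTotalDegree (Fin 2) ℝ m))
    exact Module.Finite.finite_basis (MvPolynomial.basisRestrictSupport ℝ _)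
  rw [← Nat.card_eq_finsetCard]
  refine Nat.card_le_card_of_injective (fun z : degreeIndex m =>
    (⟨Finsupp.equivFunOnFinite.symm ![z.1.1, z.1.2], ?_⟩ :
      {n : Fin 2 →₀ ℕ | (n.sum fun _ e => e) ≤ m})) ?_
  · have := mem_degreeIndex.1 z.2
    rw [Set.mem_ofPred_eq, Finsupp.sum_fintype _ _ (by simp)]
    simpa using this
  · intro z w h
    have h1 := DFunLike.congr_fun (congrArg Subtype.val h)
    have h2 := h1 0
    have h3 := h1 1
    simp only [Finsupp.equivFunOnFinite_symm_apply_apply, Matrix.cons_val] at h2 h3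
    exact Subtype.ext (Prod.ext h2 h3)

/-- A dual pair of constant forms and multivectors bounds the dimension of the space of polynomial
forms from below. -/
theorem le_finrank_polyForm {m k n : ℕ} [Module.Finite ℝ (polyForm m k)]
    (θ : Fin n → Plane [⋀^Fin k]→L[ℝ] ℝ) (w : Fin n → Fin k → Plane)
    (h : ∀ i j, θ i (w j) = if i = j then 1 else 0) :
    n * (degreeIndex m).card ≤ Module.finrank ℝ (polyForm m k) := by
  have hmem : ∀ f : Fin n → polyFun m,
      (fun x => ∑ i, (f i : Plane → ℝ) x • θ i) ∈ polyForm m k := by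
    intro f v
    have : (fun x => (∑ i, (f i : Plane → ℝ) x • θ i) v) =
        ∑ i, θ i v • (f i : Plane → ℝ) := by
      ext x
      simp [mul_comm]
    rw [this]
    exact Submodule.sum_mem _ fun i _ => Submodule.smul_mem _ _ (f i).2
  let Φ : (Fin n → polyFun m) →ₗ[ℝ] polyForm m k :=
    { toFun := fun f => ⟨_, hmem f⟩
      map_add' := fun f g => by
        ext x v
        simp [add_mul, Finset.sum_add_distrib]
      map_smul' := fun a f => by
        ext x v
        simp [Finset.mul_sum, mul_assoc] }
  have hΦ : Function.Injective Φ := by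
    intro f g hfg
    ext j x
    have h1 := congrArg (fun ω : polyForm m k => (ω : Form k) x (w j)) hfg
    simpa [Φ, h] using h1
  have hfin : Module.Finite ℝ (polyFun m) := by
    unfold polyFun; infer_instance
  have h1 := LinearMap.finrank_le_finrank_of_injective hΦ
  rw [Module.finrank_pi_fintype] at h1
  simp only [Finset.sum_const, Finset.card_univ, Fintype.card_fin, smul_eq_mul] at h1
  exact (Nat.mul_le_mul_left n (finrank_polyFun m)).trans h1

theorem le_finrank_polyForm_zero (m : ℕ) [Module.Finite ℝ (polyForm m 0)] :
    1 * (degreeIndex m).card ≤ Module.finrank ℝ (polyForm m 0) :=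
  le_finrank_polyForm (fun _ => ContinuousAlternatingMap.constOfIsEmpty ℝ Plane (Fin 0) 1)
    (fun _ => ![]) fun i j => by simp [Subsingleton.elim i j]

theorem le_finrank_polyForm_one (m : ℕ) [Module.Finite ℝ (polyForm m 1)] :
    2 * (degreeIndex m).card ≤ Module.finrank ℝ (polyForm m 1) :=
  le_finrank_polyForm
    (fun i => ContinuousAlternatingMap.ofSubsingleton ℝ Plane ℝ (0 : Fin 1)
      (EuclideanSpace.proj i : Plane →L[ℝ] ℝ))
    (fun j _ => EuclideanSpace.single j 1) fun i j => by
      simp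

/-- The standard basis of the plane. -/
noncomputable def planeBasis : Module.Basis (Fin 2) ℝ Plane :=
  (EuclideanSpace.basisFun (Fin 2) ℝ).toBasis

theorem planeBasis_eq :
    (planeBasis : Fin 2 → Plane) = ![EuclideanSpace.single 0 1, EuclideanSpace.single 1 1] := by
  ext i : 1
  fin_cases i <;> simp [planeBasis]

theorem le_finrank_polyForm_two (m : ℕ) [Module.Finite ℝ (polyForm m 2)] :
    1 * (degreeIndex m).card ≤ Module.finrank ℝ (polyForm m 2) := by
  have hc : Continuous fun v : Fin 2 → Plane => planeBasis.det v := by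
    have : (fun v : Fin 2 → Plane => planeBasis.det v) =
        fun v => v 0 0 * v 1 1 - v 1 0 * v 0 1 := by
      ext v
      simp [Module.Basis.det_apply, Matrix.det_fin_two, Module.Basis.toMatrix_apply, planeBasis]
    rw [this]
    fun_prop
  exact le_finrank_polyForm
    (fun _ => ⟨⟨planeBasis.det.toMultilinearMap, hc⟩, planeBasis.det.map_eq_zero_of_eq'⟩)
    (fun _ => planeBasis) fun i j => by
      rw [if_pos (Subsingleton.elim i j)]
      exact planeBasis.det_self

theorem ext_two_form {f : Plane [⋀^Fin 2]→L[ℝ] ℝ}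
    (h : f ![EuclideanSpace.single 0 1, EuclideanSpace.single 1 1] = 0) : f = 0 := by
  rw [← planeBasis_eq] at h
  have h1 := f.toAlternatingMap.eq_smul_basis_det planeBasis
  have h2 : f.toAlternatingMap planeBasis = 0 := h
  rw [h2, zero_smul] at h1
  exact ContinuousAlternatingMap.toAlternatingMap_injective h1

/-! ## Unisolvence on the subcells -/

/-- The vertices `P` may be dependent: the pullback by an affine map is polynomial of the same
degree in any case. This is what allows proper subcells to be treated as degenerate triangles. -/
theorem zero_form_eq_zero_on_image {m : ℕ} {ω : Form 0} (hω : ω ∈ polyForm m 0) (r : ℕ)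
    (P : Fin 3 → Plane)
    (h : ∀ b c : ℕ, b + c ≤ m → weight ω (.point (baryMap r P ((b : ℝ), (c : ℝ)))) = 0)
    (z : ℝ × ℝ) : ω (baryMap r P z) = 0 := by
  have h1 := eq_zero_of_lattice (coeff_comp_mem_bipoly hω r P ![]) h
  ext v
  rw [Subsingleton.elim v ![]]
  exact congrFun h1 z

theorem baryMap_edgePt_sub {r : ℕ} (P : Fin 3 → Plane) (d : Fin 3) (b c : ℕ) :
    baryMap r P (edgePt d b c 1) - baryMap r P (edgePt d b c 0) =
      (1 / (r : ℝ)) • ![P 1 - P 0, P 2 - P 0, P 2 - P 1] d := by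
  rw [baryMap, baryMap, ← Finset.sum_sub_distrib]
  simp only [Fin.sum_univ_three, ← sub_smul]
  fin_cases d <;> simp only [bary, edgePt, Fin.zero_eta, Fin.mk_one, Fin.reduceFinMk,
    Matrix.cons_val] <;> module

theorem baryMap_edgePt {r : ℕ} (P : Fin 3 → Plane) (d : Fin 3) (b c : ℕ) (t : ℝ) :
    baryMap r P (edgePt d b c t) =
      AffineMap.lineMap (baryMap r P (edgePt d b c 0)) (baryMap r P (edgePt d b c 1)) t := by
  rw [edgePt_eq_combo, baryMap_combo P (by ring), AffineMap.lineMap_apply_module]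

/-- The functional `ω_x` of a 1-form. -/
noncomputable def oneFormAt (ω : Form 1) (x : Plane) : Plane →L[ℝ] ℝ :=
  (ContinuousAlternatingMap.ofSubsingleton ℝ Plane ℝ (0 : Fin 1)).symm (ω x)

theorem oneFormAt_apply (ω : Form 1) (x v : Plane) : oneFormAt ω x v = ω x ![v] := by
  have : ![v] = fun _ : Fin 1 => v := by ext i : 1; simp
  rw [this]; rfl

theorem weight_edge_baryMap {r : ℕ} (ω : Form 1) (P : Fin 3 → Plane) (d : Fin 3) (b c : ℕ) :
    weight ω (.edge (baryMap r P (edgePt d b c 0)) (baryMap r P (edgePt d b c 1))) =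
      ∫ t in (0 : ℝ)..1, oneFormAt ω (baryMap r P (edgePt d b c t))
        ((1 / (r : ℝ)) • ![P 1 - P 0, P 2 - P 0, P 2 - P 1] d) := by
  simp only [weight, oneFormAt_apply, baryMap_edgePt_sub]
  refine intervalIntegral.integral_congr fun t _ => ?_
  beta_reduce
  rw [baryMap_edgePt P d b c t]

/-- The pullback of ω by `baryMap` is A du + B dv, with A and B the values of ω on (P 1 - P 0)/r and
(P 2 - P 0)/r; the edge integrals determine both, also for degenerate `P`. -/
theorem one_form_eq_zero_on_image {r : ℕ} (hr : 2 ≤ r) {ω : Form 1} (hω : ω ∈ polyForm (r - 1) 1)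
    (P : Fin 3 → Plane)
    (h : ∀ d b c, IsGoodEdge r d b c →
      weight ω (.edge (baryMap r P (edgePt d b c 0)) (baryMap r P (edgePt d b c 1))) = 0)
    (z : ℝ × ℝ) (i : Fin 3) : oneFormAt ω (baryMap r P z) (P i - P 0) = 0 := by
  have hr' : (r : ℝ) ≠ 0 := by positivity
  simp only [weight_edge_baryMap] at h
  have hmem : ∀ v, (fun z => oneFormAt ω (baryMap r P z) v) ∈ bipoly (r - 1) := fun v => by
    simp only [oneFormAt_apply]
    exact coeff_comp_mem_bipoly hω r P _
  obtain ⟨hA, hB⟩ := eq_zero_of_integral_edges (x := r / 2) (y := r - r / 2) (r := r) (by omega)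
    (by omega) (by omega) (hmem ((1 / (r : ℝ)) • (P 1 - P 0))) (hmem ((1 / (r : ℝ)) • (P 2 - P 0)))
    (fun b c hbc hc => h 0 b c ⟨hbc, fun _ => hc, by simp, by simp⟩)
    (fun b c hbc hb => h 1 b c ⟨hbc, by simp, fun _ => hb, by simp⟩)
    (fun b c hbc => by
      have h1 := h 2 b c ⟨hbc.le, by simp, by simp, fun _ => hbc⟩
      refine Eq.trans ?_ h1
      refine intervalIntegral.integral_congr fun t _ => ?_
      simp only [edgePt, Matrix.cons_val]
      rw [← map_sub]
      congr 1
      module)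
  have h1 := congrFun hA z
  have h2 := congrFun hB z
  simp only [map_smul, Pi.zero_apply, smul_eq_mul, mul_eq_zero, one_div, inv_eq_zero, hr',
    false_or] at h1 h2
  fin_cases i
  · simp
  · exact h1
  · exact h2

/-! ### Change of variables and unisolvence on the whole triangle. -/

theorem measurableEmbedding_chart {r : ℕ} (hr : 0 < r) : MeasurableEmbedding (chart T hr) :=
  (chart T hr).measurableEmbedding

/-- Uniqueness of Haar measure for the linear part, and translation invariance. Only vanishing of
integrals is at stake, so the constant need not be computed. -/
theorem exists_map_chart_volume {r : ℕ} (hr : 0 < r) :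
    ∃ c : NNReal, c ≠ 0 ∧
      (volume : Measure Plane) = c • Measure.map (chart T hr) (volume : Measure (ℝ × ℝ)) := by
  have hL : (Measure.map (chartLinearEquiv T hr) (volume : Measure (ℝ × ℝ))).IsAddHaarMeasure :=
    (chartLinearEquiv T hr).isAddHaarMeasure_map _
  have h1 := Measure.isAddLeftInvariant_eq_smul (volume : Measure Plane)
    (Measure.map (chartLinearEquiv T hr) (volume : Measure (ℝ × ℝ)))
  refine ⟨_, (Measure.addHaarScalarFactor_pos_of_isAddHaarMeasure (volume : Measure Plane)
    (Measure.map (chartLinearEquiv T hr) (volume : Measure (ℝ × ℝ)))).ne', h1.trans ?_⟩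
  congr 1
  have h2 : (chart T hr : ℝ × ℝ → Plane) = (fun x => x + T.points 0) ∘ chartLinearEquiv T hr := rfl
  rw [h2, ← Measure.map_map (by fun_prop) (chartLinearEquiv T hr).continuous.measurable,
    map_add_right_eq_self]

theorem setIntegral_chart_image_eq_zero_iff {r : ℕ} (hr : 0 < r) (s : Set (ℝ × ℝ))
    (f : Plane → ℝ) : ∫ x in chart T hr '' s, f x = 0 ↔ ∫ z in s, f (chart T hr z) = 0 := by
  obtain ⟨c, hc, h⟩ := exists_map_chart_volume T hr
  rw [h, Measure.restrict_smul, integral_smul_nnreal_measure, smul_eq_zero_iff_right hc,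
    (measurableEmbedding_chart T hr).setIntegral_map,
    Set.preimage_image_eq _ (chart T hr).injective]

theorem two_form_eq_zero {r : ℕ} (hr : 2 ≤ r) {ω : Form 2} (hω : ω ∈ polyForm (r - 2) 2)
    (h : ∀ c ∈ dofs T r 2, weight ω c = 0) : ω = 0 := by
  have hr0 : 0 < r := by omega
  have h1 := coeff_comp_mem_bipoly hω r T.points
    ![EuclideanSpace.single 0 1, EuclideanSpace.single 1 1]
  have h2 := eq_zero_of_integral_truncatedBox (x := r / 2) (y := r - r / 2) (r := r) (by omega)
    (by omega) h1 fun b c hbc => by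
      have h3 := h (.face (chart T hr0 '' nodeBox r b c)) (by
        rw [dofs_two_eq T hr]
        exact ⟨(b, c), (mem_nodeIndex hr0).2 hbc, rfl⟩)
      simp only [weight] at h3
      rw [setIntegral_chart_image_eq_zero_iff T hr0] at h3
      simp only [chart_eq_baryMap] at h3
      exact h3
  ext1 x
  obtain ⟨z, rfl⟩ := (chart T hr0).surjective x
  refine ext_two_form ?_
  rw [chart_eq_baryMap]
  exact congrFun h2 z

theorem point_chart_mem_dofs {r : ℕ} (hr : 0 < r) {b c : ℕ} (h : b + c ≤ r) :
    Cell.point (chart T hr ((b : ℝ), (c : ℝ))) ∈ dofs T r 0 := by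
  rw [dofs_zero_eq T hr]
  exact ⟨(b, c), mem_degreeIndex.2 h, rfl⟩

theorem gridEdge_mem_dofs {r : ℕ} (hr : 2 ≤ r) {d : Fin 3} {b c : ℕ} (h : IsGoodEdge r d b c) :
    gridEdge T (by omega : 0 < r) d b c ∈ dofs T r 1 := by
  rw [dofs_one_eq T hr]
  exact ⟨(d, b, c), mem_edgeIndex.2 h, rfl⟩

/-- The weights on all the cells determine the polynomial forms. -/
theorem eq_zero_of_weights {r : ℕ} (hr : 2 ≤ r) {k : ℕ} (hk : k ≤ 2) {ω : Form k}
    (hω : ω ∈ polyForm (r - k) k) (h : ∀ c ∈ dofs T r k, weight ω c = 0) : ω = 0 := by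
  have hr0 : 0 < r := by omega
  interval_cases k
  · ext1 x
    obtain ⟨z, rfl⟩ := (chart T hr0).surjective x
    rw [chart_eq_baryMap]
    refine zero_form_eq_zero_on_image hω r T.points (fun b c hbc => ?_) z
    rw [← chart_eq_baryMap T hr0]
    exact h _ (point_chart_mem_dofs T hr0 hbc)
  · ext1 x
    obtain ⟨z, rfl⟩ := (chart T hr0).surjective x
    have h1 := one_form_eq_zero_on_image hr hω T.points (fun d b c hd => by
      rw [← chart_eq_baryMap T hr0, ← chart_eq_baryMap T hr0]
      exact h _ (gridEdge_mem_dofs T hr hd)) z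
    rw [← chart_eq_baryMap T hr0] at h1
    have h2 : oneFormAt ω (chart T hr0 z) = 0 := by
      -- The triangle is nondegenerate, so the vectors on which the form is known to vanish span the
      -- plane.
      have htop := T.independent.vectorSpan_eq_top_of_card_eq_finrank_add_one (by simp)
      rw [vectorSpan_range_eq_span_range_vsub_right ℝ T.points 0] at htop
      ext1 v
      have hv : v ∈ Submodule.span ℝ (Set.range fun i => T.points i -ᵥ T.points 0) := by
        rw [htop]; trivial
      refine Submodule.span_induction (p := fun v _ => oneFormAt ω (chart T hr0 z) v = 0)
        ?_ ?_ ?_ ?_ hv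
      · rintro _ ⟨i, rfl⟩
        exact h1 i
      · simp
      · intro v w _ _ hv hw
        rw [map_add, hv, hw, add_zero]
      · intro a v _ hv
        rw [map_smul, hv, smul_zero]
    ext v
    have h3 : v = ![v 0] := by ext i : 1; fin_cases i; rfl
    rw [h3, ← oneFormAt_apply, h2]
    rfl
  · exact two_form_eq_zero T hr hω h

/-! ### Retraction to a subcell -/

/-- Collect the coefficients of the vertices with the same image under `ρ`. -/
def pushWeights {R : Type*} [AddCommMonoid R] (ρ : Fin 3 → Fin 3) (l : Fin 3 → R) : Fin 3 → R :=
  fun j => ∑ i, if ρ i = j then l i else 0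

theorem sum_pushWeights {R : Type*} [AddCommMonoid R] (ρ : Fin 3 → Fin 3) (l : Fin 3 → R) :
    ∑ j, pushWeights ρ l j = ∑ i, l i := by
  simp only [pushWeights]
  rw [Finset.sum_comm]
  simp

theorem sum_pushWeights_smul (ρ : Fin 3 → Fin 3) (l : Fin 3 → ℝ) :
    ∑ j, pushWeights ρ l j • T.points j = ∑ i, l i • T.points (ρ i) := by
  simp only [pushWeights, Finset.sum_smul, ite_smul, zero_smul]
  rw [Finset.sum_comm]
  simp

theorem natCast_pushWeights (ρ : Fin 3 → Fin 3) (l : Fin 3 → ℕ) :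
    (fun j => ((pushWeights ρ l j : ℕ) : ℝ)) = pushWeights ρ fun i => (l i : ℝ) := by
  ext j
  simp [pushWeights]

theorem pushWeights_eq_zero {R : Type*} [AddCommMonoid R] {ρ : Fin 3 → Fin 3}
    {S : Finset (Fin 3)} (hρ : ∀ i, ρ i ∈ S) (l : Fin 3 → R) {j : Fin 3} (hj : j ∉ S) :
    pushWeights ρ l j = 0 :=
  Finset.sum_eq_zero fun i _ => if_neg fun h : ρ i = j => hj (h ▸ hρ i)

theorem homothety_baryMap {r : ℕ} (P : Fin 3 → Plane) {a b c : ℕ}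
    (h : a + b + c + 1 = r) (i : Fin 3) :
    (1 / (r : ℝ)) • (P i + ∑ l, ((![a, b, c] l : ℕ) : ℝ) • P l) =
      baryMap r P (![((b : ℝ), (c : ℝ)), ((b : ℝ) + 1, (c : ℝ)), ((b : ℝ), (c : ℝ) + 1)] i) := by
  have hs : (r : ℝ) = a + b + c + 1 := by exact_mod_cast h.symm
  have e0 : (r : ℝ) - b - c = a + 1 := by rw [hs]; ring
  have e1 : (r : ℝ) - (b + 1) - c = a := by rw [hs]; ring
  have e2 : (r : ℝ) - b - (c + 1) = a := by rw [hs]; ring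
  simp only [baryMap, Fin.sum_univ_three]
  fin_cases i <;> simp only [bary, Fin.zero_eta, Fin.mk_one, Fin.reduceFinMk, Matrix.cons_val, e0,
    e1, e2] <;> module

theorem exists_retraction {S : Finset (Fin 3)} (hS : S.Nonempty) :
    ∃ ρ : Fin 3 → Fin 3, (∀ i, ρ i ∈ S) ∧ ∀ i ∈ S, ρ i = i := by
  obtain ⟨i₀, h₀⟩ := hS
  refine ⟨fun i => if i ∈ S then i else i₀, fun i => ?_, fun i hi => if_pos hi⟩
  simp only
  split_ifs with h
  · exact h
  · exact h₀

theorem mem_subcell_eq_baryMap {r : ℕ} (hr : 0 < r) {S : Finset (Fin 3)} {ρ : Fin 3 → Fin 3}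
    (hρ : ∀ i ∈ S, ρ i = i) {p : Plane} (hp : p ∈ subcell T S) :
    ∃ z, p = baryMap r (fun i => T.points (ρ i)) z := by
  obtain ⟨l, h1, h2, h3, rfl⟩ := (mem_subcell T).1 hp
  refine ⟨(r * l 1, r * l 2), ?_⟩
  rw [baryMap, ← eq_bary hr h2, pt]
  refine Finset.sum_congr rfl fun i _ => ?_
  by_cases hi : i ∈ S
  · rw [hρ i hi]
  · rw [h3 i hi, zero_smul, zero_smul]

/-- The degenerate triangle with vertices `T.points (ρ i)` covers the subcell, and `pushWeights`
shows that its lattice points are principal lattice points lying in S. -/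
theorem trace_zero_form_eq_zero {r : ℕ} (hr : 2 ≤ r) {S : Finset (Fin 3)} (hS : S.Nonempty)
    {ω : Form 0} (hω : ω ∈ polyForm r 0)
    (h : ∀ c ∈ dofs T r 0, c.carrier ⊆ subcell T S → weight ω c = 0) : trace T S 0 ω = 0 := by
  have hr0 : 0 < r := by omega
  obtain ⟨ρ, hρS, hρ⟩ := exists_retraction hS
  ext p v
  obtain ⟨z, hz⟩ := mem_subcell_eq_baryMap T hr0 hρ p.2
  rw [trace_apply, hz, zero_form_eq_zero_on_image hω r (fun i => T.points (ρ i)) ?_ z]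
  · rfl
  · intro b c hbc
    obtain ⟨α, hα⟩ : ∃ α : Fin 3 → ℕ, α = ![r - b - c, b, c] := ⟨_, rfl⟩
    have hsum : ∑ i, α i = r := by rw [hα]; simp [Fin.sum_univ_three]; omega
    have hb : bary r ((b : ℝ), (c : ℝ)) = fun i => (α i : ℝ) / r :=
      (bary_eq (l := fun i => (α i : ℝ) / r) hr0 (a := r - b - c) (by omega) (by simp [hα])
        (by simp [hα]) (by simp [hα])).symm
    have e : baryMap r (fun i => T.points (ρ i)) ((b : ℝ), (c : ℝ)) =
        pt T (fun j => ((pushWeights ρ α j : ℕ) : ℝ) / r) := by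
      rw [baryMap, ← sum_pushWeights_smul, pt, hb]
      refine Finset.sum_congr rfl fun j _ => ?_
      rw [congrFun (natCast_pushWeights ρ α) j]
      congr 1
      simp only [pushWeights, Finset.sum_div]
      refine Finset.sum_congr rfl fun i _ => ?_
      split_ifs <;> simp
    refine h _ ⟨pushWeights ρ α, by rw [sum_pushWeights, hsum], by rw [e]⟩ ?_
    rintro _ rfl
    rw [e, mem_subcell]
    have hs := sum_pushWeights ρ α
    rw [hsum] at hs
    refine ⟨_, fun i => by positivity, ?_, fun i hi => ?_, rfl⟩
    · rw [← Finset.sum_div, ← Nat.cast_sum, hs]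
      exact div_self (by positivity)
    · rw [pushWeights_eq_zero hρS α hi]; simp

theorem homothety_mem_subcell {r : ℕ} (hr : 0 < r) {S : Finset (Fin 3)} {α : Fin 3 → ℕ}
    (hα : ∑ l, α l = r - 1) (h : ∀ j ∉ S, α j = 0) {i : Fin 3} (hi : i ∈ S) :
    homothety T r α (T.points i) ∈ subcell T S := by
  rw [mem_subcell]
  refine ⟨fun j => ((α j : ℝ) + if j = i then 1 else 0) / r, fun j => ?_, ?_, fun j hj => ?_, ?_⟩
  · beta_reduce
    split_ifs <;> positivity
  · rw [← Finset.sum_div, Finset.sum_add_distrib, ← Nat.cast_sum, hα]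
    rw [Nat.cast_sub hr]
    simp
    positivity
  · have : j ≠ i := fun h => hj (h ▸ hi)
    simp [h j hj, this]
  · simp only [homothety, pt, add_div, add_smul, Finset.sum_add_distrib, Finset.smul_sum, smul_add]
    rw [add_comm]
    congr 1
    · refine Finset.sum_congr rfl fun j _ => ?_
      rw [smul_smul]; congr 1; ring
    · rw [Finset.sum_eq_single i]
      · simp
      · intro j _ hj; simp [hj]
      · simp

/-- A small edge contained in a proper subcell lies on the boundary of a region. -/
theorem edge_mem_dofs_of_card_le {r : ℕ} (hr : 2 ≤ r) {S : Finset (Fin 3)} (hS : S.card ≤ 2)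
    {α : Fin 3 → ℕ} (hα : ∑ l, α l = r - 1) (h : ∀ j ∉ S, α j = 0) {i j : Fin 3} (hi : i ∈ S)
    (hj : j ∈ S) (hij : i < j) :
    Cell.edge (homothety T r α (T.points i)) (homothety T r α (T.points j)) ∈ dofs T r 1 := by
  rw [edge_homothety_eq_gridEdge T (by omega) hα hij]
  refine gridEdge_mem_dofs T hr ?_
  have hSij : S = {i, j} := by
    symm
    refine Finset.eq_of_subset_of_card_le ?_ ?_
    · intro l hl
      rw [Finset.mem_insert, Finset.mem_singleton] at hl
      rcases hl with rfl | rfl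
      · exact hi
      · exact hj
    · rw [Finset.card_pair hij.ne]; exact hS
  have h' : ∀ l, l ≠ i → l ≠ j → α l = 0 := fun l h1 h2 => h l (by simp [hSij, h1, h2])
  rw [Fin.sum_univ_three] at hα
  unfold IsGoodEdge
  fin_cases i <;> fin_cases j <;> simp at hij h' ⊢
  · have := h' 2 (by decide) (by decide)
    omega
  · have := h' 1 (by decide) (by decide)
    omega
  · have := h' 0 (by decide) (by decide)
    omega

/-- The retraction need not preserve the order of the vertices, so the image of a small edge may be
oriented against the convention. -/
theorem weight_edge_symm (ω : Form 1) (p q : Plane) :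
    weight ω (.edge p q) = - weight ω (.edge q p) := by
  simp only [weight, ← oneFormAt_apply]
  rw [← intervalIntegral.integral_neg]
  have h := intervalIntegral.integral_comp_sub_left (a := 0) (b := 1)
    (fun t => oneFormAt ω (AffineMap.lineMap p q t) (q - p)) 1
  simp only [sub_zero, sub_self] at h
  rw [← h]
  refine intervalIntegral.integral_congr fun t _ => ?_
  beta_reduce
  rw [AffineMap.lineMap_apply_one_sub, ← map_neg, neg_sub]

theorem trace_one_form_eq_zero {r : ℕ} (hr : 2 ≤ r) {S : Finset (Fin 3)} (hS : S.Nonempty)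
    (hS2 : S.card ≤ 2) {ω : Form 1} (hω : ω ∈ polyForm (r - 1) 1)
    (h : ∀ c ∈ dofs T r 1, c.carrier ⊆ subcell T S → weight ω c = 0) : trace T S 1 ω = 0 := by
  have hr0 : 0 < r := by omega
  obtain ⟨ρ, hρS, hρ⟩ := exists_retraction hS
  have hconv : Convex ℝ (subcell T S) := convex_convexHull ℝ _
  have hlt : ∀ {α : Fin 3 → ℕ} {i j : Fin 3}, ∑ l, α l = r - 1 → (∀ j ∉ S, α j = 0) → i ∈ S →
      j ∈ S → i < j →
      weight ω (.edge (homothety T r α (T.points i)) (homothety T r α (T.points j))) = 0 :=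
    fun hα hα' hi hj hij => h _ (edge_mem_dofs_of_card_le T hr hS2 hα hα' hi hj hij)
      (hconv.segment_subset (homothety_mem_subcell T hr0 hα hα' hi)
        (homothety_mem_subcell T hr0 hα hα' hj))
  -- Under the retraction a small edge becomes a small edge of S, its reverse, or a point; the
  -- weight is zero in each case.
  have hall : ∀ {α : Fin 3 → ℕ} {i j : Fin 3}, ∑ l, α l = r - 1 → (∀ j ∉ S, α j = 0) → i ∈ S →
      j ∈ S →
      weight ω (.edge (homothety T r α (T.points i)) (homothety T r α (T.points j))) = 0 := by
    intro α i j hα hα' hi hj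
    rcases lt_trichotomy i j with hij | rfl | hij
    · exact hlt hα hα' hi hj hij
    · simp [weight, ← oneFormAt_apply]
    · rw [weight_edge_symm, hlt hα hα' hj hi hij, neg_zero]
  have hP : ∀ (α : Fin 3 → ℕ) (i : Fin 3),
      (1 / (r : ℝ)) • (T.points (ρ i) + ∑ l, (α l : ℝ) • T.points (ρ l)) =
        homothety T r (pushWeights ρ α) (T.points (ρ i)) := by
    intro α i
    rw [homothety, ← sum_pushWeights_smul]
    simp only [← congrFun (natCast_pushWeights ρ α)]
  have key := one_form_eq_zero_on_image hr hω (fun i => T.points (ρ i)) fun d b c hd => by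
    obtain ⟨a, ha⟩ : ∃ a, a + b + c + 1 = r := ⟨r - 1 - b - c, by have := hd.1; omega⟩
    have hsum : ∑ l, pushWeights ρ ![a, b, c] l = r - 1 := by
      rw [sum_pushWeights]; simp [Fin.sum_univ_three]; omega
    have hh := fun i => (homothety_baryMap (fun i => T.points (ρ i)) ha i).symm.trans
      (hP ![a, b, c] i)
    have h0 := hh 0
    have h1 := hh 1
    have h2 := hh 2
    simp only [Matrix.cons_val] at h0 h1 h2
    have hw := fun i j => hall (i := ρ i) (j := ρ j) hsum
      (fun j hj => pushWeights_eq_zero hρS ![a, b, c] hj) (hρS i) (hρS j)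
    fin_cases d
    · simp only [edgePt, Fin.zero_eta, Matrix.cons_val, add_zero]
      rw [h0, h1]; exact hw 0 1
    · simp only [edgePt, Fin.mk_one, Matrix.cons_val, add_zero]
      rw [h0, h2]; exact hw 0 2
    · simp only [edgePt, Fin.reduceFinMk, Matrix.cons_val, add_zero, sub_zero, add_sub_cancel_right]
      rw [h1, h2]; exact hw 1 2
  ext p v
  obtain ⟨z, hz⟩ := mem_subcell_eq_baryMap T hr0 hρ p.2
  rw [trace_apply, hz]
  obtain ⟨i₀, hi₀⟩ := hS
  have h3 : (fun i => (v i : Plane)) = ![(v 0 : Plane)] := by ext i : 1; fin_cases i; rfl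
  rw [h3, ← oneFormAt_apply]
  have hv : (v 0 : Plane) ∈ vectorSpan ℝ (T.points '' (S : Set (Fin 3))) := (v 0).2
  rw [vectorSpan_eq_span_vsub_set_right ℝ
    (Set.mem_image_of_mem T.points (Finset.mem_coe.2 hi₀))] at hv
  refine Submodule.span_induction
    (p := fun v _ => oneFormAt ω (baryMap r (fun i => T.points (ρ i)) z) v = 0) ?_ ?_ ?_ ?_ hv
  · rintro _ ⟨_, ⟨i, hi, rfl⟩, rfl⟩
    -- The form is known to vanish on vectors based at `T.points (ρ 0)`; subtracting two of them
    -- gives the vectors based at `i₀`.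
    have k1 := key z i
    have k2 := key z i₀
    rw [hρ i hi, map_sub, sub_eq_zero] at k1
    rw [hρ i₀ hi₀, map_sub, sub_eq_zero] at k2
    simp only [vsub_eq_sub]
    rw [map_sub, k1, k2, sub_self]
  · simp
  · intro v w _ _ hv hw
    rw [map_add, hv, hw, add_zero]
  · intro a v _ hv
    rw [map_smul, hv, smul_zero]

/-- The weights on the cells in a subcell determine the traces on the subcell. -/
theorem trace_eq_zero_of_weights {r : ℕ} (hr : 2 ≤ r) {S : Finset (Fin 3)} (hS : S.Nonempty)
    {k : ℕ} {ω : Form k} (hω : ω ∈ polyForm (r - k) k)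
    (h : ∀ c ∈ dofs T r k, c.carrier ⊆ subcell T S → weight ω c = 0) : trace T S k ω = 0 := by
  rcases le_or_gt S.card k with hk | hk
  · exact trace_eq_zero_of_card_le T hS hk ω
  · have h3 : S.card ≤ 3 := S.card_le_univ
    by_cases hcard : S.card = 3
    · obtain rfl : S = Finset.univ := (Finset.card_eq_iff_eq_univ S).1 hcard
      rw [eq_zero_of_weights T hr (by omega) hω fun c hc =>
        h c hc (carrier_subset_of_mem_dofs T hr hc), map_zero]
    · match k, hk with
      | 0, _ => exact trace_zero_form_eq_zero T hr hS hω h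
      | 1, _ => exact trace_one_form_eq_zero T hr hS (by omega) hω h
      | k + 2, hk => omega

/-! ## Minimality -/

section LinearAlgebra

variable {V W : Type*} [AddCommGroup V] [Module ℝ V] [AddCommGroup W] [Module ℝ W]
  (P : Submodule ℝ V)

theorem injective_of_eq_zero (f : P →ₗ[ℝ] W) (h : ∀ x, f x = 0 → x = 0) : Function.Injective f :=
  (injective_iff_map_eq_zero f).2 h

theorem surjective_of_injective_of_finrank_eq {ι : Type*} [Finite ι] [Module.Finite ℝ P]
    (f : P →ₗ[ℝ] (ι → ℝ)) (hf : Function.Injective f) (h : Module.finrank ℝ P = Nat.card ι) :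
    Function.Surjective f := by
  have := Fintype.ofFinite ι
  refine (LinearMap.injective_iff_surjective_of_finrank_eq_finrank ?_).1 hf
  rw [h, Module.finrank_fintype_fun_eq_card, Nat.card_eq_fintype_card]

/-- Both images are the quotient of `P` by the same kernel. `P` need not embed into the image of
`f`, as traces on a subcell forget part of the form. -/
theorem finrank_map_of_ker_eq {ι : Type*} [Finite ι] (f : V →ₗ[ℝ] W) (g : P →ₗ[ℝ] (ι → ℝ))
    (hg : Function.Surjective g) (h : ∀ x : P, f x = 0 ↔ g x = 0) :
    Module.finrank ℝ (P.map f) = Nat.card ι := by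
  have := Fintype.ofFinite ι
  have hker : LinearMap.ker (f.domRestrict P) = LinearMap.ker g := by
    ext x
    exact h x
  rw [← LinearMap.range_domRestrict, ((f.domRestrict P).quotKerEquivRange.symm.trans
    ((Submodule.quotEquivOfEq _ _ hker).trans g.quotKerEquivRange)).finrank_eq,
    LinearMap.range_eq_top.2 hg, finrank_top, Module.finrank_fintype_fun_eq_card,
    Nat.card_eq_fintype_card]

theorem finrank_map_of_eq_zero (f : V →ₗ[ℝ] W) (h : ∀ x : P, f x = 0 → x = 0) :
    Module.finrank ℝ (P.map f) = Module.finrank ℝ P := by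
  rw [← LinearMap.range_domRestrict]
  exact LinearMap.finrank_range_of_inj (injective_of_eq_zero P (f.domRestrict P) h)

end LinearAlgebra

/-- The weights of polynomial forms on all the cells. -/
noncomputable def weightMap {r : ℕ} (hr : 2 ≤ r) (k : ℕ) :
    polyForm (r - k) k →ₗ[ℝ] (dofs T r k → ℝ) where
  toFun ω c := weight (ω : Form k) c
  map_add' ω ω' := by
    ext c
    exact weight_add T hr ω.2 ω'.2 c.2
  map_smul' a ω := by
    ext c
    exact weight_smul a _ _

theorem weightMap_injective {r : ℕ} (hr : 2 ≤ r) {k : ℕ} (hk : k ≤ 2) :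
    Function.Injective (weightMap T hr k) := by
  refine injective_of_eq_zero _ _ fun ω hω => ?_
  exact Subtype.ext (eq_zero_of_weights T hr hk ω.2 fun c hc => congrFun hω ⟨c, hc⟩)

theorem finite_polyForm (T : Affine.Triangle ℝ Plane) {r : ℕ} (hr : 2 ≤ r) {k : ℕ} (hk : k ≤ 2) :
    Module.Finite ℝ (polyForm (r - k) k) := by
  have := (finite_dofs T hr k).to_subtype
  exact Module.Finite.of_injective _ (weightMap_injective T hr hk)

/-- Injectivity of the weights gives one inequality; the cell counts, compared with the independent
monomial forms, give the other. -/
theorem finrank_polyForm {r : ℕ} (hr : 2 ≤ r) {k : ℕ} (hk : k ≤ 2) :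
    Module.finrank ℝ (polyForm (r - k) k) = (dofs T r k).ncard := by
  have hfin := finite_polyForm T hr hk
  have := (finite_dofs T hr k).to_subtype
  have := Fintype.ofFinite (dofs T r k)
  refine le_antisymm ?_ ?_
  · have h := LinearMap.finrank_le_finrank_of_injective (weightMap_injective T hr hk)
    rwa [Module.finrank_fintype_fun_eq_card, ← Nat.card_eq_fintype_card] at h
  · interval_cases k
    · exact (ncard_dofs_zero_le T hr).trans (le_finrank_polyForm_zero _)
    · exact (ncard_dofs_one_le T hr).trans (le_finrank_polyForm_one _)
    · exact (ncard_dofs_two_le T hr).trans (le_finrank_polyForm_two _)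

theorem weightMap_surjective {r : ℕ} (hr : 2 ≤ r) {k : ℕ} (hk : k ≤ 2) :
    Function.Surjective (weightMap T hr k) := by
  have hfin := finite_polyForm T hr hk
  have := (finite_dofs T hr k).to_subtype
  exact surjective_of_injective_of_finrank_eq _ _ (weightMap_injective T hr hk)
    (finrank_polyForm T hr hk)

/-! ## The system -/

theorem subcell_empty : subcell T ∅ = ∅ := by simp [subcell]

theorem nonempty_of_carrier_subset {r : ℕ} (hr : 2 ≤ r) {k : ℕ} {c : Cell k}
    (hc : c ∈ dofs T r k) {S : Finset (Fin 3)} (hS : c.carrier ⊆ subcell T S) : S.Nonempty := by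
  rw [Finset.nonempty_iff_ne_empty]
  rintro rfl
  rw [subcell_empty] at hS
  exact (carrier_nonempty_of_mem_dofs T hr hc).ne_empty (Set.subset_empty_iff.1 hS)

/-- The polynomial forms with zero trace on the boundary of a subcell. -/
noncomputable def zeroBoundaryForms (r : ℕ) (S : Finset (Fin 3)) (k : ℕ) : Submodule ℝ (Form k) :=
  polyForm (r - k) k ⊓ ⨅ (S' : Finset (Fin 3)) (_ : S'.Nonempty ∧ S' ⊂ S),
    LinearMap.ker (trace T S' k)

theorem mem_zeroBoundaryForms {r : ℕ} {S : Finset (Fin 3)} {k : ℕ} {ω : Form k} :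
    ω ∈ zeroBoundaryForms T r S k ↔ ω ∈ polyForm (r - k) k ∧
      ∀ S' : Finset (Fin 3), S'.Nonempty → S' ⊂ S → trace T S' k ω = 0 := by
  simp only [zeroBoundaryForms, Submodule.mem_inf, Submodule.mem_iInf, LinearMap.mem_ker, and_imp]

/-- A cell in S not attached to S lies in a proper subcell, where the trace is zero and determines
the weight. -/
theorem weight_eq_zero_of_zeroBoundary {r : ℕ} (hr : 2 ≤ r) {S : Finset (Fin 3)} {k : ℕ}
    {ω : Form k} (hω : ω ∈ zeroBoundaryForms T r S k) {c : Cell k} (hc : c ∈ dofs T r k)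
    (hcS : c.carrier ⊆ subcell T S) (hcF : c ∉ system T r S k) : weight ω c = 0 := by
  have h : ∃ S' : Finset (Fin 3), S' ⊂ S ∧ c.carrier ⊆ subcell T S' := by
    by_contra! h
    exact hcF ⟨hc, hcS, h⟩
  obtain ⟨S', hS', hcS'⟩ := h
  have h0 := (mem_zeroBoundaryForms T).1 hω |>.2 S' (nonempty_of_carrier_subset T hr hc hcS') hS'
  rw [weight_congr T hr hc hcS' (ω' := 0) (by rw [h0, map_zero]), weight_zero]

theorem trace_eq_zero_of_zeroBoundary {r : ℕ} (hr : 2 ≤ r) {S : Finset (Fin 3)} (hS : S.Nonempty)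
    {k : ℕ} {ω : Form k} (hω : ω ∈ zeroBoundaryForms T r S k)
    (h : ∀ c ∈ system T r S k, weight ω c = 0) : trace T S k ω = 0 := by
  refine trace_eq_zero_of_weights T hr hS ((mem_zeroBoundaryForms T).1 hω).1 fun c hc hcS => ?_
  by_cases hcF : c ∈ system T r S k
  · exact h c hcF
  · exact weight_eq_zero_of_zeroBoundary T hr hω hc hcS hcF

theorem isPhysicalSysdofs_system {r : ℕ} (hr : 2 ≤ r) : IsPhysicalSysdofs T (system T r) := by
  intro S _ k _
  have hsub : system T r S k ⊆ dofs T r k := fun c hc => hc.1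
  exact ⟨(finite_dofs T hr k).subset hsub, fun c hc => ⟨isCell_of_mem_dofs T hr hc.1, hc.2.1⟩,
    (pairwiseDisjoint_dofs T hr k).subset hsub⟩

theorem isUnisolvent_system {r : ℕ} (hr : 2 ≤ r) : IsUnisolvent T r (system T r) := by
  rintro S hS k _ ω hω ⟨ω', hω', heq⟩ h
  rw [← heq]
  refine trace_eq_zero_of_zeroBoundary T hr hS hω' fun c hc => ?_
  rw [weight_congr T hr hc.1 hc.2.1 heq]
  exact h c hc

/-- On forms with zero boundary trace, the trace on S and the weights on the cells attached to S
have the same kernel, and these weights take arbitrary values. -/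
theorem isMinimal_system {r : ℕ} (hr : 2 ≤ r) : IsMinimal T r (system T r) := by
  intro S hS k hk
  have hk2 : k ≤ 2 := by
    have : S.card ≤ 3 := S.card_le_univ
    omega
  have hfin : (system T r S k).Finite := (finite_dofs T hr k).subset fun c hc => hc.1
  have := hfin.to_subtype
  let V := zeroBoundaryForms T r S k
  have hVp : V ≤ polyForm (r - k) k := inf_le_left
  let g : V →ₗ[ℝ] (system T r S k → ℝ) :=
    (LinearMap.pi fun c : system T r S k =>
      LinearMap.proj (R := ℝ) (φ := fun _ : dofs T r k => ℝ) ⟨(c : Cell k), c.2.1⟩).comp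
      ((weightMap T hr k).comp (Submodule.inclusion hVp))
  have hg : ∀ (ω : V) (c : system T r S k), g ω c = weight (ω : Form k) c := fun _ _ => rfl
  have hker : ∀ ω : V, trace T S k (ω : Form k) = 0 ↔ g ω = 0 := by
    intro ω
    constructor
    · intro h
      ext c
      have h' : trace T S k (ω : Form k) = trace T S k 0 := h.trans (map_zero _).symm
      exact (hg ω c).trans ((weight_congr T hr c.2.1 c.2.2.1 h').trans (weight_zero _))
    · intro h
      exact trace_eq_zero_of_zeroBoundary T hr hS ω.2 fun c hc => congrFun h ⟨c, hc⟩
  have hsurj : Function.Surjective g := by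
    intro y
    classical
    -- Weights are prescribed on all of T, with zero off the cells attached to S. All weights on a
    -- proper subcell of S are then zero, so the boundary traces vanish by unisolvence there.
    obtain ⟨ω, hω⟩ := weightMap_surjective T hr hk2
      fun c => if h : (c : Cell k) ∈ system T r S k then y ⟨c, h⟩ else 0
    have hω' : ∀ c (hc : c ∈ dofs T r k), weight (ω : Form k) c =
        if h : c ∈ system T r S k then y ⟨c, h⟩ else 0 := fun c hc => congrFun hω ⟨c, hc⟩
    have hωV : (ω : Form k) ∈ zeroBoundaryForms T r S k := by
      refine (mem_zeroBoundaryForms T).2 ⟨ω.2, fun S' hS' hSS' => ?_⟩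
      refine trace_eq_zero_of_weights T hr hS' ω.2 fun c hc hcS' => ?_
      rw [hω' c hc, dif_neg fun h => h.2.2 S' hSS' hcS']
    refine ⟨⟨ω, hωV⟩, ?_⟩
    ext c
    rw [hg]
    exact (hω' c c.2.1).trans (dif_pos c.2)
  exact (finrank_map_of_ker_eq V (trace T S k) g hsurj hker).symm

theorem total_system {r : ℕ} (hr : 2 ≤ r) (k : ℕ) :
    total (system T r) Finset.univ k = dofs T r k := by
  ext c
  simp only [total, Set.mem_iUnion, exists_prop]
  constructor
  · rintro ⟨S, -, hc⟩
    exact hc.1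
  · intro hc
    -- Only a minimal subcell containing the cell is needed; its uniqueness plays no role for the
    -- union.
    obtain ⟨S, hS, hmin⟩ := exists_minimal_of_wellFoundedLT
      (fun S : Finset (Fin 3) => c.carrier ⊆ subcell T S)
      ⟨Finset.univ, carrier_subset_of_mem_dofs T hr hc⟩
    refine ⟨S, ⟨nonempty_of_carrier_subset T hr hc hS, Finset.subset_univ S⟩, hc, hS,
      fun S' hS' h => ?_⟩
    exact hS'.2 (hmin h hS'.1)

theorem ncard_dofs_eq_finrank {r : ℕ} (hr : 2 ≤ r) {k : ℕ} (hk : k ≤ 2) :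
    (dofs T r k).ncard = Module.finrank ℝ (X T r Finset.univ k) := by
  rw [← finrank_polyForm T hr hk]
  refine (finrank_map_of_eq_zero (polyForm (r - k) k) (trace T Finset.univ k)
    fun ω hω => Subtype.ext (eq_zero_of_weights T hr hk ω.2 fun c hc => ?_)).symm
  have h : trace T Finset.univ k (ω : Form k) = trace T Finset.univ k 0 :=
    hω.trans (map_zero _).symm
  exact (weight_congr T hr hc (carrier_subset_of_mem_dofs T hr hc) h).trans (weight_zero _)

end PhysicalDofs

theorem theorem2 (T : Affine.Triangle ℝ PhysicalDofs.Plane) (r : ℕ) (hr : 2 ≤ r) :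
    -- `F` is a unisolvent and minimal physical system of degrees of freedom on the triangle
    -- and on its subcells
    PhysicalDofs.IsPhysicalSysdofs T (PhysicalDofs.system T r) ∧
    PhysicalDofs.IsUnisolvent T r (PhysicalDofs.system T r) ∧
    PhysicalDofs.IsMinimal T r (PhysicalDofs.system T r) ∧
    -- its cells on the whole triangle are those of the construction, they do not overlap, and
    -- they are unisolvent and minimal for the whole space `P_{r-k} Λ^k(T)`, `k = 0, 1, 2`
    ∀ k : ℕ, k ≤ 2 →
      PhysicalDofs.total (PhysicalDofs.system T r) Finset.univ k = PhysicalDofs.dofs T r k ∧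
      (PhysicalDofs.dofs T r k).Finite ∧
      (PhysicalDofs.dofs T r k).PairwiseDisjoint PhysicalDofs.Cell.inner ∧
      PhysicalDofs.Unisolves T r Finset.univ k (PhysicalDofs.X T r Finset.univ k)
        (PhysicalDofs.dofs T r k) ∧
      (PhysicalDofs.dofs T r k).ncard =
        Module.finrank ℝ (PhysicalDofs.X T r Finset.univ k) :=
  ⟨PhysicalDofs.isPhysicalSysdofs_system T hr, PhysicalDofs.isUnisolvent_system T hr,
    PhysicalDofs.isMinimal_system T hr, fun k hk =>
      ⟨PhysicalDofs.total_system T hr k, PhysicalDofs.finite_dofs T hr k,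
        PhysicalDofs.pairwiseDisjoint_dofs T hr k,
        fun _ hω _ h => by rw [PhysicalDofs.eq_zero_of_weights T hr hk hω h, map_zero],
        PhysicalDofs.ncard_dofs_eq_finrank T hr hk⟩⟩
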